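/- Let $d\ge 2$ and let $U\subset\mathbb R^d$ be a bounded Lipschitz domain. Let $\alpha\in C^{1,1}(\overline U)$ be real-valued with $\alpha>0$ on $\overline U$, and put $L_\alpha u=-\nabla\cdot(\alpha\nabla u)$. Let $\psi\in C^{1,1}(\overline U)$ be real-valued with $|\nabla\psi(x)|\ge c$ for all $x\in\overline U$ and some constant $c>0$, and with $\psi\ge 0$ on $\partial U$. For $\gamma>0$ set $\varphi=e^{\gamma\psi}$. Then there exist constants $\gamma_*\ge 1$, $\tau_*\ge 1$ and $C>0$ (depending only on $U,\alpha,\psi$) such that $$ \int_U\Big(\tau^3\gamma^4\varphi^3e^{2\tau\varphi}|u|^2+\tau\gamma^2e^{2\tau\varphi}|\nabla u|^2\Big)\,dx \le C\left(\int_U e^{2\tau\varphi}|L_\alpha u|^2\,dx+\int_{\partial U}\Big(\tau^3\gamma^3\varphi^3e^{2\tau\varphi}|u|^2+\tau\gamma\varphi e^{2\tau\varphi}|\nabla u|^2\Big)\,dS\right) $$ for all $\tau\ge\tau_*$, all $\gamma\ge\gamma_*$ and all complex-valued $u\in H^2(U)$. Here the derivatives of $u$ in $U$ are weak derivatives, $u$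 and $\nabla u$ on $\partial U$ are understood in the sense of traces, and $dS$ is the surface measure. -/

import Mathlib

open MeasureTheory Filter Topology
open scoped ENNReal NNReal ContDiff SchwartzMap

namespace Carleman

/-- Euclidean space `ℝ^d`. -/
abbrev E (d : ℕ) : Type := EuclideanSpace ℝ (Fin d)

/-- The `i`-th standard unit vector of `ℝ^d`. -/
noncomputable def unitVec {d : ℕ} (i : Fin d) : E d := EuclideanSpace.single i (1 : ℝ)

/-- `U` is an open set with Lipschitz boundary: near every boundary point `p`, after a choice of a
direction `e`, the set `U` is the region strictly above the graph of a Lipschitz function `g`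
defined on the hyperplane orthogonal to `e`. (Connectedness of `U` is not required.) -/
def IsLipschitzDomain {d : ℕ} (U : Set (E d)) : Prop :=
  IsOpen U ∧ ∀ p ∈ frontier U,
    ∃ (e : E d) (K : ℝ≥0) (g : (ℝ ∙ e)ᗮ → ℝ) (V : Set (E d)),
      ‖e‖ = 1 ∧ LipschitzWith K g ∧ IsOpen V ∧ p ∈ V ∧
      ∀ x ∈ V, (x ∈ U ↔ g ((ℝ ∙ e)ᗮ.orthogonalProjectionOnto x) < inner ℝ e x)

/-- The class `C^{1,1}(Ū)` of real-valued functions: `f` is continuous on `Ū`, differentiable in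
`U`, and its gradient is Lipschitz continuous on `U` (hence `∇f` extends uniquely to a Lipschitz
field on `Ū`). Only the values of `f` on `Ū` matter. -/
def IsC11 {d : ℕ} (U : Set (E d)) (f : E d → ℝ) : Prop :=
  ContinuousOn f (closure U) ∧ DifferentiableOn ℝ f U ∧
    ∃ K : ℝ≥0, LipschitzOnWith K (gradient f) U

/-- `w` is the weak partial derivative `∂ᵢ v` on the open set `U`: both functions are locally
integrable on `U` and `∫_U v ∂ᵢη = - ∫_U w η` for all test functions `η ∈ C_c^∞(U)`. -/
def HasWeakPartial {d : ℕ} (U : Set (E d)) (i : Fin d) (v w : E d → ℂ) : Prop :=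
  LocallyIntegrableOn v U ∧ LocallyIntegrableOn w U ∧
    ∀ η : E d → ℝ, ContDiff ℝ ∞ η → HasCompactSupport η → tsupport η ⊆ U →
      ∫ x in U, (fderiv ℝ η x (unitVec i)) • v x = - ∫ x in U, η x • w x

open Classical in
/-- The weak partial derivative `∂ᵢ v` on `U` (well defined up to null sets of `U`); it is `0` by
convention when `v` has no weak partial derivative in `L¹_loc(U)`. -/
noncomputable def weakPartial {d : ℕ} (U : Set (E d)) (i : Fin d) (v : E d → ℂ) : E d → ℂ :=
  if h : ∃ w, HasWeakPartial U i v w then h.choose else 0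

/-- The Euclidean norm squared `|∇v|²` of the weak gradient of `v` on `U`. -/
noncomputable def gradNormSq {d : ℕ} (U : Set (E d)) (v : E d → ℂ) (x : E d) : ℝ :=
  ∑ i, ‖weakPartial U i v x‖ ^ 2

/-- The operator `L_α u = -∇·(α∇u) = -∑ᵢ ∂ᵢ(α ∂ᵢ u)` on `U`, with weak derivatives. -/
noncomputable def ellipticOp {d : ℕ} (U : Set (E d)) (α : E d → ℝ) (u : E d → ℂ) : E d → ℂ :=
  fun x => - ∑ i, weakPartial U i (fun y => (α y : ℂ) * weakPartial U i u y) x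

/-- The Sobolev space `H²(U)` of complex-valued functions: restrictions to `U` of functions in
`H²(ℝ^d)`, the latter defined through the Fourier transform of tempered distributions. -/
def MemH2 {d : ℕ} (U : Set (E d)) (u : E d → ℂ) : Prop :=
  ∃ V : Lp ℂ 2 (volume : Measure (E d)),
    TemperedDistribution.MemSobolev 2 2 (V : 𝓢'(E d, ℂ)) ∧
    (V : E d → ℂ) =ᵐ[volume.restrict U] u

/-- The surface measure `dS` on `∂U`: the `(d-1)`-dimensional Hausdorff measure (normalized to
agree with Lebesgue measure on hyperplanes), restricted to `∂U`. -/
noncomputable def surfaceMeasure {d : ℕ} (U : Set (E d)) : Measure (E d) :=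
  (μHE[d - 1] : Measure (E d)).restrict (frontier U)

/-- `w ∈ L²(∂U)` is the boundary trace of `v ∈ H¹(U)`: there are smooth functions `vₙ` on `ℝ^d`
with `vₙ → v` in `H¹(U)` and `vₙ|_{∂U} → w` in `L²(∂U)`. -/
def IsTrace {d : ℕ} (U : Set (E d)) (v w : E d → ℂ) : Prop :=
  MemLp v 2 (volume.restrict U) ∧
  (∀ i, ∃ g, HasWeakPartial U i v g ∧ MemLp g 2 (volume.restrict U)) ∧
  MemLp w 2 (surfaceMeasure U) ∧
  ∃ vn : ℕ → E d → ℂ,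
    (∀ n, ContDiff ℝ ∞ (vn n)) ∧
    Tendsto (fun n => eLpNorm (fun x => vn n x - v x) 2 (volume.restrict U)) atTop (𝓝 0) ∧
    (∀ i, Tendsto (fun n => eLpNorm (fun x => fderiv ℝ (vn n) x (unitVec i) - weakPartial U i v x)
      2 (volume.restrict U)) atTop (𝓝 0)) ∧
    Tendsto (fun n => eLpNorm (fun x => vn n x - w x) 2 (surfaceMeasure U)) atTop (𝓝 0)

open Classical in
/-- The boundary trace of `v` on `∂U` (well defined up to null sets of `∂U` for `v ∈ H¹(U)`, `U` a
bounded Lipschitz domain); it is `0` by convention when `v` has no trace. -/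
noncomputable def trace {d : ℕ} (U : Set (E d)) (v : E d → ℂ) : E d → ℂ :=
  if h : ∃ w, IsTrace U v w then h.choose else 0

/-- `|∇u|²` on `∂U`, the components of `∇u` being taken in the sense of traces. -/
noncomputable def traceGradNormSq {d : ℕ} (U : Set (E d)) (u : E d → ℂ) (x : E d) : ℝ :=
  ∑ i, ‖trace U (weakPartial U i u) x‖ ^ 2

/-- The weight `φ = e^{γψ}`. -/
noncomputable def weight {d : ℕ} (γ : ℝ) (ψ : E d → ℝ) (x : E d) : ℝ := Real.exp (γ * ψ x)

end Carleman

/-! The estimate is proved for smooth functions by the multiplier method and extended to `H²(U)` by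
density. Put `v = e^{τφ}u`, `p = ∇v`, `Φ = ∇φ`, `N = |∇ψ|²`. Conjugation gives `e^{τφ}Δu = S - τM +
R` with `S = Δv + τ²|Φ|²v`, `M = 2Φ·p + hv`, `R = τ(h - Δφ)v`. A Rellich-type identity
(`hasFDerivAt_flux`) writes `S·M = div F - Q`, where `Q` is a quadratic form in `(v, p)`. With `h =
2γ²φN` the form `Q` is coercive for large `γ` and `τ` (`flux_coercive`). This is where `|∇ψ| ≥ c`
enters: the Hessian of `e^{γψ}` contains `γ²φ ∇ψ⊗∇ψ`, which dominates `γφ D²ψ`. The remainder `R` is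
of lower order in `τ` and is absorbed (`carleman_pointwise`). The function `h` involves only first
derivatives of `ψ`, unlike `Δφ`, so for `ψ` in `C^{1,1}` it is still locally Lipschitz and so is the
flux. All identities then hold almost everywhere, by Rademacher's theorem. The variable coefficient
costs one first-order term, since `αΔu` and `∇·(α∇u)` differ by `∇α·∇u`; large `γ` absorbs it
(`interior_bound`).

The boundary terms are wanted only up to a constant, so no normal vector and no exact divergence
theorem are needed. The flux is multiplied by a Lipschitz cutoff of slope `1/ε` supported inside
`U`. The error is `1/ε` times an integral over a strip of width comparable to `ε`, and in Lipschitz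
charts this is controlled by the surface integral as `ε → 0` (`exists_strip_le`,
`exists_lintegral_le_of_le_div`). The weight satisfies `φ ≥ 1` on the closure: `ψ` has no critical
point in `U`, so its minimum lies on the boundary, where `ψ ≥ 0`.

The coefficients are real, so real and imaginary parts can be treated separately
(`exists_complex_carleman`). For `u` in `H²(U)`, Bessel potentials of Schwartz functions approximate
`u` together with all derivatives up to order two. The trace inequality (`exists_trace_le`) carries
this convergence to the boundary, and both sides of the estimate converge (`MemH2.exists_approx`).
-/

namespace Carleman

/-! ### Measure theory in graph coordinates -/

section GraphCoordinates

variable {d : ℕ}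

/-- The point of the graph of `g` above `y`, in the direction `e`. -/
noncomputable def graphMap {e : E d} (g : (ℝ ∙ e)ᗮ → ℝ) (y : (ℝ ∙ e)ᗮ) : E d :=
  (y : E d) + g y • e

theorem proj_add_smul {e : E d} (y : (ℝ ∙ e)ᗮ) (t : ℝ) :
    (ℝ ∙ e)ᗮ.orthogonalProjectionOnto ((y : E d) + t • e) = y := by
  rw [map_add, map_smul, Submodule.orthogonalProjectionOnto_mem_subspace_eq_self,
    Submodule.orthogonalProjectionOnto_orthogonalComplement_singleton_eq_zero]
  simp

theorem inner_add_smul {e : E d} (he : ‖e‖ = 1) (y : (ℝ ∙ e)ᗮ) (t : ℝ) :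
    inner ℝ e ((y : E d) + t • e) = t := by
  have h := Submodule.mem_orthogonal_singleton_iff_inner_right.1 y.2
  rw [inner_add_right, h, inner_smul_right, real_inner_self_eq_norm_sq, he]
  simp

theorem eq_proj_add_smul {e : E d} (he : ‖e‖ = 1) (x : E d) :
    x = ((ℝ ∙ e)ᗮ.orthogonalProjectionOnto x : E d) + (inner ℝ e x : ℝ) • e := by
  have h := Submodule.starProjection_add_starProjection_orthogonal (K := ℝ ∙ e) x
  rw [Submodule.starProjection_unit_singleton ℝ he] at h
  conv_lhs => rw [← h]
  rw [add_comm]; rfl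

theorem lipschitzWith_graphMap {e : E d} (he : ‖e‖ = 1) {K : ℝ≥0} {g : (ℝ ∙ e)ᗮ → ℝ}
    (hg : LipschitzWith K g) : LipschitzWith (1 + K) (graphMap g) := by
  refine LipschitzWith.add (LipschitzWith.subtype_val _) ?_
  refine LipschitzWith.of_dist_le_mul fun x y => ?_
  rw [dist_eq_norm, ← sub_smul, norm_smul, he, mul_one, ← dist_eq_norm]
  exact hg.dist_le_mul x y

theorem finrank_perp {e : E d} (he : ‖e‖ = 1) : Module.finrank ℝ (ℝ ∙ e)ᗮ = d - 1 := by
  have he0 : e ≠ 0 := fun h => by simp [h] at he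
  have hd : d = (d - 1) + 1 := by
    rcases d with _ | d
    · exact absurd (Subsingleton.elim e 0) he0
    · rfl
  have : Fact (Module.finrank ℝ (E d) = (d - 1) + 1) := ⟨by simpa using hd⟩
  exact Submodule.finrank_orthogonal_span_singleton he0

theorem volume_perp {e : E d} (he : ‖e‖ = 1) :
    (volume : Measure (ℝ ∙ e)ᗮ) = μHE[d - 1] := by
  rw [← finrank_perp he]
  exact InnerProductSpace.euclideanHausdorffMeasure_eq_volume.symm

theorem proj_euclideanHausdorff_le (e : E d) (n : ℕ) (s : Set (E d)) :
    (μHE[n] : Measure (ℝ ∙ e)ᗮ) ((ℝ ∙ e)ᗮ.orthogonalProjectionOnto '' s) ≤ μHE[n] s := by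
  simp_rw [Measure.euclideanHausdorffMeasure_def, Measure.smul_apply]
  gcongr
  exact hausdorffMeasure_orthogonalProjectionOnto_le _ _ _ (Nat.cast_nonneg n)

theorem euclideanHausdorff_image_le {X Y : Type*} [EMetricSpace X] [EMetricSpace Y]
    [MeasurableSpace X] [BorelSpace X] [MeasurableSpace Y] [BorelSpace Y] {f : X → Y} {L : ℝ≥0}
    (hf : LipschitzWith L f) (n : ℕ) (s : Set X) :
    μHE[n] (f '' s) ≤ (L : ℝ≥0∞) ^ n * μHE[n] s := by
  simp_rw [Measure.euclideanHausdorffMeasure_def, Measure.smul_apply]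
  have := hf.hausdorffMeasure_image_le (Nat.cast_nonneg n) s
  rw [ENNReal.rpow_natCast] at this
  calc _ ≤ (_ : ℝ≥0) • ((L : ℝ≥0∞) ^ n * μH[n] s) := by gcongr
    _ = _ := by rw [mul_smul_comm]

theorem proj_graphMap {e : E d} (g : (ℝ ∙ e)ᗮ → ℝ) (y : (ℝ ∙ e)ᗮ) :
    (ℝ ∙ e)ᗮ.orthogonalProjectionOnto (graphMap g y) = y := proj_add_smul y _

/-- Orthogonal projection is 1-Lipschitz and inverts `graphMap g`, so passing from the graph to the
hyperplane cannot increase Hausdorff measure. With the converse `restrict_graphMap_image_le`, where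
`graphMap g` is `(1 + K)`-Lipschitz, this takes the place of the area formula. -/
theorem map_graphMap_le {e : E d} (he : ‖e‖ = 1) {K : ℝ≥0} {g : (ℝ ∙ e)ᗮ → ℝ}
    (hg : LipschitzWith K g) {S : Set (E d)} {A : Set (ℝ ∙ e)ᗮ}
    (hS : ∀ y ∈ A, graphMap g y ∈ S) :
    (volume.restrict A).map (graphMap g) ≤ (μHE[d - 1] : Measure (E d)).restrict S := by
  have hm := (lipschitzWith_graphMap he hg).continuous.measurable
  refine Measure.le_iff.2 fun s hs => ?_
  rw [Measure.map_apply hm hs, Measure.restrict_apply (hm hs), Measure.restrict_apply hs,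
    volume_perp he]
  refine le_trans (measure_mono ?_) (proj_euclideanHausdorff_le e _ _)
  intro y hy
  exact ⟨graphMap g y, ⟨hy.1, hS y hy.2⟩, proj_graphMap g y⟩

theorem restrict_graphMap_image_le {e : E d} (he : ‖e‖ = 1) {K : ℝ≥0} {g : (ℝ ∙ e)ᗮ → ℝ}
    (hg : LipschitzWith K g) {S : Set (E d)} {A : Set (ℝ ∙ e)ᗮ}
    (hS : S ⊆ graphMap g '' A) :
    (μHE[d - 1] : Measure (E d)).restrict S
      ≤ (((1 + K : ℝ≥0) : ℝ≥0∞) ^ (d - 1)) • (volume.restrict A).map (graphMap g) := by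
  have hm := (lipschitzWith_graphMap he hg).continuous.measurable
  refine Measure.le_iff.2 fun s hs => ?_
  rw [Measure.smul_apply, Measure.map_apply hm hs, Measure.restrict_apply (hm hs),
    Measure.restrict_apply hs, volume_perp he]
  refine le_trans (measure_mono ?_)
    (euclideanHausdorff_image_le (lipschitzWith_graphMap he hg) _ _)
  rintro x ⟨hx, hxS⟩
  obtain ⟨y, hy, rfl⟩ := hS hxS
  exact ⟨y, ⟨hx, hy⟩, rfl⟩

/-- The splitting of `ℝ^d` into the line spanned by `e` and its orthogonal complement. -/
noncomputable def splitEquiv {e : E d} (he : ‖e‖ = 1) : ((ℝ ∙ e)ᗮ × ℝ) ≃L[ℝ] E d :=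
  LinearEquiv.toContinuousLinearEquiv
    { toFun := fun z => (z.1 : E d) + z.2 • e
      map_add' := fun a b => by simp [add_smul]; abel
      map_smul' := fun c a => by simp [mul_smul]
      invFun := fun x => ((ℝ ∙ e)ᗮ.orthogonalProjectionOnto x, inner ℝ e x)
      left_inv := fun z => by
        simp only [proj_add_smul, inner_add_smul he]
      right_inv := fun x => (eq_proj_add_smul he x).symm }

theorem splitEquiv_apply {e : E d} (he : ‖e‖ = 1) (z : (ℝ ∙ e)ᗮ × ℝ) :
    splitEquiv he z = (z.1 : E d) + z.2 • e := rfl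

/-- Uniqueness of Haar measure up to a scalar. The scalar is left uncomputed because every later
estimate absorbs constants. -/
theorem exists_volume_eq_map_split {e : E d} (he : ‖e‖ = 1) :
    ∃ c : ℝ≥0, c ≠ 0 ∧ (volume : Measure (E d)) =
      c • ((volume : Measure (ℝ ∙ e)ᗮ).prod (volume : Measure ℝ)).map (splitEquiv he) := by
  have : (((volume : Measure (ℝ ∙ e)ᗮ).prod (volume : Measure ℝ)).map
    (splitEquiv he)).IsAddHaarMeasure := ContinuousLinearEquiv.isAddHaarMeasure_map _ _
  refine ⟨_, ?_, Measure.isAddLeftInvariant_eq_smul _ _⟩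
  exact (Measure.addHaarScalarFactor_pos_of_isAddHaarMeasure _ _).ne'

/-- Tonelli in the splitting, followed by the translation of the height variable by `g y`. This
direction needs no measurability of `f`; the reverse one does. -/
theorem lintegral_graph_le {e : E d} (he : ‖e‖ = 1) :
    ∃ c : ℝ≥0∞, c ≠ ⊤ ∧ ∀ (g : (ℝ ∙ e)ᗮ → ℝ) (f : E d → ℝ≥0∞),
      ∫⁻ x, f x ≤ c * ∫⁻ y : (ℝ ∙ e)ᗮ, ∫⁻ t : ℝ, f (graphMap g y + t • e) := by
  obtain ⟨c, -, hc⟩ := exists_volume_eq_map_split he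
  refine ⟨c, ENNReal.coe_ne_top, fun g f => ?_⟩
  rw [hc, lintegral_smul_measure]
  change (c : ℝ≥0∞) * _ ≤ _
  gcongr
  have : ∫⁻ x, f x ∂(((volume : Measure (ℝ ∙ e)ᗮ).prod (volume : Measure ℝ)).map (splitEquiv he))
      = ∫⁻ z, f (splitEquiv he z) ∂((volume : Measure (ℝ ∙ e)ᗮ).prod (volume : Measure ℝ)) :=
    lintegral_map_equiv f (splitEquiv he).toHomeomorph.toMeasurableEquiv
  rw [this]
  refine (lintegral_prod_le _).trans (le_of_eq ?_)
  congr 1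
  ext y
  rw [← lintegral_add_left_eq_self _ (g y)]
  congr 1
  ext t
  simp only [splitEquiv_apply, graphMap, add_smul, add_assoc]

theorem lintegral_graph_ge {e : E d} (he : ‖e‖ = 1) :
    ∃ c : ℝ≥0∞, c ≠ ⊤ ∧ ∀ (g : (ℝ ∙ e)ᗮ → ℝ) (f : E d → ℝ≥0∞), Measurable f →
      ∫⁻ y : (ℝ ∙ e)ᗮ, ∫⁻ t : ℝ, f (graphMap g y + t • e) ≤ c * ∫⁻ x, f x := by
  obtain ⟨c, hc0, hc⟩ := exists_volume_eq_map_split he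
  refine ⟨(c : ℝ≥0∞)⁻¹, by simpa using hc0, fun g f hf => ?_⟩
  conv_rhs => rw [hc, lintegral_smul_measure]
  change _ ≤ _ * ((c : ℝ≥0∞) * _)
  rw [← mul_assoc, ENNReal.inv_mul_cancel (by simpa using hc0) ENNReal.coe_ne_top, one_mul]
  have : ∫⁻ x, f x ∂(((volume : Measure (ℝ ∙ e)ᗮ).prod (volume : Measure ℝ)).map (splitEquiv he))
      = ∫⁻ z, f (splitEquiv he z) ∂((volume : Measure (ℝ ∙ e)ᗮ).prod (volume : Measure ℝ)) :=
    lintegral_map_equiv f (splitEquiv he).toHomeomorph.toMeasurableEquiv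
  rw [this, lintegral_prod (fun z => f (splitEquiv he z))
    (hf.comp (splitEquiv he).continuous.measurable).aemeasurable]
  refine le_of_eq ?_
  congr 1
  ext y
  rw [← lintegral_add_left_eq_self (fun t => f (splitEquiv he (y, t))) (g y)]
  congr 1
  ext t
  simp only [splitEquiv_apply, graphMap, add_smul, add_assoc]

end GraphCoordinates

end Carleman

namespace Carleman

/-! ### Lipschitz boundary charts -/

section BoundaryCharts

variable {d : ℕ} {U V : Set (E d)} {e : E d} {K : ℝ≥0} {g : (ℝ ∙ e)ᗮ → ℝ}

theorem graphMap_add_smul (g : (ℝ ∙ e)ᗮ → ℝ) (y : (ℝ ∙ e)ᗮ) (t : ℝ) :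
    graphMap g y + t • e = (y : E d) + (g y + t) • e := by
  simp only [graphMap, add_smul, add_assoc]

theorem graphMap_add_smul_mem (he : ‖e‖ = 1)
    (hUV : ∀ x ∈ V, (x ∈ U ↔ g ((ℝ ∙ e)ᗮ.orthogonalProjectionOnto x) < inner ℝ e x))
    {y : (ℝ ∙ e)ᗮ} {t : ℝ} (ht : 0 < t) (hy : graphMap g y + t • e ∈ V) :
    graphMap g y + t • e ∈ U := by
  rw [hUV _ hy, graphMap_add_smul, proj_add_smul, inner_add_smul he]
  linarith

theorem graphMap_mem_frontier (he : ‖e‖ = 1) (hU : IsOpen U) (hV : IsOpen V)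
    (hUV : ∀ x ∈ V, (x ∈ U ↔ g ((ℝ ∙ e)ᗮ.orthogonalProjectionOnto x) < inner ℝ e x))
    {y : (ℝ ∙ e)ᗮ} (hy : graphMap g y ∈ V) : graphMap g y ∈ frontier U := by
  rw [hU.frontier_eq]
  constructor
  · have hc : Tendsto (fun t : ℝ => graphMap g y + t • e) (𝓝[>] 0) (𝓝 (graphMap g y)) := by
      have : ContinuousAt (fun t : ℝ => graphMap g y + t • e) 0 := by fun_prop
      have h := this.tendsto
      simp only [zero_smul, add_zero] at h
      exact h.mono_left nhdsWithin_le_nhds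
    refine mem_closure_of_tendsto hc ?_
    filter_upwards [hc.eventually (hV.mem_nhds hy), self_mem_nhdsWithin] with t h1 h2
    exact graphMap_add_smul_mem he hUV h2 h1
  · rw [hUV _ hy]
    have h0 := graphMap_add_smul g y 0
    rw [zero_smul, add_zero, add_zero] at h0
    rw [h0, proj_add_smul, inner_add_smul he]
    exact lt_irrefl _

theorem eq_graphMap_of_mem_frontier (he : ‖e‖ = 1) (hU : IsOpen U) (hV : IsOpen V)
    (hg : LipschitzWith K g)
    (hUV : ∀ x ∈ V, (x ∈ U ↔ g ((ℝ ∙ e)ᗮ.orthogonalProjectionOnto x) < inner ℝ e x))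
    {x : E d} (hx : x ∈ V) (hxU : x ∈ frontier U) :
    graphMap g ((ℝ ∙ e)ᗮ.orthogonalProjectionOnto x) = x := by
  rw [hU.frontier_eq] at hxU
  have h1 : inner ℝ e x ≤ g ((ℝ ∙ e)ᗮ.orthogonalProjectionOnto x) := by
    have := hxU.2
    rw [hUV _ hx] at this
    exact not_lt.1 this
  have h2 : g ((ℝ ∙ e)ᗮ.orthogonalProjectionOnto x) ≤ inner ℝ e x := by
    by_contra! hlt
    have hgc := hg.continuous
    have ho : IsOpen (V ∩ {z | inner ℝ e z < g ((ℝ ∙ e)ᗮ.orthogonalProjectionOnto z)}) :=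
      hV.inter (isOpen_lt (by fun_prop) (by fun_prop))
    obtain ⟨z, ⟨hzV, hz⟩, hzU⟩ := mem_closure_iff.1 hxU.1 _ ho ⟨hx, hlt⟩
    have hz' := (hUV z hzV).1 hzU
    exact lt_asymm hz hz'
  conv_rhs => rw [eq_proj_add_smul he x]
  rw [graphMap, le_antisymm h2 h1]

/-- The height above the graph is a `(1 + K)`-Lipschitz function of the point and is nonpositive at
points of the chart outside `U`. Distance to the complement therefore controls height. -/
theorem graph_height_le (he : ‖e‖ = 1) (hg : LipschitzWith K g)
    (hUV : ∀ x ∈ V, (x ∈ U ↔ g ((ℝ ∙ e)ᗮ.orthogonalProjectionOnto x) < inner ℝ e x))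
    {y : (ℝ ∙ e)ᗮ} {t : ℝ} {z : E d} (hz : z ∈ V) (hzU : z ∉ U) :
    t ≤ (1 + K) * dist (graphMap g y + t • e) z := by
  rw [hUV _ hz, not_lt] at hzU
  have h1 : inner ℝ e (graphMap g y + t • e) = g y + t := by
    rw [graphMap_add_smul, inner_add_smul he]
  have h2 : (ℝ ∙ e)ᗮ.orthogonalProjectionOnto (graphMap g y + t • e) = y := by
    rw [graphMap_add_smul, proj_add_smul]
  set x := graphMap g y + t • e
  have h3 : inner ℝ e x - inner ℝ e z ≤ dist x z := by
    rw [← inner_sub_right, dist_eq_norm]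
    simpa [he] using real_inner_le_norm e (x - z)
  have h4 : g ((ℝ ∙ e)ᗮ.orthogonalProjectionOnto z) - g y ≤ K * dist x z := by
    have := hg.dist_le_mul ((ℝ ∙ e)ᗮ.orthogonalProjectionOnto z) y
    rw [Real.dist_eq] at this
    refine (le_abs_self _).trans (this.trans ?_)
    gcongr
    rw [← h2, dist_comm x z]
    simpa using ((ℝ ∙ e)ᗮ.lipschitzWith_orthogonalProjectionOnto).dist_le_mul z x
  linarith

end BoundaryCharts

/-! ### Integrals over thin strips along the boundary -/

section Strip

variable {d : ℕ}

/-- The integral over the part in `O` of the inner strip of width `ε` along the boundary is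
controlled by `ε` times the boundary integral. -/
def StripBound (U O : Set (E d)) : Prop :=
  ∃ C : ℝ≥0∞, C ≠ ⊤ ∧ ∀ F : E d → ℝ, Continuous F → ∀ η : ℝ, 0 < η → ∃ ε₀ : ℝ, 0 < ε₀ ∧
    ∀ ε : ℝ, 0 < ε → ε < ε₀ →
      ∫⁻ x in U ∩ O ∩ {x | Metric.infDist x Uᶜ ≤ ε}, ‖F x‖ₑ
        ≤ ENNReal.ofReal ε * (C * (∫⁻ x, ‖F x‖ₑ ∂surfaceMeasure U) + ENNReal.ofReal η)

theorem StripBound.union {U O O' : Set (E d)} (h : StripBound U O) (h' : StripBound U O') :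
    StripBound U (O ∪ O') := by
  obtain ⟨C, hC, h⟩ := h
  obtain ⟨C', hC', h'⟩ := h'
  refine ⟨C + C', by simp [hC, hC'], fun F hF η hη => ?_⟩
  obtain ⟨ε₀, hε₀, h⟩ := h F hF (η / 2) (by positivity)
  obtain ⟨ε₁, hε₁, h'⟩ := h' F hF (η / 2) (by positivity)
  refine ⟨min ε₀ ε₁, lt_min hε₀ hε₁, fun ε h1 h2 => ?_⟩
  rw [Set.inter_union_distrib_left, Set.union_inter_distrib_right]
  refine (lintegral_union_le _ _ _).trans ?_
  refine (add_le_add (h ε h1 (h2.trans_le (min_le_left _ _)))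
    (h' ε h1 (h2.trans_le (min_le_right _ _)))).trans (le_of_eq ?_)
  have : ENNReal.ofReal η = ENNReal.ofReal (η / 2) + ENNReal.ofReal (η / 2) := by
    rw [← ENNReal.ofReal_add (by positivity) (by positivity), add_halves]
  rw [this]
  ring

/-- In a chart the strip of width `ε` lies in the set of heights `0 < t ≤ (1 + K)ε`. There `F`
differs from its value at the foot point on the boundary by a small uniform amount, so integrating
in `t` produces the factor `ε` times a surface integral. -/
theorem stripBound_ball {U : Set (E d)} (hU : IsLipschitzDomain U) (hUb : Bornology.IsBounded U)
    (hUc : Uᶜ.Nonempty) {p : E d} (hp : p ∈ frontier U) :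
    ∃ r > 0, StripBound U (Metric.ball p r) := by
  obtain ⟨hUo, hU⟩ := hU
  obtain ⟨e, K, g, V, he, hg, hV, hpV, hUV⟩ := hU p hp
  obtain ⟨R, hR, hRV⟩ := Metric.isOpen_iff.1 hV p hpV
  obtain ⟨c, hc, hcle⟩ := lintegral_graph_le he
  set L : ℝ := 1 + K with hL
  have hL1 : 1 ≤ L := by simp [hL]
  have hL0 : 0 < L := by linarith
  have hΓ := (lipschitzWith_graphMap he hg).continuous
  set A : Set (ℝ ∙ e)ᗮ := graphMap g ⁻¹' (frontier U ∩ Metric.ball p R) with hA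
  have hAm : MeasurableSet A :=
    hΓ.measurable (isClosed_frontier.measurableSet.inter Metric.isOpen_ball.measurableSet)
  have hAfin : volume A ≠ ⊤ := by
    refine ((measure_mono ?_).trans_lt (measure_ball_lt_top (μ := volume)
      (x := (ℝ ∙ e)ᗮ.orthogonalProjectionOnto p) (r := R))).ne
    intro y hy
    rw [Metric.mem_ball, ← proj_graphMap g y]
    refine lt_of_le_of_lt ?_ (Metric.mem_ball.1 hy.2)
    simpa using ((ℝ ∙ e)ᗮ.lipschitzWith_orthogonalProjectionOnto).dist_le_mul (graphMap g y) p
  refine ⟨R / 2, by positivity, c * ENNReal.ofReal L, ENNReal.mul_ne_top hc ENNReal.ofReal_ne_top,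
    fun F hF η hη => ?_⟩
  -- `ρ` is the allowed oscillation of `F`, scaled so that its integral over the base `A` costs at
  -- most `η`. The `+ 1` keeps the denominator positive.
  set ρ : ℝ := η / ((c * ENNReal.ofReal L * volume A).toReal + 1) with hρ
  have hρ0 : 0 < ρ := by positivity
  have hρle : c * ENNReal.ofReal L * volume A * ENNReal.ofReal ρ ≤ ENNReal.ofReal η := by
    have hfin : c * ENNReal.ofReal L * volume A ≠ ⊤ :=
      ENNReal.mul_ne_top (ENNReal.mul_ne_top hc ENNReal.ofReal_ne_top) hAfin
    rw [← ENNReal.ofReal_toReal hfin, ← ENNReal.ofReal_mul ENNReal.toReal_nonneg]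
    refine ENNReal.ofReal_le_ofReal ?_
    rw [hρ, mul_div_assoc', div_le_iff₀ (by positivity)]
    nlinarith [ENNReal.toReal_nonneg (a := c * ENNReal.ofReal L * volume A)]
  have huc := hUb.isCompact_closure.uniformContinuousOn_of_continuous hF.continuousOn
  obtain ⟨δ, hδ, hδF⟩ := Metric.uniformContinuousOn_iff.1 huc ρ hρ0
  refine ⟨min (R / (2 * L)) (δ / L), by positivity, fun ε hε hεlt => ?_⟩
  have hε1 : L * ε < R / 2 := by
    have := hεlt.trans_le (min_le_left _ _)
    rw [lt_div_iff₀ (by positivity)] at this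
    linarith
  have hε2 : L * ε < δ := by
    have := hεlt.trans_le (min_le_right _ _)
    rw [lt_div_iff₀ (by positivity)] at this
    linarith
  have hms : MeasurableSet (U ∩ Metric.ball p (R / 2) ∩ {x | Metric.infDist x Uᶜ ≤ ε}) :=
    (hUo.measurableSet.inter Metric.isOpen_ball.measurableSet).inter
      (isClosed_le (Metric.continuous_infDist_pt _) continuous_const).measurableSet
  have key : ∀ (y : (ℝ ∙ e)ᗮ) (t : ℝ),
      (U ∩ Metric.ball p (R / 2) ∩ {x | Metric.infDist x Uᶜ ≤ ε}).indicator (fun x => ‖F x‖ₑ)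
        (graphMap g y + t • e)
      ≤ A.indicator (fun y => ‖F (graphMap g y)‖ₑ + ENNReal.ofReal ρ) y *
        (Set.Ioc 0 (L * ε)).indicator 1 t := by
    intro y t
    by_cases hx : graphMap g y + t • e ∈
        U ∩ Metric.ball p (R / 2) ∩ {x | Metric.infDist x Uᶜ ≤ ε}
    swap
    · rw [Set.indicator_of_notMem hx]; exact zero_le
    obtain ⟨⟨hxU, hxb⟩, hxd⟩ := hx
    -- The nearest exterior point is within `ε ≤ L * ε < R / 2`, hence still in the chart, so
    -- `graph_height_le` bounds `t` by `L * ε`. The same margin keeps the foot point `graphMap g y`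
    -- in the ball of radius `R`.
    obtain ⟨z, hzU, hz⟩ := hUo.isClosed_compl.exists_infDist_eq_dist hUc (graphMap g y + t • e)
    have hxd' : dist (graphMap g y + t • e) z ≤ ε := hz ▸ hxd
    have hεL : ε ≤ L * ε := by nlinarith
    have hxV : graphMap g y + t • e ∈ V :=
      hRV (Metric.ball_subset_ball (by linarith) hxb)
    rw [Metric.mem_ball] at hxb
    have hzV : z ∈ V := by
      apply hRV
      rw [Metric.mem_ball]
      have := dist_triangle_left z p (graphMap g y + t • e)
      linarith
    have ht0 : 0 < t := by
      have := (hUV _ hxV).1 hxU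
      rw [graphMap_add_smul, proj_add_smul, inner_add_smul he] at this
      linarith
    have ht1 : t ≤ L * ε :=
      (graph_height_le he hg hUV hzV hzU).trans (by rw [← hL]; gcongr)
    have hdist : dist (graphMap g y + t • e) (graphMap g y) = t := by
      rw [dist_eq_norm, add_sub_cancel_left, norm_smul, he, mul_one, Real.norm_of_nonneg ht0.le]
    have hyb : graphMap g y ∈ Metric.ball p R := by
      rw [Metric.mem_ball]
      have := dist_triangle_left (graphMap g y) p (graphMap g y + t • e)
      rw [hdist] at this
      linarith
    have hyA : y ∈ A := ⟨graphMap_mem_frontier he hUo hV hUV (hRV hyb), hyb⟩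
    rw [Set.indicator_of_mem (by exact ⟨⟨hxU, hxb⟩, hxd⟩), Set.indicator_of_mem hyA,
      Set.indicator_of_mem (by exact ⟨ht0, ht1⟩), Pi.one_apply, mul_one]
    have hFd := hδF _ (subset_closure hxU) _ (frontier_subset_closure hyA.1)
      (by rw [hdist]; linarith)
    calc ‖F (graphMap g y + t • e)‖ₑ
        = ‖F (graphMap g y) + (F (graphMap g y + t • e) - F (graphMap g y))‖ₑ := by
          rw [add_sub_cancel]
      _ ≤ ‖F (graphMap g y)‖ₑ + ‖F (graphMap g y + t • e) - F (graphMap g y)‖ₑ :=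
          enorm_add_le _ _
      _ ≤ _ := by
          gcongr
          rw [← ofReal_norm, ← dist_eq_norm]
          exact ENNReal.ofReal_le_ofReal hFd.le
  rw [← lintegral_indicator hms]
  calc _ ≤ c * ∫⁻ y : (ℝ ∙ e)ᗮ, ∫⁻ t : ℝ, _ := hcle g _
    _ ≤ c * ∫⁻ y : (ℝ ∙ e)ᗮ, ∫⁻ t : ℝ,
        A.indicator (fun y => ‖F (graphMap g y)‖ₑ + ENNReal.ofReal ρ) y *
        (Set.Ioc 0 (L * ε)).indicator 1 t := by
        gcongr with y t
        exact key y t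
    _ = c * ∫⁻ y : (ℝ ∙ e)ᗮ, A.indicator (fun y => ‖F (graphMap g y)‖ₑ + ENNReal.ofReal ρ) y *
        ENNReal.ofReal (L * ε) := by
        congr 2
        ext y
        rw [lintegral_const_mul _ (measurable_one.indicator measurableSet_Ioc),
          lintegral_indicator_one measurableSet_Ioc, Real.volume_Ioc, sub_zero]
    _ = c * (((∫⁻ y in A, ‖F (graphMap g y)‖ₑ) + ENNReal.ofReal ρ * volume A) *
          ENNReal.ofReal (L * ε)) := by
        have hm : Measurable fun y => ‖F (graphMap g y)‖ₑ := (hF.comp hΓ).enorm.measurable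
        rw [lintegral_mul_const _ ((hm.add_const _).indicator hAm), lintegral_indicator hAm,
          lintegral_add_left hm, lintegral_const, Measure.restrict_apply_univ]
    _ ≤ c * (((∫⁻ x, ‖F x‖ₑ ∂surfaceMeasure U) + ENNReal.ofReal ρ * volume A) *
          ENNReal.ofReal (L * ε)) := by
        gcongr
        have h1 := map_graphMap_le he hg (S := frontier U) (A := A) fun y hy => hy.1
        have h2 := lintegral_mono' h1 (le_refl fun x => ‖F x‖ₑ)
        rwa [lintegral_map hF.enorm.measurable hΓ.measurable] at h2
    _ = ENNReal.ofReal ε * (c * ENNReal.ofReal L * (∫⁻ x, ‖F x‖ₑ ∂surfaceMeasure U) +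
          c * ENNReal.ofReal L * volume A * ENNReal.ofReal ρ) := by
        rw [ENNReal.ofReal_mul hL0.le]
        ring
    _ ≤ _ := by gcongr

/-- Compactness of the boundary gives a neighbourhood `O` covered by finitely many charts, and a
sufficiently thin strip lies inside `O`. -/
theorem exists_strip_le {U : Set (E d)} (hU : IsLipschitzDomain U) (hUb : Bornology.IsBounded U)
    (hUc : Uᶜ.Nonempty) : StripBound U Set.univ := by
  have hK : IsCompact (frontier U) := hUb.isCompact_closure.of_isClosed_subset isClosed_frontier
    frontier_subset_closure
  have hO : ∃ O : Set (E d), IsOpen O ∧ frontier U ⊆ O ∧ StripBound U O := by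
    refine hK.induction_on (p := fun s => ∃ O : Set (E d), IsOpen O ∧ s ⊆ O ∧ StripBound U O)
      ?_ ?_ ?_ ?_
    · exact ⟨∅, isOpen_empty, le_rfl, 0, by simp, fun F _ η _ => ⟨1, one_pos, by simp⟩⟩
    · rintro s t hst ⟨O, h1, h2, h3⟩
      exact ⟨O, h1, hst.trans h2, h3⟩
    · rintro s t ⟨O, h1, h2, h3⟩ ⟨O', h1', h2', h3'⟩
      exact ⟨O ∪ O', h1.union h1', Set.union_subset_union h2 h2', h3.union h3'⟩
    · intro p hp
      obtain ⟨r, hr, h⟩ := stripBound_ball hU hUb hUc hp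
      exact ⟨Metric.ball p r, mem_nhdsWithin_of_mem_nhds (Metric.ball_mem_nhds p hr), _,
        Metric.isOpen_ball, le_rfl, h⟩
  obtain ⟨O, hOo, hOs, C, hC, h⟩ := hO
  obtain ⟨δ, hδ, hδO⟩ := hK.exists_cthickening_subset_open hOo hOs
  refine ⟨C, hC, fun F hF η hη => ?_⟩
  obtain ⟨ε₀, hε₀, h⟩ := h F hF η hη
  refine ⟨min ε₀ δ, lt_min hε₀ hδ, fun ε h1 h2 => le_trans (lintegral_mono_set ?_)
    (h ε h1 (h2.trans_le (min_le_left _ _)))⟩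
  rintro x ⟨⟨hxU, -⟩, hx⟩
  refine ⟨⟨hxU, hδO ?_⟩, hx⟩
  obtain ⟨z, hzU, hz⟩ := hU.1.isClosed_compl.exists_infDist_eq_dist hUc x
  -- The strip is defined by distance to the complement, but the thickening by distance to the
  -- boundary. A segment from a point of `U` to an exterior point is connected and so meets the
  -- boundary.
  have hconn : (segment ℝ x z ∩ frontier U).Nonempty := by
    by_contra! hne
    have hz' : z ∉ closure U := fun h => by
      have : z ∈ segment ℝ x z ∩ frontier U :=
        ⟨right_mem_segment ℝ x z, by rw [hU.1.frontier_eq]; exact ⟨h, hzU⟩⟩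
      rw [hne] at this
      exact this
    obtain ⟨q, -, hq1, hq2⟩ := (convex_segment x z).isPreconnected U (closure U)ᶜ hU.1
      isClosed_closure.isOpen_compl (fun q hq => by
        by_cases h : q ∈ closure U
        · left
          by_contra hqU
          have : q ∈ segment ℝ x z ∩ frontier U :=
            ⟨hq, by rw [hU.1.frontier_eq]; exact ⟨h, hqU⟩⟩
          rw [hne] at this
          exact this
        · exact Or.inr h)
      ⟨x, left_mem_segment ℝ x z, hxU⟩ ⟨z, right_mem_segment ℝ x z, hz'⟩
    exact hq2 (subset_closure hq1)
  obtain ⟨q, hq, hqU⟩ := hconn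
  refine Metric.mem_cthickening_of_dist_le x q δ _ hqU ?_
  have hd : dist x q ≤ dist x z := by
    have := dist_add_dist_of_mem_segment hq
    linarith [dist_nonneg (x := q) (y := z)]
  have h3 := h2.trans_le (min_le_right _ _)
  have hx' : Metric.infDist x Uᶜ ≤ ε := hx
  linarith

end Strip

end Carleman

namespace Carleman

/-! ### The trace inequality -/

section TraceInequality

theorem enorm_add_sq_le {F : Type*} [SeminormedAddCommGroup F] (a b : F) :
    ‖a + b‖ₑ ^ 2 ≤ 2 * ‖a‖ₑ ^ 2 + 2 * ‖b‖ₑ ^ 2 := by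
  have h : ‖a + b‖₊ ^ 2 ≤ 2 * ‖a‖₊ ^ 2 + 2 * ‖b‖₊ ^ 2 := by
    rw [← NNReal.coe_le_coe]
    push_cast
    have := norm_add_le a b
    have h0 := norm_nonneg (a + b)
    nlinarith [sq_nonneg (‖a‖ - ‖b‖)]
  simp only [enorm]
  exact_mod_cast h

theorem lintegral_sq_le {α : Type*} [MeasurableSpace α] (μ : Measure α) {f : α → ℝ≥0∞}
    (hf : AEMeasurable f μ) :
    (∫⁻ x, f x ∂μ) ^ 2 ≤ μ Set.univ * ∫⁻ x, f x ^ 2 ∂μ := by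
  have h := ENNReal.lintegral_mul_le_Lp_mul_Lq μ Real.HolderConjugate.two_two
    (aemeasurable_const (b := (1 : ℝ≥0∞))) hf
  simp only [Pi.mul_apply, one_mul, lintegral_const, ENNReal.rpow_ofNat, one_pow] at h
  calc _ ≤ (μ Set.univ ^ (1 / 2 : ℝ) * (∫⁻ x, f x ^ 2 ∂μ) ^ (1 / 2 : ℝ)) ^ 2 := by gcongr
    _ = _ := by
      rw [mul_pow, ← ENNReal.rpow_mul_natCast, ← ENNReal.rpow_mul_natCast]
      norm_num

/-- Write `w 0 = w t - ∫₀ᵗ w'`, square, apply Cauchy–Schwarz to the integral, and integrate over `t`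
in `(0, δ)`. -/
theorem ofReal_mul_enorm_sq_le {F : Type*} [NormedAddCommGroup F] [NormedSpace ℝ F]
    [CompleteSpace F] {w w' : ℝ → F} (hw : ∀ t, HasDerivAt w (w' t) t) (hw' : Continuous w')
    (δ : ℝ) :
    ENNReal.ofReal δ * ‖w 0‖ₑ ^ 2 ≤
      ∫⁻ t in Set.Ioo 0 δ, (2 * ‖w t‖ₑ ^ 2 + 2 * ENNReal.ofReal δ ^ 2 * ‖w' t‖ₑ ^ 2) := by
  set I := ∫⁻ t in Set.Ioo 0 δ, ‖w' t‖ₑ with hI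
  have hI2 : I ^ 2 ≤ ENNReal.ofReal δ * ∫⁻ t in Set.Ioo 0 δ, ‖w' t‖ₑ ^ 2 := by
    have := lintegral_sq_le (volume.restrict (Set.Ioo 0 δ)) (f := fun t => ‖w' t‖ₑ)
      hw'.enorm.measurable.aemeasurable
    simpa using this
  have hwc : Continuous w := continuous_iff_continuousAt.2 fun t => (hw t).continuousAt
  have hpt : ∀ t ∈ Set.Ioo 0 δ, ‖w 0‖ₑ ^ 2 ≤ 2 * ‖w t‖ₑ ^ 2 + 2 * I ^ 2 := by
    intro t ht
    have hftc : ∫ s in (0 : ℝ)..t, w' s = w t - w 0 :=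
      intervalIntegral.integral_eq_sub_of_hasDerivAt (fun s _ => hw s)
        (hw'.intervalIntegrable _ _)
    have h0 : w 0 = w t + -(w t - w 0) := by abel
    have hle : ‖-(w t - w 0)‖ₑ ≤ I := by
      rw [enorm_neg, ← hftc, intervalIntegral.integral_of_le ht.1.le,
        integral_Ioc_eq_integral_Ioo]
      refine (enorm_integral_le_lintegral_enorm _).trans ?_
      exact lintegral_mono_set (Set.Ioo_subset_Ioo_right ht.2.le)
    conv_lhs => rw [h0]
    refine (enorm_add_sq_le _ _).trans ?_
    gcongr
  have hconst : ENNReal.ofReal δ * ‖w 0‖ₑ ^ 2 = ∫⁻ t in Set.Ioo 0 δ, ‖w 0‖ₑ ^ 2 := by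
    simp [mul_comm]
  rw [hconst]
  calc _ ≤ ∫⁻ t in Set.Ioo 0 δ, (2 * ‖w t‖ₑ ^ 2 + 2 * I ^ 2) :=
        setLIntegral_mono' measurableSet_Ioo hpt
    _ = (∫⁻ t in Set.Ioo 0 δ, 2 * ‖w t‖ₑ ^ 2) + 2 * I ^ 2 * ENNReal.ofReal δ := by
        rw [lintegral_add_right _ measurable_const]
        simp
    _ ≤ (∫⁻ t in Set.Ioo 0 δ, 2 * ‖w t‖ₑ ^ 2) +
          2 * (ENNReal.ofReal δ * ∫⁻ t in Set.Ioo 0 δ, ‖w' t‖ₑ ^ 2) * ENNReal.ofReal δ := by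
        gcongr
    _ = _ := by
        rw [lintegral_add_left ((hwc.enorm.measurable.pow_const 2).const_mul 2),
          lintegral_const_mul (2 * ENNReal.ofReal δ ^ 2) (hw'.enorm.measurable.pow_const 2)]
        ring

variable {d : ℕ} {F : Type*} [NormedAddCommGroup F] [NormedSpace ℝ F] [CompleteSpace F]

/-- The one-dimensional inequality is applied on each segment issuing from the boundary in the
direction `e`, then integrated over the base of the chart. -/
theorem exists_trace_le_ball {U : Set (E d)} (hU : IsLipschitzDomain U) {p : E d}
    (hp : p ∈ frontier U) : ∃ r > 0, ∃ C : ℝ≥0∞, C ≠ ⊤ ∧ ∀ v : E d → F, ContDiff ℝ 1 v →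
      ∫⁻ x in Metric.ball p r, ‖v x‖ₑ ^ 2 ∂surfaceMeasure U
        ≤ C * ∫⁻ x in U, (‖v x‖ₑ ^ 2 + ‖fderiv ℝ v x‖ₑ ^ 2) := by
  obtain ⟨hUo, hU⟩ := hU
  obtain ⟨e, K, g, V, he, hg, hV, hpV, hUV⟩ := hU p hp
  obtain ⟨R, hR, hRV⟩ := Metric.isOpen_iff.1 hV p hpV
  obtain ⟨c, hc, hcle⟩ := lintegral_graph_ge he
  have hΓ := (lipschitzWith_graphMap he hg).continuous
  set A : Set (ℝ ∙ e)ᗮ := graphMap g ⁻¹' (Metric.ball p (R / 2)) with hA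
  have hAm : MeasurableSet A := hΓ.measurable Metric.isOpen_ball.measurableSet
  -- Half of the radius is spent on the base and half on the segments, so that segments of length
  -- `δ` stay in the chart.
  set δ := R / 2 with hδ
  have hδ0 : 0 < δ := by positivity
  set M : ℝ≥0∞ := ((1 + K : ℝ≥0) : ℝ≥0∞) ^ (d - 1) with hM
  set D := ENNReal.ofReal δ with hD
  have hD0 : D ≠ 0 := by simpa [hD] using hδ0
  have hDt : D ≠ ⊤ := ENNReal.ofReal_ne_top
  refine ⟨δ, hδ0, M * (D⁻¹ * (c * (2 + 2 * D ^ 2))), ?_, fun v hv => ?_⟩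
  · refine ENNReal.mul_ne_top (by simp [hM]) (ENNReal.mul_ne_top (by simpa using hD0)
      (ENNReal.mul_ne_top hc ?_))
    exact ENNReal.add_ne_top.2 ⟨by simp, ENNReal.mul_ne_top (by simp) (by simp [hDt])⟩
  have hvc := hv.continuous
  have hvd : Continuous (fderiv ℝ v) := hv.continuous_fderiv one_ne_zero
  have hsurf : (surfaceMeasure U).restrict (Metric.ball p δ)
      ≤ M • (volume.restrict A).map (graphMap g) := by
    rw [surfaceMeasure, Measure.restrict_restrict Metric.isOpen_ball.measurableSet]
    refine restrict_graphMap_image_le he hg ?_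
    rintro x ⟨hxb, hxU⟩
    have hxV : x ∈ V := hRV (Metric.ball_subset_ball (by rw [hδ]; linarith) hxb)
    have hx := eq_graphMap_of_mem_frontier he hUo hV hg hUV hxV hxU
    exact ⟨_, by rw [hA, Set.mem_preimage, hx]; exact hxb, hx⟩
  set h : E d → ℝ≥0∞ := U.indicator
    (fun x => 2 * ‖v x‖ₑ ^ 2 + 2 * D ^ 2 * ‖fderiv ℝ v x‖ₑ ^ 2) with hh
  have hm1 : Measurable fun x => ‖v x‖ₑ ^ 2 := hvc.enorm.measurable.pow_const 2
  have hm2 : Measurable fun x => ‖fderiv ℝ v x‖ₑ ^ 2 := hvd.enorm.measurable.pow_const 2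
  have hhm : Measurable h :=
    ((hm1.const_mul 2).add (hm2.const_mul (2 * D ^ 2))).indicator hUo.measurableSet
  have hline : ∀ y ∈ A, D * ‖v (graphMap g y)‖ₑ ^ 2 ≤ ∫⁻ t : ℝ, h (graphMap g y + t • e) := by
    intro y hy
    have hder : ∀ t : ℝ, HasDerivAt (fun t : ℝ => v (graphMap g y + t • e))
        (fderiv ℝ v (graphMap g y + t • e) e) t := by
      intro t
      have h1 : HasDerivAt (fun t : ℝ => graphMap g y + t • e) e t := by
        simpa using ((hasDerivAt_id t).smul_const e).const_add (graphMap g y)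
      exact ((hv.differentiable one_ne_zero _).hasFDerivAt).comp_hasDerivAt t h1
    have h1 := ofReal_mul_enorm_sq_le hder (by fun_prop) δ
    simp only [zero_smul, add_zero] at h1
    refine h1.trans (le_trans (setLIntegral_mono' measurableSet_Ioo fun t ht => ?_)
      (setLIntegral_le_lintegral (Set.Ioo 0 δ) _))
    have hxV : graphMap g y + t • e ∈ V := by
      apply hRV
      rw [Metric.mem_ball]
      have h2 : dist (graphMap g y + t • e) (graphMap g y) = t := by
        rw [dist_eq_norm, add_sub_cancel_left, norm_smul, he, mul_one,
          Real.norm_of_nonneg ht.1.le]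
      have h3 : dist (graphMap g y) p < δ := hy
      have := dist_triangle (graphMap g y + t • e) (graphMap g y) p
      linarith [ht.2]
    rw [hh, Set.indicator_of_mem (graphMap_add_smul_mem he hUV ht.1 hxV)]
    gcongr
    have h4 := (fderiv ℝ v (graphMap g y + t • e)).le_opENorm e
    rwa [← ofReal_norm e, he, ENNReal.ofReal_one, mul_one] at h4
  calc ∫⁻ x in Metric.ball p δ, ‖v x‖ₑ ^ 2 ∂surfaceMeasure U
      ≤ ∫⁻ x, ‖v x‖ₑ ^ 2 ∂(M • (volume.restrict A).map (graphMap g)) :=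
        lintegral_mono' hsurf le_rfl
    _ = M * ∫⁻ y in A, ‖v (graphMap g y)‖ₑ ^ 2 := by
        rw [lintegral_smul_measure, lintegral_map hm1 hΓ.measurable, smul_eq_mul]
    _ = M * (D⁻¹ * ∫⁻ y in A, D * ‖v (graphMap g y)‖ₑ ^ 2) := by
        rw [lintegral_const_mul D (f := fun y => ‖v (graphMap g y)‖ₑ ^ 2)
          (hm1.comp hΓ.measurable), ← mul_assoc D⁻¹,
          ENNReal.inv_mul_cancel hD0 hDt, one_mul]
    _ ≤ M * (D⁻¹ * ∫⁻ y in A, ∫⁻ t : ℝ, h (graphMap g y + t • e)) := by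
        gcongr 2
        exact setLIntegral_mono' hAm hline
    _ ≤ M * (D⁻¹ * ∫⁻ y : (ℝ ∙ e)ᗮ, ∫⁻ t : ℝ, h (graphMap g y + t • e)) := by
        gcongr
        exact Measure.restrict_le_self
    _ ≤ M * (D⁻¹ * (c * ∫⁻ x, h x)) := by
        gcongr
        exact hcle g h hhm
    _ ≤ M * (D⁻¹ * (c * ((2 + 2 * D ^ 2) *
          ∫⁻ x in U, (‖v x‖ₑ ^ 2 + ‖fderiv ℝ v x‖ₑ ^ 2)))) := by
        gcongr
        rw [hh, lintegral_indicator hUo.measurableSet, ← lintegral_const_mul (2 + 2 * D ^ 2)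
          (f := fun x => ‖v x‖ₑ ^ 2 + ‖fderiv ℝ v x‖ₑ ^ 2) (hm1.add hm2)]
        refine lintegral_mono fun x => ?_
        rw [mul_add]
        gcongr
        · exact le_self_add
        · exact le_add_self
    _ = _ := by ring

/-- The trace inequality `∫_{∂U} |v|² dS ≤ C ∫_U (|v|² + |Dv|²)` for `C¹` functions. -/
theorem exists_trace_le {U : Set (E d)} (hU : IsLipschitzDomain U)
    (hUb : Bornology.IsBounded U) : ∃ C : ℝ≥0∞, C ≠ ⊤ ∧ ∀ v : E d → F, ContDiff ℝ 1 v →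
      ∫⁻ x, ‖v x‖ₑ ^ 2 ∂surfaceMeasure U
        ≤ C * ∫⁻ x in U, (‖v x‖ₑ ^ 2 + ‖fderiv ℝ v x‖ₑ ^ 2) := by
  have hK : IsCompact (frontier U) := hUb.isCompact_closure.of_isClosed_subset isClosed_frontier
    frontier_subset_closure
  have key : ∃ C : ℝ≥0∞, C ≠ ⊤ ∧ ∀ v : E d → F, ContDiff ℝ 1 v →
      ∫⁻ x in frontier U, ‖v x‖ₑ ^ 2 ∂surfaceMeasure U
        ≤ C * ∫⁻ x in U, (‖v x‖ₑ ^ 2 + ‖fderiv ℝ v x‖ₑ ^ 2) := by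
    refine hK.induction_on (p := fun s => ∃ C : ℝ≥0∞, C ≠ ⊤ ∧ ∀ v : E d → F, ContDiff ℝ 1 v →
      ∫⁻ x in s, ‖v x‖ₑ ^ 2 ∂surfaceMeasure U
        ≤ C * ∫⁻ x in U, (‖v x‖ₑ ^ 2 + ‖fderiv ℝ v x‖ₑ ^ 2)) ?_ ?_ ?_ ?_
    · exact ⟨0, by simp⟩
    · rintro s t hst ⟨C, hC, h⟩
      exact ⟨C, hC, fun v hv => (lintegral_mono_set hst).trans (h v hv)⟩
    · rintro s t ⟨C, hC, h⟩ ⟨C', hC', h'⟩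
      refine ⟨C + C', by simp [hC, hC'], fun v hv => (lintegral_union_le _ _ _).trans ?_⟩
      rw [add_mul]
      exact add_le_add (h v hv) (h' v hv)
    · intro p hp
      obtain ⟨r, hr, C, hC, h⟩ := exists_trace_le_ball (F := F) hU hp
      exact ⟨_, mem_nhdsWithin_of_mem_nhds (Metric.ball_mem_nhds p hr), C, hC, h⟩
  obtain ⟨C, hC, h⟩ := key
  refine ⟨C, hC, fun v hv => ?_⟩
  have := h v hv
  rwa [surfaceMeasure, Measure.restrict_restrict isClosed_frontier.measurableSet,
    Set.inter_self] at this

/-- The trace inequality for the constant function `1`. -/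
theorem isFiniteMeasure_surfaceMeasure {U : Set (E d)} (hU : IsLipschitzDomain U)
    (hUb : Bornology.IsBounded U) : IsFiniteMeasure (surfaceMeasure U) := by
  obtain ⟨C, hC, h⟩ := exists_trace_le (F := ℝ) hU hUb
  have h1 := h (fun _ => 1) contDiff_const
  simp at h1
  exact ⟨h1.trans_lt (ENNReal.mul_lt_top hC.lt_top
    (ENNReal.mul_lt_top (by simp [enorm]) hUb.measure_lt_top))⟩

end TraceInequality

end Carleman

namespace Carleman

/-! ### A one-sided divergence theorem -/

section Divergence

variable {d : ℕ}

theorem norm_unitVec (i : Fin d) : ‖(unitVec i : E d)‖ = 1 := by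
  simp [unitVec]

theorem _root_.ContDiff.comp_locallyLipschitzOn {X E' F' : Type*} [PseudoEMetricSpace X]
    [NormedAddCommGroup E'] [NormedSpace ℝ E'] [NormedAddCommGroup F'] [NormedSpace ℝ F']
    {Φ : E' → F'} (hΦ : ContDiff ℝ 1 Φ) {f : X → E'} {s : Set X} (hf : LocallyLipschitzOn s f) :
    LocallyLipschitzOn s fun x => Φ (f x) := by
  intro x hx
  obtain ⟨K, t, ht, h⟩ := hf hx
  obtain ⟨K', t', ht', h'⟩ := hΦ.locallyLipschitz (f x)
  refine ⟨K' * K, t ∩ f ⁻¹' t', inter_mem ht (hf.continuousOn x hx ht'), ?_⟩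
  exact h'.comp (h.mono Set.inter_subset_left) fun y hy => hy.2

theorem _root_.LocallyLipschitzOn.prodMk {X Y Z : Type*} [PseudoEMetricSpace X]
    [PseudoEMetricSpace Y] [PseudoEMetricSpace Z] {f : X → Y} {g : X → Z} {s : Set X}
    (hf : LocallyLipschitzOn s f) (hg : LocallyLipschitzOn s g) :
    LocallyLipschitzOn s fun x => (f x, g x) := by
  intro x hx
  obtain ⟨K, t, ht, h⟩ := hf hx
  obtain ⟨K', t', ht', h'⟩ := hg hx
  exact ⟨max K K', t ∩ t', inter_mem ht ht',
    (h.mono Set.inter_subset_left).prodMk (h'.mono Set.inter_subset_right)⟩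

/-- Local Lipschitz bounds become uniform on the compact 1-thickening of `k`. For a pair with a
point outside it, either both values vanish or the distance is at least `1`, and then the sup bound
of `f` is a Lipschitz bound. This makes flux times cutoff globally Lipschitz. -/
theorem exists_lipschitzWith_of_eq_zero_off_compact {f : E d → ℝ} {k U : Set (E d)}
    (hU : IsOpen U) (hk : IsCompact k) (hkU : k ⊆ U) (hf : LocallyLipschitzOn U f)
    (h0 : ∀ x ∉ k, f x = 0) : ∃ C, LipschitzWith C f := by
  have hloc : LocallyLipschitz f := by
    intro x
    by_cases hx : x ∈ k
    · obtain ⟨C, t, ht, h⟩ := hf (hkU hx)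
      rw [hU.nhdsWithin_eq (hkU hx)] at ht
      exact ⟨C, t, ht, h⟩
    · refine ⟨0, kᶜ, hk.isClosed.isOpen_compl.mem_nhds hx, fun a ha b hb => ?_⟩
      rw [h0 a ha, h0 b hb]
      simp
  obtain ⟨C, hC⟩ := LocallyLipschitzOn.exists_lipschitzOnWith_of_compact
    (hk.cthickening (r := 1)) (hloc.locallyLipschitzOn (s := Metric.cthickening 1 k))
  obtain ⟨M, hM⟩ := hk.exists_bound_of_continuousOn hloc.continuous.continuousOn
  have hM' : ∀ x, ‖f x‖ ≤ max M 0 := fun x => by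
    by_cases hx : x ∈ k
    · exact (hM x hx).trans (le_max_left _ _)
    · rw [h0 x hx, norm_zero]; exact le_max_right _ _
  have key : ∀ x y, y ∉ Metric.cthickening 1 k → ‖f x - f y‖ ≤ (C + max M 0) * dist x y := by
    intro x y hy
    have hyk : y ∉ k := fun h => hy (Metric.self_subset_cthickening k h)
    rw [h0 y hyk, sub_zero]
    have hmax : 0 ≤ max M 0 := le_max_right _ _
    by_cases hx : x ∈ k
    · have h1 : 1 ≤ dist x y := by
        by_contra! hlt
        exact hy (Metric.mem_cthickening_of_dist_le y x 1 k hx (by rw [dist_comm]; exact hlt.le))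
      calc ‖f x‖ ≤ max M 0 := hM' x
        _ ≤ (C + max M 0) * 1 := by simp
        _ ≤ _ := by gcongr
    · rw [h0 x hx, norm_zero]; positivity
  refine ⟨C + ⟨max M 0, le_max_right _ _⟩, LipschitzWith.of_dist_le_mul fun x y => ?_⟩
  rw [dist_eq_norm]
  change _ ≤ ((C : ℝ) + max M 0) * _
  by_cases hy : y ∈ Metric.cthickening 1 k
  · by_cases hx : x ∈ Metric.cthickening 1 k
    · have := hC.dist_le_mul x hx y hy
      rw [dist_eq_norm] at this
      refine this.trans ?_
      gcongr
      simp
    · rw [norm_sub_rev, dist_comm]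
      exact key y x hx
  · exact key x y hy

/-- Integration by parts against the constant `1`. -/
theorem integral_lineDeriv_eq_zero {f : E d → ℝ} {C : ℝ≥0} (hf : LipschitzWith C f)
    (hc : HasCompactSupport f) (v : E d) : ∫ x, lineDeriv ℝ f x v = 0 := by
  have h := LipschitzWith.integral_lineDeriv_mul_eq (μ := (volume : Measure (E d)))
    (LipschitzWith.const (1 : ℝ)) hf hc (-v)
  simpa [lineDeriv] using h.symm

/-- A Lipschitz cutoff, equal to `1` at distance at least `2ε` from the complement of `U` and to
`0` at distance at most `ε`. -/
noncomputable def innerCutoff (U : Set (E d)) (ε : ℝ) (x : E d) : ℝ :=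
  max 0 (min 1 (Metric.infDist x Uᶜ / ε - 1))

theorem lipschitzWith_innerCutoff (U : Set (E d)) {ε : ℝ≥0} :
    LipschitzWith ε⁻¹ (innerCutoff U ε) := by
  have h1 : LipschitzWith ε⁻¹ fun x => Metric.infDist x Uᶜ / ε - 1 := by
    refine LipschitzWith.of_dist_le_mul fun x y => ?_
    rw [Real.dist_eq, sub_sub_sub_cancel_right, ← sub_div, abs_div, NNReal.abs_eq,
      NNReal.coe_inv, div_eq_inv_mul]
    gcongr
    simpa [Real.dist_eq] using (Metric.lipschitz_infDist_pt Uᶜ).dist_le_mul x y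
  exact (h1.const_min 1).const_max 0

theorem innerCutoff_nonneg (U : Set (E d)) (ε : ℝ) (x : E d) : 0 ≤ innerCutoff U ε x :=
  le_max_left _ _

theorem innerCutoff_le_one (U : Set (E d)) (ε : ℝ) (x : E d) : innerCutoff U ε x ≤ 1 :=
  max_le zero_le_one (min_le_left _ _)

theorem innerCutoff_eq_zero {U : Set (E d)} {ε : ℝ} (hε : 0 < ε) {x : E d}
    (hx : Metric.infDist x Uᶜ ≤ ε) : innerCutoff U ε x = 0 := by
  have : Metric.infDist x Uᶜ / ε ≤ 1 := (div_le_one hε).2 hx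
  exact max_eq_left ((min_le_right _ _).trans (by linarith))

theorem innerCutoff_eq_one {U : Set (E d)} {ε : ℝ} (hε : 0 < ε) {x : E d}
    (hx : 2 * ε ≤ Metric.infDist x Uᶜ) : innerCutoff U ε x = 1 := by
  have : 2 ≤ Metric.infDist x Uᶜ / ε := (le_div_iff₀ hε).2 hx
  rw [innerCutoff, min_eq_left (by linarith), max_eq_right zero_le_one]

/-- The slope is at most `1/ε`, and the cutoff is locally constant where the distance to the
complement exceeds `2ε`. The gradient thus lives in the strip of width `2ε`. -/
theorem fderiv_innerCutoff_le {U : Set (E d)} {ε : ℝ} (hε : 0 < ε) {x : E d} {D : E d →L[ℝ] ℝ}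
    (hD : HasFDerivAt (innerCutoff U ε) D x) (i : Fin d) :
    |D (unitVec i)| ≤ ({x | Metric.infDist x Uᶜ ≤ 2 * ε} : Set (E d)).indicator
      (fun _ => ε⁻¹) x := by
  by_cases hx : Metric.infDist x Uᶜ ≤ 2 * ε
  · rw [Set.indicator_of_mem (by exact hx)]
    have h1 := hD.le_of_lipschitz (lipschitzWith_innerCutoff U (ε := ⟨ε, hε.le⟩))
    have h2 := D.le_opNorm (unitVec i)
    rw [norm_unitVec, mul_one] at h2
    exact h2.trans h1
  · have hev : innerCutoff U ε =ᶠ[𝓝 x] fun _ => 1 := by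
      have ho : IsOpen {y : E d | 2 * ε < Metric.infDist y Uᶜ} :=
        isOpen_lt continuous_const (Metric.continuous_infDist_pt _)
      filter_upwards [ho.mem_nhds (not_le.1 hx)] with y hy
      exact innerCutoff_eq_one hε (le_of_lt hy)
    have : D = 0 := hD.unique ((hasFDerivAt_const (1 : ℝ) x).congr_of_eventuallyEq hev)
    rw [Set.indicator_of_notMem (by exact hx), this]
    simp

theorem integrableOn_of_continuous {U : Set (E d)} (hUb : Bornology.IsBounded U) {f : E d → ℝ}
    (hf : Continuous f) : IntegrableOn f U :=
  (hf.continuousOn.integrableOn_compact hUb.isCompact_closure).mono_set subset_closure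

/-- With the cutoff `χ`, `χ div F = div(χF) - F·∇χ`. The first term integrates to zero by compact
support, and the second is at most `1/ε` times `|F|` on the strip, component by component. -/
theorem lintegral_mul_innerCutoff_le {U : Set (E d)} (hUo : IsOpen U)
    (hUb : Bornology.IsBounded U) {F : Fin d → E d → ℝ} {G f : E d → ℝ}
    (hF : ∀ i, Continuous (F i)) (hFl : ∀ i, LocallyLipschitzOn U (F i))
    (hG : Continuous G) (hf : Continuous f) (hG0 : ∀ x ∈ U, 0 ≤ G x) (hf0 : ∀ x ∈ U, 0 ≤ f x)
    (hdiv : ∀ᵐ x ∂volume.restrict U, ∃ D : Fin d → ℝ,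
      (∀ i, HasLineDerivAt ℝ (F i) (D i) x (unitVec i)) ∧ G x ≤ f x + ∑ i, D i)
    {ε : ℝ} (hε : 0 < ε) :
    ∫⁻ x in U, ENNReal.ofReal (G x * innerCutoff U ε x) ≤
      (∫⁻ x in U, ENNReal.ofReal (f x)) +
        ∑ i, ENNReal.ofReal ε⁻¹ * ∫⁻ x in U ∩ {x | Metric.infDist x Uᶜ ≤ 2 * ε}, ‖F i x‖ₑ := by
  set χ := innerCutoff U ε with hχ
  have hχL : LipschitzWith (⟨ε, hε.le⟩ : ℝ≥0)⁻¹ χ :=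
    lipschitzWith_innerCutoff U (ε := ⟨ε, hε.le⟩)
  set k : Set (E d) := {x | ε ≤ Metric.infDist x Uᶜ} with hk
  have hkU : k ⊆ U := by
    intro x hx
    by_contra hxU
    have : Metric.infDist x Uᶜ = 0 := Metric.infDist_zero_of_mem hxU
    have hx' : ε ≤ Metric.infDist x Uᶜ := hx
    linarith
  have hkc : IsClosed k := isClosed_le continuous_const (Metric.continuous_infDist_pt _)
  have hkk : IsCompact k :=
    hUb.isCompact_closure.of_isClosed_subset hkc (hkU.trans subset_closure)
  set H : Fin d → E d → ℝ := fun i x => F i x * χ x with hH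
  have hH0 : ∀ i, ∀ x ∉ k, H i x = 0 := by
    intro i x hx
    have : χ x = 0 := innerCutoff_eq_zero hε (le_of_lt (not_le.1 hx))
    simp [hH, this]
  have hHL : ∀ i, ∃ C, LipschitzWith C (H i) := fun i =>
    exists_lipschitzWith_of_eq_zero_off_compact hUo hkk hkU
      (contDiff_mul.comp_locallyLipschitzOn
        ((hFl i).prodMk hχL.locallyLipschitz.locallyLipschitzOn)) (hH0 i)
  have hHc : ∀ i, HasCompactSupport (H i) := fun i => HasCompactSupport.intro hkk (hH0 i)
  have hfin : volume U ≠ ⊤ := hUb.measure_lt_top.ne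
  have : IsFiniteMeasure (volume.restrict U) := ⟨by simpa using hfin.lt_top⟩
  have hHint : ∀ i, IntegrableOn (fun x => lineDeriv ℝ (H i) x (unitVec i)) U := fun i => by
    obtain ⟨C, hC⟩ := hHL i
    exact ((hC.memLp_lineDeriv (unitVec i)).restrict U).integrable le_top
  have hHzero : ∀ i, ∫ x in U, lineDeriv ℝ (H i) x (unitVec i) = 0 := fun i => by
    obtain ⟨C, hC⟩ := hHL i
    rw [setIntegral_eq_integral_of_forall_compl_eq_zero,
      integral_lineDeriv_eq_zero hC (hHc i)]
    intro x hx
    have hxk : x ∉ k := fun h => hx (hkU h)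
    have hev : (H i) =ᶠ[𝓝 x] fun _ => 0 := by
      filter_upwards [hkc.isOpen_compl.mem_nhds hxk] with y hy
      exact hH0 i y hy
    have h0 : HasLineDerivAt ℝ (H i) 0 x (unitVec i) :=
      (((hasFDerivAt_const (0 : ℝ) x).congr_of_eventuallyEq hev).hasLineDerivAt _)
    exact h0.lineDeriv
  set st : Set (E d) := {x | Metric.infDist x Uᶜ ≤ 2 * ε} with hst
  have hstm : MeasurableSet st :=
    (isClosed_le (Metric.continuous_infDist_pt _) continuous_const).measurableSet
  have hpt : ∀ᵐ x ∂volume.restrict U, G x * χ x ≤ f x + ∑ i, (lineDeriv ℝ (H i) x (unitVec i)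
      + ε⁻¹ * st.indicator (fun x => |F i x|) x) := by
    filter_upwards [hdiv, ae_restrict_of_ae hχL.ae_differentiableAt,
      ae_restrict_mem hUo.measurableSet] with x hx hχd hxU
    obtain ⟨D, hD, hGD⟩ := hx
    have hline : ∀ i, D i * χ x ≤ lineDeriv ℝ (H i) x (unitVec i)
        + ε⁻¹ * st.indicator (fun x => |F i x|) x := by
      intro i
      have h1 : HasLineDerivAt ℝ χ (fderiv ℝ χ x (unitVec i)) x (unitVec i) :=
        hχd.hasFDerivAt.hasLineDerivAt _
      have h2 : HasLineDerivAt ℝ (H i) (D i * χ x + F i x * fderiv ℝ χ x (unitVec i)) x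
          (unitVec i) := by
        have := HasDerivAt.mul (hD i) h1
        simpa [HasLineDerivAt, hH, Pi.mul_def] using this
      rw [h2.lineDeriv]
      have h3 := fderiv_innerCutoff_le hε hχd.hasFDerivAt i
      have h4 : -(F i x * fderiv ℝ χ x (unitVec i)) ≤ ε⁻¹ * st.indicator (fun x => |F i x|) x := by
        calc -(F i x * fderiv ℝ χ x (unitVec i)) ≤ |F i x| * |fderiv ℝ χ x (unitVec i)| := by
              rw [← abs_mul]; exact neg_le_abs _
          _ ≤ |F i x| * st.indicator (fun _ => ε⁻¹) x := by gcongr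
          _ = _ := by
              by_cases hxs : x ∈ st
              · simp [hxs, mul_comm]
              · simp [hxs]
      linarith
    have hχ0 : 0 ≤ χ x := innerCutoff_nonneg _ _ _
    have hχ1 : χ x ≤ 1 := innerCutoff_le_one _ _ _
    calc G x * χ x ≤ (f x + ∑ i, D i) * χ x := by gcongr
      _ = f x * χ x + ∑ i, D i * χ x := by rw [add_mul, Finset.sum_mul]
      _ ≤ f x + ∑ i, (lineDeriv ℝ (H i) x (unitVec i)
            + ε⁻¹ * st.indicator (fun x => |F i x|) x) :=
          add_le_add (mul_le_of_le_one_right (hf0 x hxU) hχ1)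
            (Finset.sum_le_sum fun i _ => hline i)
  have hGi : IntegrableOn (fun x => G x * χ x) U :=
    integrableOn_of_continuous hUb (hG.mul hχL.continuous)
  have hfi : IntegrableOn f U := integrableOn_of_continuous hUb hf
  have hFi : ∀ i, IntegrableOn (fun x => ε⁻¹ * st.indicator (fun x => |F i x|) x) U := fun i =>
    ((integrableOn_of_continuous hUb (hF i).abs).indicator hstm).const_mul _
  have hsi : ∀ i, IntegrableOn (fun x => lineDeriv ℝ (H i) x (unitVec i)
      + ε⁻¹ * st.indicator (fun x => |F i x|) x) U := fun i => (hHint i).add (hFi i)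
  have hssi : IntegrableOn (fun x => ∑ i, (lineDeriv ℝ (H i) x (unitVec i)
      + ε⁻¹ * st.indicator (fun x => |F i x|) x)) U := integrable_finsetSum _ fun i _ => hsi i
  have hint := integral_mono_ae hGi (hfi.add hssi) hpt
  have heq : ∫ x in U, (f x + ∑ i, (lineDeriv ℝ (H i) x (unitVec i)
      + ε⁻¹ * st.indicator (fun x => |F i x|) x)) =
      (∫ x in U, f x) + ∑ i, ∫ x in U, ε⁻¹ * st.indicator (fun x => |F i x|) x := by
    rw [integral_add hfi hssi, integral_finsetSum _ fun i _ => hsi i]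
    congr 1
    refine Finset.sum_congr rfl fun i _ => ?_
    rw [integral_add (hHint i) (hFi i), hHzero i, zero_add]
  have hGχ0 : 0 ≤ᵐ[volume.restrict U] fun x => G x * χ x := by
    filter_upwards [ae_restrict_mem hUo.measurableSet] with x hx
    exact mul_nonneg (hG0 x hx) (innerCutoff_nonneg _ _ _)
  have hf0' : 0 ≤ᵐ[volume.restrict U] f := by
    filter_upwards [ae_restrict_mem hUo.measurableSet] with x hx
    exact hf0 x hx
  have hF0 : ∀ i, 0 ≤ᵐ[volume.restrict U] fun x => ε⁻¹ * st.indicator (fun x => |F i x|) x :=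
    fun i => ae_of_all _ fun x =>
      mul_nonneg (by positivity) (Set.indicator_nonneg (fun _ _ => abs_nonneg _) _)
  rw [← ofReal_integral_eq_lintegral_ofReal hGi hGχ0,
    ← ofReal_integral_eq_lintegral_ofReal hfi hf0']
  have hFeq : ∀ i, ENNReal.ofReal ε⁻¹ * ∫⁻ x in U ∩ st, ‖F i x‖ₑ =
      ENNReal.ofReal (∫ x in U, ε⁻¹ * st.indicator (fun x => |F i x|) x) := by
    intro i
    rw [integral_const_mul, ENNReal.ofReal_mul (by positivity),
      integral_indicator hstm, Measure.restrict_restrict hstm, Set.inter_comm st]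
    congr 1
    rw [← ofReal_integral_norm_eq_lintegral_enorm
      ((integrableOn_of_continuous hUb (hF i)).mono_set Set.inter_subset_left)]
    rfl
  simp_rw [hFeq]
  rw [← ENNReal.ofReal_sum_of_nonneg fun i _ => integral_nonneg_of_ae (hF0 i),
    ← ENNReal.ofReal_add (integral_nonneg_of_ae hf0')
      (Finset.sum_nonneg fun i _ => integral_nonneg_of_ae (hF0 i))]
  refine ENNReal.ofReal_le_ofReal (hint.trans (le_of_eq ?_))
  exact heq

/-- A one-sided divergence theorem on Lipschitz domains, up to a constant in the boundary term. -/
theorem exists_lintegral_le_of_le_div {U : Set (E d)} (hU : IsLipschitzDomain U)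
    (hUb : Bornology.IsBounded U) (hUc : Uᶜ.Nonempty) :
    ∃ C : ℝ≥0∞, C ≠ ⊤ ∧ ∀ (F : Fin d → E d → ℝ) (G f : E d → ℝ),
      (∀ i, Continuous (F i)) → (∀ i, LocallyLipschitzOn U (F i)) →
      Continuous G → Continuous f → (∀ x ∈ U, 0 ≤ G x) → (∀ x ∈ U, 0 ≤ f x) →
      (∀ᵐ x ∂volume.restrict U, ∃ D : Fin d → ℝ,
        (∀ i, HasLineDerivAt ℝ (F i) (D i) x (unitVec i)) ∧ G x ≤ f x + ∑ i, D i) →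
      ∫⁻ x in U, ENNReal.ofReal (G x) ≤
        (∫⁻ x in U, ENNReal.ofReal (f x)) + C * ∑ i, ∫⁻ x, ‖F i x‖ₑ ∂surfaceMeasure U := by
  obtain ⟨C, hC, hstrip⟩ := exists_strip_le hU hUb hUc
  refine ⟨2 * C, ENNReal.mul_ne_top (by simp) hC, fun F G f hF hFl hG hf hG0 hf0 hdiv => ?_⟩
  refine ENNReal.le_of_forall_pos_le_add fun ρ hρ _ => ?_
  -- Each of the `d` components contributes an error `2η`; this choice keeps the total below `ρ`,
  -- also for `d = 0`.
  set η : ℝ := ρ / (2 * (d + 1)) with hη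
  have hη0 : 0 < η := by positivity
  choose ε₀ hε₀ hε using fun i => hstrip (F i) (hF i) η hη0
  have hbound : ∀ᶠ ε in 𝓝[>] (0 : ℝ),
      ∫⁻ x in U, ENNReal.ofReal (G x * innerCutoff U ε x) ≤
      (∫⁻ x in U, ENNReal.ofReal (f x)) + 2 * C * (∑ i, ∫⁻ x, ‖F i x‖ₑ ∂surfaceMeasure U) + ρ := by
    have hsmall : ∀ᶠ ε in 𝓝[>] (0 : ℝ), ∀ i, 2 * ε < ε₀ i := by
      rw [eventually_all]
      intro i
      have : Tendsto (fun ε : ℝ => 2 * ε) (𝓝[>] 0) (𝓝 0) := by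
        have h : Tendsto (fun ε : ℝ => 2 * ε) (𝓝 0) (𝓝 (2 * 0)) := tendsto_id.const_mul 2
        rw [mul_zero] at h
        exact h.mono_left nhdsWithin_le_nhds
      exact this.eventually_lt_const (hε₀ i)
    filter_upwards [hsmall, self_mem_nhdsWithin] with ε hs hpos
    have hpos' : 0 < ε := hpos
    refine (lintegral_mul_innerCutoff_le hU.1 hUb hF hFl hG hf hG0 hf0 hdiv hpos').trans ?_
    rw [add_assoc]
    gcongr
    calc ∑ i, ENNReal.ofReal ε⁻¹ *
          ∫⁻ x in U ∩ {x | Metric.infDist x Uᶜ ≤ 2 * ε}, ‖F i x‖ₑ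
        ≤ ∑ i, ENNReal.ofReal ε⁻¹ * (ENNReal.ofReal (2 * ε) *
            (C * (∫⁻ x, ‖F i x‖ₑ ∂surfaceMeasure U) + ENNReal.ofReal η)) := by
          gcongr with i
          have := hε i (2 * ε) (by positivity) (hs i)
          rwa [Set.inter_univ] at this
      _ = ∑ i, (2 * C * (∫⁻ x, ‖F i x‖ₑ ∂surfaceMeasure U) + 2 * ENNReal.ofReal η) := by
          refine Finset.sum_congr rfl fun i _ => ?_
          rw [← mul_assoc, ← ENNReal.ofReal_mul (by positivity)]
          -- The slope of the cutoff cancels the width of the strip, which is why the boundary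
          -- constant is `2 * C` for every `ε`.
          have : ε⁻¹ * (2 * ε) = 2 := by field_simp
          rw [this, ENNReal.ofReal_ofNat]
          ring
      _ = 2 * C * (∑ i, ∫⁻ x, ‖F i x‖ₑ ∂surfaceMeasure U) + d * (2 * ENNReal.ofReal η) := by
          rw [Finset.sum_add_distrib, Finset.mul_sum]
          simp
      _ ≤ _ := by
          gcongr
          have h2 : (2 : ℝ≥0∞) = ENNReal.ofReal 2 := by simp
          have hd : (d : ℝ≥0∞) = ENNReal.ofReal d := by simp
          rw [h2, hd, ← ENNReal.ofReal_mul (by norm_num), ← ENNReal.ofReal_mul (by positivity),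
            ← ENNReal.ofReal_coe_nnreal]
          refine ENNReal.ofReal_le_ofReal ?_
          rw [hη]
          have : (d : ℝ) * (2 * (ρ / (2 * (d + 1)))) = ρ * (d / (d + 1)) := by field_simp
          rw [this]
          refine mul_le_of_le_one_right ρ.2 ?_
          rw [div_le_one (by positivity)]
          linarith
  -- At each point of `U` the cutoff is eventually `1`, so Fatou's lemma along a sequence of widths
  -- recovers the integral of `G` without the cutoff.
  obtain ⟨u, hu⟩ := (𝓝[>] (0 : ℝ)).exists_seq_tendsto
  have hlim : ∀ x ∈ U, Tendsto (fun n => ENNReal.ofReal (G x * innerCutoff U (u n) x)) atTop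
      (𝓝 (ENNReal.ofReal (G x))) := by
    intro x hx
    have hpos : 0 < Metric.infDist x Uᶜ := by
      rw [← hU.1.isClosed_compl.notMem_iff_infDist_pos hUc]
      exact fun h => h hx
    refine tendsto_const_nhds.congr' ?_
    have hsm : ∀ᶠ ε in 𝓝[>] (0 : ℝ), ε < Metric.infDist x Uᶜ / 2 :=
      (eventually_lt_nhds (by positivity)).filter_mono nhdsWithin_le_nhds
    filter_upwards [hu.eventually hsm, hu.eventually self_mem_nhdsWithin] with n h1 h2
    rw [innerCutoff_eq_one h2 (by linarith), mul_one]
  calc ∫⁻ x in U, ENNReal.ofReal (G x)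
      = ∫⁻ x in U, liminf (fun n => ENNReal.ofReal (G x * innerCutoff U (u n) x)) atTop := by
        refine setLIntegral_congr_fun hU.1.measurableSet fun x hx => ?_
        exact (hlim x hx).liminf_eq.symm
    _ ≤ liminf (fun n => ∫⁻ x in U, ENNReal.ofReal (G x * innerCutoff U (u n) x)) atTop := by
        refine lintegral_liminf_le' fun n => ?_
        have hm : Continuous (innerCutoff U (u n)) := by
          unfold innerCutoff
          have := Metric.continuous_infDist_pt Uᶜ
          fun_prop
        exact (hG.mul hm).measurable.ennreal_ofReal.aemeasurable
    _ ≤ _ := by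
        refine liminf_le_of_frequently_le' ?_
        exact (hu.eventually hbound).frequently

end Divergence

end Carleman

namespace Carleman

/-! ### The multiplier identity and its coercivity -/

section PointwiseIdentity

variable {d : ℕ}

/-- The trace of an endomorphism of `ℝ^d`; the divergence of a field is the trace of its
derivative. -/
noncomputable def tr (T : E d →L[ℝ] E d) : ℝ := ∑ i, T (unitVec i) i

theorem map_eq_sum_unitVec (a : E d →L[ℝ] ℝ) (w : E d) : a w = ∑ i, a (unitVec i) * w i := by
  conv_lhs => rw [← (EuclideanSpace.basisFun (Fin d) ℝ).sum_repr w]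
  rw [map_sum]
  refine Finset.sum_congr rfl fun i _ => ?_
  rw [map_smul, smul_eq_mul, mul_comm]
  simp [unitVec]

theorem tr_add (S T : E d →L[ℝ] E d) : tr (S + T) = tr S + tr T := by
  simp [tr, Finset.sum_add_distrib]

theorem tr_smul (c : ℝ) (T : E d →L[ℝ] E d) : tr (c • T) = c * tr T := by
  simp [tr, Finset.mul_sum]

theorem tr_smulRight (a : E d →L[ℝ] ℝ) (w : E d) : tr (a.smulRight w) = a w := by
  rw [map_eq_sum_unitVec]
  simp [tr]

theorem abs_tr_le (T : E d →L[ℝ] E d) : |tr T| ≤ d * ‖T‖ := by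
  calc |tr T| ≤ ∑ i : Fin d, |T (unitVec i) i| := Finset.abs_sum_le_sum_abs _ _
    _ ≤ ∑ _i : Fin d, ‖T‖ := by
        refine Finset.sum_le_sum fun i _ => ?_
        have h1 := PiLp.norm_apply_le (T (unitVec i)) i
        have h2 := T.le_opNorm (unitVec i)
        rw [norm_unitVec, mul_one] at h2
        exact h1.trans h2
    _ = _ := by simp

/-- The flux of the multiplier identity for `Δv + τ²|Φ|²v` against `2Φ·p + hv`, `p = ∇v`. -/
noncomputable def flux (τ h v : ℝ) (p Φ : E d) : E d :=
  (2 * inner ℝ Φ p + h * v) • p + (τ ^ 2 * ‖Φ‖ ^ 2 * v ^ 2 - ‖p‖ ^ 2) • Φ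

/-- Here `A` is the Hessian of the weight, `B` that of `v`, and `k` the derivative of `h`. The
second derivatives of `v` coming from `(2Φ·p)p` and from `|p|²Φ` cancel because `B` is symmetric,
except for `tr B`, which combines with the multiplier. What is left is a quadratic form in `(v, p)`
with coefficients from `A`, `h` and `k`. -/
theorem hasFDerivAt_flux {v h : E d → ℝ} {p Φ : E d → E d} {x : E d} {A B : E d →L[ℝ] E d}
    {k : E d →L[ℝ] ℝ} (τ : ℝ) (hv : HasFDerivAt v (innerSL ℝ (p x)) x)
    (hp : HasFDerivAt p B x) (hΦ : HasFDerivAt Φ A x) (hh : HasFDerivAt h k x)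
    (hB : ∀ a b, inner ℝ (B a) b = inner ℝ (B b) a) :
    ∃ F' : E d →L[ℝ] E d, HasFDerivAt (fun z => flux τ (h z) (v z) (p z) (Φ z)) F' x ∧
      tr F' = (tr B + τ ^ 2 * ‖Φ x‖ ^ 2 * v x) * (2 * inner ℝ (Φ x) (p x) + h x * v x)
        + 2 * inner ℝ (A (p x)) (p x) - tr A * ‖p x‖ ^ 2
        + τ ^ 2 * v x ^ 2 * (2 * inner ℝ (A (Φ x)) (Φ x) + ‖Φ x‖ ^ 2 * tr A)
        + h x * ‖p x‖ ^ 2 + v x * k (p x) - τ ^ 2 * ‖Φ x‖ ^ 2 * h x * v x ^ 2 := by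
  have h1 := (((hΦ.inner ℝ hp).const_mul 2).add (hh.mul hv)).smul hp
  have h2 := ((((hΦ.norm_sq).const_mul (τ ^ 2)).mul (hv.pow 2)).sub hp.norm_sq).smul hΦ
  refine ⟨_, h1.add h2, ?_⟩
  rw [tr_add, tr_add, tr_add, tr_smul, tr_smul, tr_smulRight, tr_smulRight]
  simp only [Pi.mul_apply, Pi.add_apply, Pi.sub_apply]
  simp [fderivInnerCLM_apply]
  have e1 : inner ℝ (Φ x) (B (p x)) = inner ℝ (p x) (B (Φ x)) := by
    rw [real_inner_comm, hB (p x) (Φ x), real_inner_comm]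
  rw [e1, real_inner_comm (Φ x) (p x), real_inner_comm (A (Φ x)) (Φ x)]
  ring

/-- The scalars stand for `N = |∇ψ|²`, `T = Δψ`, `q₁ = D²ψ p·p`, `q₂ = D²ψ∇ψ·∇ψ`, `s = ∇ψ·p`, `kp =
∇h·p`. With `h = λγ²φN` the leading coefficients are `(λ - 1)γ²φN` for `|p|²` (plus a square) and
`(3 - λ)τ²γ⁴φ³N²` for `v²`; the value `λ = 2` makes both positive. The terms with `T`, `q₁`, `q₂`
have one power of `γ` less and are absorbed through `hγK`, while `v * kp` is absorbed by large `τ`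
through `hτk`. -/
theorem flux_coercive {N c K D γ τ φ v q₁ q₂ s T kp pn k₀ : ℝ} (hc : 0 < c)
    (hN : c ^ 2 ≤ N) (hT : |T| ≤ D * K) (hq₁ : |q₁| ≤ K * pn ^ 2)
    (hq₂ : |q₂| ≤ K * N) (hφ : 1 ≤ φ) (hγ : 1 ≤ γ) (hγK : 2 * ((D + 2) * K) ≤ γ * c ^ 2)
    (hτk : 4 * k₀ ^ 2 ≤ τ ^ 2 * c ^ 6) (hkp : |kp| ≤ k₀ * γ ^ 3 * φ * pn) :
    c ^ 2 / 4 * (γ ^ 2 * φ * pn ^ 2) + c ^ 4 / 4 * (τ ^ 2 * γ ^ 4 * φ ^ 3 * v ^ 2) ≤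
      2 * (γ * φ * (q₁ + γ * s ^ 2)) - γ * φ * (T + γ * N) * pn ^ 2
        + τ ^ 2 * v ^ 2 * (2 * (γ ^ 3 * φ ^ 3 * (q₂ + γ * N ^ 2))
          + γ ^ 2 * φ ^ 2 * N * (γ * φ * (T + γ * N)))
        + 2 * γ ^ 2 * φ * N * pn ^ 2 + v * kp
        - τ ^ 2 * (γ ^ 2 * φ ^ 2 * N) * (2 * γ ^ 2 * φ * N) * v ^ 2 := by
  have hφ0 : 0 < φ := by linarith
  have hγ0 : 0 < γ := by linarith
  have hN0 : 0 < N := lt_of_lt_of_le (by positivity) hN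
  have hT' := abs_le.1 hT
  have hq₁' := abs_le.1 hq₁
  have hq₂' := abs_le.1 hq₂
  have hγc : γ * c ^ 2 ≤ γ * N := by gcongr
  have hγN : γ * c ^ 2 / 2 ≤ γ * N - (D + 2) * K := by linarith
  have hγN' : γ * N / 2 ≤ γ * N - (D + 2) * K := by linarith
  -- the gradient part
  have h1 : c ^ 2 / 2 * (γ ^ 2 * φ * pn ^ 2) ≤ 2 * (γ * φ * (q₁ + γ * s ^ 2))
      - γ * φ * (T + γ * N) * pn ^ 2 + 2 * γ ^ 2 * φ * N * pn ^ 2 := by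
    have h11 : 0 ≤ γ * φ * (γ * s ^ 2) := by positivity
    have h12 : γ * φ * (-(K * pn ^ 2)) ≤ γ * φ * q₁ := by gcongr; exact hq₁'.1
    have h13 : γ * φ * pn ^ 2 * T ≤ γ * φ * pn ^ 2 * (D * K) := by gcongr; exact hT'.2
    have h14 : γ * φ * pn ^ 2 * (γ * c ^ 2 / 2) ≤ γ * φ * pn ^ 2 * (γ * N - (D + 2) * K) := by
      gcongr
    linarith
  -- the zeroth order part
  have h2 : c ^ 4 / 2 * (τ ^ 2 * γ ^ 4 * φ ^ 3 * v ^ 2) ≤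
      τ ^ 2 * v ^ 2 * (2 * (γ ^ 3 * φ ^ 3 * (q₂ + γ * N ^ 2))
          + γ ^ 2 * φ ^ 2 * N * (γ * φ * (T + γ * N)))
        - τ ^ 2 * (γ ^ 2 * φ ^ 2 * N) * (2 * γ ^ 2 * φ * N) * v ^ 2 := by
    set Z := τ ^ 2 * v ^ 2 * (γ ^ 3 * φ ^ 3) with hZ
    have hZ0 : 0 ≤ Z := by positivity
    have h21 : Z * (-(K * N)) ≤ Z * q₂ := by gcongr; exact hq₂'.1
    have h22 : Z * N * (-(D * K)) ≤ Z * N * T := by gcongr; exact hT'.1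
    have h23 : Z * N * (γ * N / 2) ≤ Z * N * (γ * N - (D + 2) * K) := by gcongr
    have h24 : c ^ 4 ≤ N ^ 2 := by
      calc c ^ 4 = (c ^ 2) ^ 2 := by ring
        _ ≤ N ^ 2 := by gcongr
    have h25 : Z * γ / 2 * c ^ 4 ≤ Z * γ / 2 * N ^ 2 := by gcongr
    have e1 : c ^ 4 / 2 * (τ ^ 2 * γ ^ 4 * φ ^ 3 * v ^ 2) = Z * γ / 2 * c ^ 4 := by
      rw [hZ]; ring
    have e2 : τ ^ 2 * v ^ 2 * (2 * (γ ^ 3 * φ ^ 3 * (q₂ + γ * N ^ 2))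
          + γ ^ 2 * φ ^ 2 * N * (γ * φ * (T + γ * N)))
        - τ ^ 2 * (γ ^ 2 * φ ^ 2 * N) * (2 * γ ^ 2 * φ * N) * v ^ 2
        = 2 * (Z * q₂) + Z * N * T + Z * γ * N ^ 2 := by
      rw [hZ]; ring
    rw [e1, e2]
    linarith
  -- the term with the gradient of the multiplier
  have h3 : -(v * kp) ≤ c ^ 2 / 4 * (γ ^ 2 * φ * pn ^ 2)
      + c ^ 4 / 4 * (τ ^ 2 * γ ^ 4 * φ ^ 3 * v ^ 2) := by
    have h31 : -(v * kp) ≤ |v| * (k₀ * γ ^ 3 * φ * pn) := by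
      calc -(v * kp) ≤ |v| * |kp| := by rw [← abs_mul]; exact neg_le_abs _
        _ ≤ _ := by gcongr
    -- Young's inequality from a completed square; the factor `c ^ 2` avoids division and is
    -- cancelled at the end.
    have h32 : c ^ 2 * (|v| * (k₀ * γ ^ 3 * φ * pn)) ≤ c ^ 2 * (c ^ 2 / 4 * (γ ^ 2 * φ * pn ^ 2))
        + γ ^ 4 * φ * v ^ 2 * k₀ ^ 2 := by
      have := mul_nonneg (by positivity : 0 ≤ γ ^ 2 * φ)
        (sq_nonneg (c ^ 2 / 2 * pn - γ * |v| * k₀))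
      have e : (c ^ 2 / 2 * pn - γ * |v| * k₀) ^ 2
          = c ^ 4 / 4 * pn ^ 2 - c ^ 2 * pn * γ * |v| * k₀ + γ ^ 2 * v ^ 2 * k₀ ^ 2 := by
        rw [← sq_abs v]; ring
      rw [e] at this
      linarith
    have h33 : γ ^ 4 * φ * v ^ 2 * k₀ ^ 2 ≤
        c ^ 2 * (c ^ 4 / 4 * (τ ^ 2 * γ ^ 4 * φ ^ 3 * v ^ 2)) := by
      have h331 : γ ^ 4 * φ * v ^ 2 * k₀ ^ 2 ≤ γ ^ 4 * φ * v ^ 2 * (τ ^ 2 * c ^ 6 / 4) := by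
        gcongr; linarith
      have h332 : φ ≤ φ ^ 3 := le_self_pow₀ hφ (by norm_num)
      have h333 : γ ^ 4 * v ^ 2 * (τ ^ 2 * c ^ 6 / 4) * φ
          ≤ γ ^ 4 * v ^ 2 * (τ ^ 2 * c ^ 6 / 4) * φ ^ 3 := by gcongr
      linarith
    have h34 : c ^ 2 * (-(v * kp)) ≤ c ^ 2 * (c ^ 2 / 4 * (γ ^ 2 * φ * pn ^ 2)
      + c ^ 4 / 4 * (τ ^ 2 * γ ^ 4 * φ ^ 3 * v ^ 2)) := by
      have := mul_le_mul_of_nonneg_left h31 (by positivity : 0 ≤ c ^ 2)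
      linarith
    exact le_of_mul_le_mul_left h34 (by positivity)
  linarith

/-- The remainder `R = τ(h - Δφ)v` satisfies `|R| ≲ τγ²φ|v|`, so its square carries `τ²`, one power
below the `τ³` supplied by `4τQ`. Half of the zeroth-order term is spent on absorbing it. -/
theorem carleman_pointwise {N b c K D γ τ φ v T pn S M Q : ℝ} (hc : 0 < c)
    (hN0 : 0 ≤ N) (hNb : N ≤ b ^ 2) (hK : 0 ≤ K) (hD : 0 ≤ D) (hT : |T| ≤ D * K)
    (hφ : 1 ≤ φ) (hγ : 1 ≤ γ) (hτ : 1 ≤ τ) (hτb : 4 * (b ^ 2 + D * K) ^ 2 ≤ τ * c ^ 4)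
    (hQ : c ^ 2 / 4 * (γ ^ 2 * φ * pn ^ 2) + c ^ 4 / 4 * (τ ^ 2 * γ ^ 4 * φ ^ 3 * v ^ 2) ≤ Q) :
    τ * c ^ 2 * γ ^ 2 * φ * pn ^ 2 + c ^ 4 / 2 * (τ ^ 3 * γ ^ 4 * φ ^ 3 * v ^ 2) ≤
      4 * τ * (S * M + Q) + 2 * (S - τ * M + τ * (γ * φ * (γ * N - T)) * v) ^ 2 := by
  have hφ0 : 0 < φ := by linarith
  have hγ0 : 0 < γ := by linarith
  have hτ0 : 0 < τ := by linarith
  have hT' := abs_le.1 hT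
  have h1 : (γ * N - T) ^ 2 ≤ (γ * (b ^ 2 + D * K)) ^ 2 := by
    have hDK : 0 ≤ D * K := by positivity
    refine sq_le_sq' ?_ ?_ <;> nlinarith
  set R := τ * (γ * φ * (γ * N - T)) * v with hR
  have h2 : 2 * R ^ 2 ≤ c ^ 4 / 2 * (τ ^ 3 * γ ^ 4 * φ ^ 3 * v ^ 2) := by
    have e : R ^ 2 = τ ^ 2 * γ ^ 2 * φ ^ 2 * v ^ 2 * (γ * N - T) ^ 2 := by rw [hR]; ring
    have h21 : τ ^ 2 * γ ^ 2 * φ ^ 2 * v ^ 2 * (γ * N - T) ^ 2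
        ≤ τ ^ 2 * γ ^ 2 * φ ^ 2 * v ^ 2 * (γ * (b ^ 2 + D * K)) ^ 2 := by gcongr
    have h22 : τ ^ 2 * γ ^ 4 * φ ^ 2 * v ^ 2 * (4 * (b ^ 2 + D * K) ^ 2)
        ≤ τ ^ 2 * γ ^ 4 * φ ^ 2 * v ^ 2 * (τ * c ^ 4) := by gcongr
    have h23 : τ ^ 3 * γ ^ 4 * v ^ 2 * c ^ 4 * φ ^ 2 ≤ τ ^ 3 * γ ^ 4 * v ^ 2 * c ^ 4 * φ ^ 3 := by
      have : φ ^ 2 ≤ φ ^ 3 := pow_le_pow_right₀ hφ (by norm_num)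
      gcongr
    rw [e]
    linarith
  have h3 := mul_le_mul_of_nonneg_left hQ (by positivity : 0 ≤ 4 * τ)
  -- With `a = S - τM`, `2(a + R)² = a² - 2R² + (a + 2R)²` and `a² + 4τSM = (S + τM)²`, so only `4τQ
  -- - 2R²` remains.
  linarith [sq_nonneg (S - τ * M + 2 * R), sq_nonneg (S + τ * M)]

end PointwiseIdentity

end Carleman

namespace Carleman

/-! ### Conjugation with the exponential weight -/

section Conjugation

variable {d : ℕ}

theorem _root_.DifferentiableAt.hasFDerivAt_innerSL_gradient {f : E d → ℝ} {x : E d}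
    (h : DifferentiableAt ℝ f x) : HasFDerivAt f (innerSL ℝ (gradient f x)) x := by
  have := h.hasGradientAt.hasFDerivAt
  refine this.congr_fderiv ?_
  ext w
  simp

/-- The gradient of the weight `e^{γψ}`, in terms of the gradient `Ψ` of `ψ`. -/
noncomputable def weightGrad (γ : ℝ) (ψ : E d → ℝ) (Ψ : E d → E d) (x : E d) : E d :=
  (γ * weight γ ψ x) • Ψ x

/-- The conjugated function `e^{τφ} u`. -/
noncomputable def conj (γ τ : ℝ) (ψ u : E d → ℝ) (x : E d) : ℝ :=
  Real.exp (τ * weight γ ψ x) * u x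

/-- The gradient of the conjugated function `e^{τφ} u`. -/
noncomputable def conjGrad (γ τ : ℝ) (ψ : E d → ℝ) (Ψ : E d → E d) (u : E d → ℝ) (x : E d) :
    E d :=
  Real.exp (τ * weight γ ψ x) • (gradient u x + (τ * u x) • weightGrad γ ψ Ψ x)

/-- The zeroth order multiplier. -/
noncomputable def multiplier (γ : ℝ) (ψ : E d → ℝ) (Ψ : E d → E d) (x : E d) : ℝ :=
  2 * γ ^ 2 * (weight γ ψ x * ‖Ψ x‖ ^ 2)

/-- The flux field whose boundary values give the boundary terms of the Carleman estimate. -/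
noncomputable def carlemanFlux (γ τ : ℝ) (ψ : E d → ℝ) (Ψ : E d → E d) (u : E d → ℝ) (x : E d) :
    E d :=
  flux τ (multiplier γ ψ Ψ x) (conj γ τ ψ u x) (conjGrad γ τ ψ Ψ u x) (weightGrad γ ψ Ψ x)

theorem hasFDerivAt_weight {γ : ℝ} {ψ : E d → ℝ} {Ψ : E d → E d} {x : E d}
    (h : HasFDerivAt ψ (innerSL ℝ (Ψ x)) x) :
    HasFDerivAt (weight γ ψ) (innerSL ℝ (weightGrad γ ψ Ψ x)) x := by
  refine (h.const_mul γ).exp.congr_fderiv ?_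
  ext w
  simp [weightGrad, weight]
  ring

theorem hasFDerivAt_expWeight {γ τ : ℝ} {ψ : E d → ℝ} {Ψ : E d → E d} {x : E d}
    (h : HasFDerivAt ψ (innerSL ℝ (Ψ x)) x) :
    HasFDerivAt (fun y => Real.exp (τ * weight γ ψ y))
      (Real.exp (τ * weight γ ψ x) • τ • innerSL ℝ (weightGrad γ ψ Ψ x)) x :=
  ((hasFDerivAt_weight h).const_mul τ).exp

theorem hasFDerivAt_conj {γ τ : ℝ} {ψ u : E d → ℝ} {Ψ : E d → E d} {x : E d}
    (h : HasFDerivAt ψ (innerSL ℝ (Ψ x)) x) (hu : DifferentiableAt ℝ u x) :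
    HasFDerivAt (conj γ τ ψ u) (innerSL ℝ (conjGrad γ τ ψ Ψ u x)) x := by
  refine ((hasFDerivAt_expWeight h).mul hu.hasFDerivAt_innerSL_gradient).congr_fderiv ?_
  ext w
  simp [conjGrad]
  ring

theorem contDiff_gradient {u : E d → ℝ} (hu : ContDiff ℝ ∞ u) : ContDiff ℝ ∞ (gradient u) := by
  unfold gradient
  exact (InnerProductSpace.toDual ℝ (E d)).symm.contDiff.comp (hu.fderiv_right le_rfl)

/-- This instantiates the algebra at a point where `∇ψ` is differentiable, hence almost everywhere
for `ψ` in `C^{1,1}`. The Hessian of the weight there is `γφ(D + γ ∇ψ⊗∇ψ)`. -/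
theorem carlemanFlux_coercive {γ τ b c K k₀ : ℝ} {ψ u : E d → ℝ} {Ψ : E d → E d} {x : E d}
    {D : E d →L[ℝ] E d} (hψ : ∀ᶠ y in 𝓝 x, HasFDerivAt ψ (innerSL ℝ (Ψ y)) y)
    (hΨ : HasFDerivAt Ψ D x) (hu : ContDiff ℝ ∞ u) (hc : 0 < c) (hΨc : c ≤ ‖Ψ x‖)
    (hΨb : ‖Ψ x‖ ≤ b) (hDK : ‖D‖ ≤ K) (hφ : 1 ≤ weight γ ψ x) (hγ : 1 ≤ γ)
    (hγK : 2 * ((d + 2) * K) ≤ γ * c ^ 2) (hτ : 1 ≤ τ)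
    (hk₀ : k₀ = 2 * b ^ 3 + 4 * K * b) (hτk : 4 * k₀ ^ 2 ≤ τ ^ 2 * c ^ 6)
    (hτb : 4 * (b ^ 2 + d * K) ^ 2 ≤ τ * c ^ 4) :
    ∃ F' : E d →L[ℝ] E d, HasFDerivAt (carlemanFlux γ τ ψ Ψ u) F' x ∧
      τ * c ^ 2 * γ ^ 2 * weight γ ψ x * ‖conjGrad γ τ ψ Ψ u x‖ ^ 2
        + c ^ 4 / 2 * (τ ^ 3 * γ ^ 4 * weight γ ψ x ^ 3 * conj γ τ ψ u x ^ 2) ≤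
      4 * τ * tr F' +
        2 * (Real.exp (τ * weight γ ψ x) * tr (fderiv ℝ (gradient u) x)) ^ 2 := by
  have hψx := hψ.self_of_nhds
  have hgu : HasFDerivAt (gradient u) (fderiv ℝ (gradient u) x) x :=
    ((contDiff_gradient hu).differentiable (by simp) x).hasFDerivAt
  have hux := (hu.differentiable (by simp) x)
  have hw := hasFDerivAt_weight (γ := γ) hψx
  have he := hasFDerivAt_expWeight (γ := γ) (τ := τ) hψx
  set A : E d →L[ℝ] E d := (γ * weight γ ψ x) • D
    + (γ • innerSL ℝ (weightGrad γ ψ Ψ x)).smulRight (Ψ x) with hA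
  have hΦ : HasFDerivAt (weightGrad γ ψ Ψ) A x := (hw.const_mul γ).smul hΨ
  set B : E d →L[ℝ] E d := Real.exp (τ * weight γ ψ x) • (fderiv ℝ (gradient u) x
      + ((τ * u x) • A + (τ • innerSL ℝ (gradient u x)).smulRight (weightGrad γ ψ Ψ x)))
    + (Real.exp (τ * weight γ ψ x) • τ • innerSL ℝ (weightGrad γ ψ Ψ x)).smulRight
      (gradient u x + (τ * u x) • weightGrad γ ψ Ψ x) with hB
  have hp : HasFDerivAt (conjGrad γ τ ψ Ψ u) B x :=
    he.smul (hgu.add ((hux.hasFDerivAt_innerSL_gradient.const_mul τ).smul hΦ))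
  have hv : HasFDerivAt (conj γ τ ψ u) (innerSL ℝ (conjGrad γ τ ψ Ψ u x)) x :=
    hasFDerivAt_conj hψx hux
  -- Symmetry of the Hessian needs only that `conjGrad` is the gradient of `conj` near `x` and is
  -- differentiable at `x` itself; no `C²` regularity is used.
  have hBsym : ∀ a b, inner ℝ (B a) b = inner ℝ (B b) a := by
    intro a b
    have hev : ∀ᶠ y in 𝓝 x, HasFDerivAt (conj γ τ ψ u) (innerSL ℝ (conjGrad γ τ ψ Ψ u y)) y :=
      hψ.mono fun y hy => hasFDerivAt_conj hy (hu.differentiable (by simp) y)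
    exact second_derivative_symmetric_of_eventually hev
      (((innerSL ℝ : E d →L[ℝ] E d →L[ℝ] ℝ).hasFDerivAt).comp x hp) a b
  set k : E d →L[ℝ] ℝ := (2 * γ ^ 2) • (weight γ ψ x • (2 • (innerSL ℝ (Ψ x)).comp D)
    + ‖Ψ x‖ ^ 2 • innerSL ℝ (weightGrad γ ψ Ψ x)) with hk
  have hh : HasFDerivAt (multiplier γ ψ Ψ) k x := (hw.mul hΨ.norm_sq).const_mul (2 * γ ^ 2)
  obtain ⟨F', hF', htr⟩ := hasFDerivAt_flux τ hv hp hΦ hh hBsym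
  refine ⟨F', hF', ?_⟩
  rw [htr]
  set φ := weight γ ψ x with hφdef
  set p := conjGrad γ τ ψ Ψ u x with hpdef
  set v := conj γ τ ψ u x with hvdef
  set N := ‖Ψ x‖ ^ 2 with hNdef
  set e := Real.exp (τ * φ) with hedef
  have hφ0 : 0 < φ := by linarith
  have hγ0 : 0 < γ := by linarith
  have hb0 : 0 ≤ b := (norm_nonneg _).trans hΨb
  have hK0 : 0 ≤ K := (norm_nonneg _).trans hDK
  have hΦx : weightGrad γ ψ Ψ x = (γ * φ) • Ψ x := rfl
  have hΦN : ‖weightGrad γ ψ Ψ x‖ ^ 2 = γ ^ 2 * φ ^ 2 * N := by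
    rw [hΦx, norm_smul, Real.norm_of_nonneg (by positivity)]; ring
  have hself : inner ℝ (Ψ x) (Ψ x) = N := real_inner_self_eq_norm_sq _
  have htrA : tr A = γ * φ * (tr D + γ * N) := by
    rw [hA, tr_add, tr_smul, tr_smulRight]
    simp [hΦx, hNdef]
    ring
  have hAp : inner ℝ (A p) p = γ * φ * (inner ℝ (D p) p + γ * inner ℝ (Ψ x) p ^ 2) := by
    rw [hA]
    simp [hΦx, inner_smul_left, inner_add_left]
    ring
  have hAΦ : inner ℝ (A (weightGrad γ ψ Ψ x)) (weightGrad γ ψ Ψ x)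
      = γ ^ 3 * φ ^ 3 * (inner ℝ (D (Ψ x)) (Ψ x) + γ * N ^ 2) := by
    rw [hA]
    simp [hΦx, inner_smul_left, inner_smul_right, inner_add_left, hNdef]
    ring
  have hhx : multiplier γ ψ Ψ x = 2 * γ ^ 2 * φ * N := by
    rw [multiplier, ← hφdef, ← hNdef]; ring
  -- The conjugation identity `e^{τφ}Δu = S - τM + τ(h - Δφ)v`; here `h - Δφ = γφ(γN - Δψ)`.
  have hf : e * tr (fderiv ℝ (gradient u) x) =
      (tr B + τ ^ 2 * (γ ^ 2 * φ ^ 2 * N) * v)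
        - τ * (2 * inner ℝ (weightGrad γ ψ Ψ x) p + 2 * γ ^ 2 * φ * N * v)
        + τ * (γ * φ * (γ * N - tr D)) * v := by
    have h1 : v = e * u x := rfl
    have h2 : p = e • (gradient u x + (τ * u x) • weightGrad γ ψ Ψ x) := rfl
    rw [hB]
    simp only [tr_add, tr_smul, tr_smulRight, htrA, h1, h2, inner_smul_right, inner_add_right,
      innerSL_apply_apply, smul_apply, smul_eq_mul,
      real_inner_self_eq_norm_sq, hΦN, real_inner_comm (weightGrad γ ψ Ψ x) (gradient u x)]
    ring
  have hT : |tr D| ≤ d * K := (abs_tr_le D).trans (by gcongr)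
  have hq : ∀ w : E d, |inner ℝ (D w) w| ≤ K * ‖w‖ ^ 2 := fun w => by
    calc |inner ℝ (D w) w| ≤ ‖D w‖ * ‖w‖ := abs_real_inner_le_norm _ _
      _ ≤ (K * ‖w‖) * ‖w‖ := by gcongr; exact D.le_of_opNorm_le hDK w
      _ = _ := by ring
  have hkp : |k p| ≤ k₀ * γ ^ 3 * φ * ‖p‖ := by
    have e1 : k p = 2 * γ ^ 2 * φ * (2 * inner ℝ (Ψ x) (D p) + γ * N * inner ℝ (Ψ x) p) := by
      rw [hk]
      simp [hΦx, hNdef]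
      ring
    have h1 : |inner ℝ (Ψ x) (D p)| ≤ b * (K * ‖p‖) := (abs_real_inner_le_norm _ _).trans (by
      gcongr; exact D.le_of_opNorm_le hDK p)
    have h2 : |inner ℝ (Ψ x) p| ≤ b * ‖p‖ := (abs_real_inner_le_norm _ _).trans (by gcongr)
    have hNb : N ≤ b ^ 2 := by rw [hNdef]; gcongr
    have hN0 : 0 ≤ N := by positivity
    have h3 : |2 * inner ℝ (Ψ x) (D p) + γ * N * inner ℝ (Ψ x) p|
        ≤ 2 * (b * (K * ‖p‖)) + γ * b ^ 2 * (b * ‖p‖) := by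
      refine (abs_add_le _ _).trans ?_
      rw [abs_mul, abs_mul, abs_of_pos (by norm_num : (0 : ℝ) < 2),
        abs_of_nonneg (by positivity : 0 ≤ γ * N)]
      gcongr
    have h4 : 2 * (b * (K * ‖p‖)) ≤ γ * (2 * (b * (K * ‖p‖))) :=
      le_mul_of_one_le_left (by positivity) hγ
    rw [e1, abs_mul, abs_of_nonneg (by positivity : 0 ≤ 2 * γ ^ 2 * φ), hk₀]
    calc 2 * γ ^ 2 * φ * |2 * inner ℝ (Ψ x) (D p) + γ * N * inner ℝ (Ψ x) p|
        ≤ 2 * γ ^ 2 * φ * (γ * (2 * (b * (K * ‖p‖))) + γ * b ^ 2 * (b * ‖p‖)) := by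
          gcongr; linarith
      _ = _ := by ring
  have hNc : c ^ 2 ≤ N := by rw [hNdef]; gcongr
  have hcoer := flux_coercive (v := v) (s := inner ℝ (Ψ x) p) hc hNc
    hT (hq p) (hq (Ψ x)) hφ hγ hγK hτk hkp
  have hpt := carleman_pointwise (S := tr B + τ ^ 2 * (γ ^ 2 * φ ^ 2 * N) * v)
    (M := 2 * inner ℝ (weightGrad γ ψ Ψ x) p + 2 * γ ^ 2 * φ * N * v) hc (by positivity)
    (pow_le_pow_left₀ (norm_nonneg _) hΨb 2) hK0 (by positivity : (0 : ℝ) ≤ d) hT hφ hγ hτ hτb hcoer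
  rw [← hf] at hpt
  rw [hΦN, hAp, hAΦ, hhx, htrA]
  refine hpt.trans (le_of_eq ?_)
  ring

end Conjugation

end Carleman

namespace Carleman

/-! ### Scalar inequalities returning from the conjugated function to the original one -/

section RealEstimate

variable {d : ℕ}

/-- `C₁` is chosen so that `C₁c² ≥ 2` and `C₁c⁴/2 ≥ 1 + 2b²`, which dominates the weighted `u` and
`∇u` terms by those in `v` and `∇v`. Replacing the Laplacian by `L = αΔu + ∇α·∇u` leaves a multiple
of `|∇u|²`, and `hγa` makes it at most half of the left side; this accounts for the doubling to `8 *
C₁`. -/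
theorem interior_bound {γ τ φ b c C₁ a₀ a₁ e u g lap L P t : ℝ} (hc : 0 < c)
    (hC₁ : C₁ = 2 * (1 + 2 * b ^ 2) / c ^ 4 + 2 / c ^ 2) (ha₀ : 0 < a₀) (hφ : 1 ≤ φ) (hγ : 1 ≤ γ)
    (hτ : 1 ≤ τ) (hγa : 8 * C₁ * a₁ ^ 2 ≤ γ * a₀ ^ 2)
    (hL : lap ^ 2 * a₀ ^ 2 ≤ 2 * L ^ 2 + 2 * a₁ ^ 2 * g ^ 2)
    (hg : e ^ 2 * g ^ 2 ≤ 2 * P + 2 * τ ^ 2 * γ ^ 2 * φ ^ 2 * b ^ 2 * (e * u) ^ 2) (hP : 0 ≤ P)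
    (hpt : τ * c ^ 2 * γ ^ 2 * φ * P + c ^ 4 / 2 * (τ ^ 3 * γ ^ 4 * φ ^ 3 * (e * u) ^ 2)
      ≤ 4 * τ * t + 2 * (e * lap) ^ 2) :
    τ ^ 3 * γ ^ 4 * φ ^ 3 * e ^ 2 * u ^ 2 + τ * γ ^ 2 * e ^ 2 * g ^ 2
      ≤ 8 * C₁ / a₀ ^ 2 * (e ^ 2 * L ^ 2) + 8 * C₁ * τ * t := by
  have hC₁0 : 0 < C₁ := by rw [hC₁]; positivity
  have hφ0 : 0 < φ := by linarith
  have hγ0 : 0 < γ := by linarith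
  have hτ0 : 0 < τ := by linarith
  set T := τ ^ 3 * γ ^ 4 * φ ^ 3 * e ^ 2 * u ^ 2 + τ * γ ^ 2 * e ^ 2 * g ^ 2 with hT
  set X := τ * γ ^ 2 * φ * P with hX
  set Y := τ ^ 3 * γ ^ 4 * φ ^ 3 * (e * u) ^ 2 with hY
  have hX0 : 0 ≤ X := by positivity
  have hY0 : 0 ≤ Y := by positivity
  have h1 : T ≤ 2 * X + (1 + 2 * b ^ 2) * Y := by
    have h11 := mul_le_mul_of_nonneg_left hg (by positivity : 0 ≤ τ * γ ^ 2)
    have h12 : τ * γ ^ 2 * P * 1 ≤ τ * γ ^ 2 * P * φ := by gcongr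
    have h13 : φ ^ 2 ≤ φ ^ 3 := pow_le_pow_right₀ hφ (by norm_num)
    have h14 : τ ^ 3 * γ ^ 4 * b ^ 2 * (e * u) ^ 2 * φ ^ 2
      ≤ τ ^ 3 * γ ^ 4 * b ^ 2 * (e * u) ^ 2 * φ ^ 3 := by gcongr
    rw [hT, hX, hY]
    linarith
  have h2 : 2 * X + (1 + 2 * b ^ 2) * Y ≤ C₁ * (c ^ 2 * X + c ^ 4 / 2 * Y) := by
    have e1 : C₁ * (c ^ 2 * X + c ^ 4 / 2 * Y) = 2 * X + (1 + 2 * b ^ 2) * Y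
        + (2 * (1 + 2 * b ^ 2) / c ^ 2 * X + c ^ 2 * Y) := by
      rw [hC₁]
      field_simp
      ring
    rw [e1]
    have : 0 ≤ 2 * (1 + 2 * b ^ 2) / c ^ 2 * X + c ^ 2 * Y := by positivity
    linarith
  have h3 : C₁ * (c ^ 2 * X + c ^ 4 / 2 * Y) ≤ C₁ * (4 * τ * t + 2 * (e * lap) ^ 2) := by
    refine mul_le_mul_of_nonneg_left ?_ hC₁0.le
    rw [hX]
    linarith
  have h4 : C₁ * (2 * (e * lap) ^ 2) ≤ 4 * C₁ / a₀ ^ 2 * (e ^ 2 * L ^ 2) + T / 2 := by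
    have h41 : C₁ * (2 * (e * lap) ^ 2) = 2 * C₁ / a₀ ^ 2 * (e ^ 2 * (lap ^ 2 * a₀ ^ 2)) := by
      field_simp
    have h42 : 2 * C₁ / a₀ ^ 2 * (e ^ 2 * (lap ^ 2 * a₀ ^ 2))
        ≤ 2 * C₁ / a₀ ^ 2 * (e ^ 2 * (2 * L ^ 2 + 2 * a₁ ^ 2 * g ^ 2)) := by gcongr
    have h43 : 2 * C₁ / a₀ ^ 2 * (e ^ 2 * (2 * L ^ 2 + 2 * a₁ ^ 2 * g ^ 2))
        = 4 * C₁ / a₀ ^ 2 * (e ^ 2 * L ^ 2) + 8 * C₁ * a₁ ^ 2 / a₀ ^ 2 * (e ^ 2 * g ^ 2) / 2 := by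
      ring
    have h44 : 8 * C₁ * a₁ ^ 2 / a₀ ^ 2 ≤ τ * γ ^ 2 := by
      rw [div_le_iff₀ (by positivity)]
      have h441 : γ ≤ τ * γ ^ 2 := by nlinarith [mul_pos hτ0 hγ0]
      calc _ ≤ γ * a₀ ^ 2 := hγa
        _ ≤ _ := by gcongr
    have h45 : 8 * C₁ * a₁ ^ 2 / a₀ ^ 2 * (e ^ 2 * g ^ 2) ≤ τ * γ ^ 2 * (e ^ 2 * g ^ 2) := by
      gcongr
    have h46 : 0 ≤ τ ^ 3 * γ ^ 4 * φ ^ 3 * e ^ 2 * u ^ 2 := by positivity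
    rw [hT]
    linarith
  have e2 : 8 * C₁ / a₀ ^ 2 * (e ^ 2 * L ^ 2) = 2 * (4 * C₁ / a₀ ^ 2 * (e ^ 2 * L ^ 2)) := by ring
  rw [e2]
  linarith

/-- Only the cross term `h v p` needs care: Young's inequality splits `γ²|v||p|` into `γ|p|²` and
`γ³v²`. The powers of `τ` and `φ` on `v²` are then raised to three, since both are at least `1`. -/
theorem norm_flux_le {γ τ φ b h v : ℝ} {p Φ : E d} (hφ : 1 ≤ φ) (hγ : 1 ≤ γ)
    (hτ : 1 ≤ τ) (hΦ : ‖Φ‖ ≤ γ * φ * b) (hh0 : 0 ≤ h) (hh : h ≤ 2 * γ ^ 2 * φ * b ^ 2) :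
    τ * ‖flux τ h v p Φ‖ ≤ (3 * b + b ^ 2) * (τ * γ * φ * ‖p‖ ^ 2)
      + (b ^ 3 + b ^ 2) * (τ ^ 3 * γ ^ 3 * φ ^ 3 * v ^ 2) := by
  have hφ0 : 0 < φ := by linarith
  have hγ0 : 0 < γ := by linarith
  have hτ0 : 0 < τ := by linarith
  have hp0 := norm_nonneg p
  have h1 : |2 * inner ℝ Φ p + h * v| ≤ 2 * (γ * φ * b * ‖p‖) + 2 * γ ^ 2 * φ * b ^ 2 * |v| := by
    refine (abs_add_le _ _).trans ?_
    rw [abs_mul, abs_mul, abs_of_pos (by norm_num : (0 : ℝ) < 2), abs_of_nonneg hh0]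
    gcongr
    exact (abs_real_inner_le_norm _ _).trans (by gcongr)
  have h2 : |τ ^ 2 * ‖Φ‖ ^ 2 * v ^ 2 - ‖p‖ ^ 2| ≤ τ ^ 2 * (γ * φ * b) ^ 2 * v ^ 2 + ‖p‖ ^ 2 := by
    refine (abs_sub _ _).trans ?_
    rw [abs_of_nonneg (by positivity), abs_of_nonneg (by positivity)]
    gcongr
  have h3 : ‖flux τ h v p Φ‖ ≤ (2 * (γ * φ * b * ‖p‖) + 2 * γ ^ 2 * φ * b ^ 2 * |v|) * ‖p‖
      + (τ ^ 2 * (γ * φ * b) ^ 2 * v ^ 2 + ‖p‖ ^ 2) * (γ * φ * b) := by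
    refine (norm_add_le _ _).trans ?_
    rw [norm_smul, norm_smul, Real.norm_eq_abs, Real.norm_eq_abs]
    gcongr
  have h4 : 2 * (τ * γ * φ * b ^ 2) * (γ * |v| * ‖p‖)
      ≤ (τ * γ * φ * b ^ 2) * (‖p‖ ^ 2 + γ ^ 2 * v ^ 2) := by
    have := mul_nonneg (by positivity : 0 ≤ τ * γ * φ * b ^ 2) (sq_nonneg (γ * |v| - ‖p‖))
    have e : (γ * |v| - ‖p‖) ^ 2 = γ ^ 2 * v ^ 2 - 2 * (γ * |v| * ‖p‖) + ‖p‖ ^ 2 := by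
      rw [← sq_abs v]; ring
    rw [e] at this
    linarith
  have h5 : b ^ 2 * γ ^ 3 * v ^ 2 * (τ * φ) ≤ b ^ 2 * γ ^ 3 * v ^ 2 * (τ ^ 3 * φ ^ 3) := by
    have h51 : τ ≤ τ ^ 3 := le_self_pow₀ hτ (by norm_num)
    have h52 : φ ≤ φ ^ 3 := le_self_pow₀ hφ (by norm_num)
    gcongr
  have h6 := mul_le_mul_of_nonneg_left h3 hτ0.le
  refine h6.trans ?_
  linarith

theorem boundary_bound {γ τ φ b e u g P f : ℝ} (hb : 0 ≤ b) (hφ : 1 ≤ φ) (hγ : 1 ≤ γ)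
    (hτ : 1 ≤ τ)
    (hP : P ≤ 2 * (e ^ 2 * g ^ 2) + 2 * τ ^ 2 * γ ^ 2 * φ ^ 2 * b ^ 2 * (e * u) ^ 2)
    (hf : f ≤ (3 * b + b ^ 2) * (τ * γ * φ * P)
      + (b ^ 3 + b ^ 2) * (τ ^ 3 * γ ^ 3 * φ ^ 3 * (e * u) ^ 2)) :
    f ≤ (2 * (3 * b + b ^ 2) * (1 + b ^ 2) + b ^ 3 + b ^ 2) *
      (τ ^ 3 * γ ^ 3 * φ ^ 3 * e ^ 2 * u ^ 2 + τ * γ * φ * e ^ 2 * g ^ 2) := by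
  have hφ0 : 0 < φ := by linarith
  have hγ0 : 0 < γ := by linarith
  have hτ0 : 0 < τ := by linarith
  have h1 : (3 * b + b ^ 2) * (τ * γ * φ * P) ≤ (3 * b + b ^ 2) * (τ * γ * φ *
      (2 * (e ^ 2 * g ^ 2) + 2 * τ ^ 2 * γ ^ 2 * φ ^ 2 * b ^ 2 * (e * u) ^ 2)) := by gcongr
  set X := τ ^ 3 * γ ^ 3 * φ ^ 3 * e ^ 2 * u ^ 2 with hX
  set Y := τ * γ * φ * e ^ 2 * g ^ 2 with hY
  have hX0 : 0 ≤ X := by positivity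
  have hY0 : 0 ≤ Y := by positivity
  have e1 : (3 * b + b ^ 2) * (τ * γ * φ *
      (2 * (e ^ 2 * g ^ 2) + 2 * τ ^ 2 * γ ^ 2 * φ ^ 2 * b ^ 2 * (e * u) ^ 2))
      = 2 * (3 * b + b ^ 2) * Y + 2 * (3 * b + b ^ 2) * b ^ 2 * X := by rw [hX, hY]; ring
  have e2 : (b ^ 3 + b ^ 2) * (τ ^ 3 * γ ^ 3 * φ ^ 3 * (e * u) ^ 2) = (b ^ 3 + b ^ 2) * X := by
    rw [hX]; ring
  rw [e1] at h1
  rw [e2] at hf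
  have h2 : 0 ≤ 2 * (3 * b + b ^ 2) * X := by positivity
  have h3 : 0 ≤ (2 * (3 * b + b ^ 2) * b ^ 2 + b ^ 3 + b ^ 2) * Y := by positivity
  linarith

theorem norm_sq_conjGrad_sub {γ τ b φ : ℝ} {ψ u : E d → ℝ} {Ψ : E d → E d} {x : E d}
    (hφ : weight γ ψ x = φ) (hΨb : ‖Ψ x‖ ≤ b) :
    Real.exp (τ * φ) ^ 2 * ‖gradient u x‖ ^ 2 ≤ 2 * ‖conjGrad γ τ ψ Ψ u x‖ ^ 2
        + 2 * τ ^ 2 * γ ^ 2 * φ ^ 2 * b ^ 2 * (Real.exp (τ * φ) * u x) ^ 2 ∧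
    ‖conjGrad γ τ ψ Ψ u x‖ ^ 2 ≤ 2 * (Real.exp (τ * φ) ^ 2 * ‖gradient u x‖ ^ 2)
        + 2 * τ ^ 2 * γ ^ 2 * φ ^ 2 * b ^ 2 * (Real.exp (τ * φ) * u x) ^ 2 := by
  have hφ0 : 0 < φ := hφ ▸ Real.exp_pos _
  have key : ∀ a b : E d, ‖a + b‖ ^ 2 ≤ 2 * ‖a‖ ^ 2 + 2 * ‖b‖ ^ 2 := fun a b => by
    have := norm_add_le a b
    nlinarith [sq_nonneg (‖a‖ - ‖b‖), norm_nonneg (a + b)]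
  set w : E d := (Real.exp (τ * φ) * (τ * u x) * (γ * φ)) • Ψ x with hw
  have hwn : ‖w‖ ^ 2 ≤ τ ^ 2 * γ ^ 2 * φ ^ 2 * b ^ 2 * (Real.exp (τ * φ) * u x) ^ 2 := by
    rw [hw, norm_smul, mul_pow, Real.norm_eq_abs, sq_abs]
    calc _ ≤ (Real.exp (τ * φ) * (τ * u x) * (γ * φ)) ^ 2 * b ^ 2 := by gcongr
      _ = _ := by ring
  have hp : conjGrad γ τ ψ Ψ u x = Real.exp (τ * φ) • gradient u x + w := by
    rw [conjGrad, weightGrad, hφ, hw, smul_add, smul_smul, smul_smul]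
  have hn : ‖Real.exp (τ * φ) • gradient u x‖ ^ 2 = Real.exp (τ * φ) ^ 2 * ‖gradient u x‖ ^ 2 := by
    rw [norm_smul, mul_pow, Real.norm_eq_abs, sq_abs]
  constructor
  · have h1 : Real.exp (τ * φ) • gradient u x = conjGrad γ τ ψ Ψ u x + -w := by
      rw [hp]; abel
    have h2 := key (conjGrad γ τ ψ Ψ u x) (-w)
    rw [← h1, hn, norm_neg] at h2
    linarith
  · have h2 := key (Real.exp (τ * φ) • gradient u x) w
    rw [← hp, hn] at h2
    linarith

end RealEstimate

end Carleman

namespace Carleman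

/-! ### The estimate for smooth real-valued functions -/

section RealCarleman

variable {d : ℕ}

theorem continuous_weight {γ : ℝ} {ψ : E d → ℝ} (hψ : Continuous ψ) :
    Continuous (weight γ ψ) := by
  unfold weight; fun_prop

theorem continuous_carlemanFlux {γ τ : ℝ} {ψ u : E d → ℝ} {Ψ : E d → E d} (hψ : Continuous ψ)
    (hΨ : Continuous Ψ) (hu : ContDiff ℝ ∞ u) : Continuous (carlemanFlux γ τ ψ Ψ u) := by
  have h1 := hu.continuous
  have h2 := (contDiff_gradient hu).continuous
  unfold carlemanFlux flux multiplier conj conjGrad weightGrad weight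
  fun_prop

theorem locallyLipschitzOn_of_hasFDerivAt {U : Set (E d)} (hU : IsOpen U) {ψ : E d → ℝ}
    {Ψ : E d → E d} {b : ℝ} (h : ∀ x ∈ U, HasFDerivAt ψ (innerSL ℝ (Ψ x)) x)
    (hb : ∀ x ∈ U, ‖Ψ x‖ ≤ b) : LocallyLipschitzOn U ψ := by
  intro x hx
  obtain ⟨r, hr, hrU⟩ := Metric.isOpen_iff.1 hU x hx
  refine ⟨b.toNNReal, Metric.ball x r, mem_nhdsWithin_of_mem_nhds (Metric.ball_mem_nhds x hr), ?_⟩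
  refine (convex_ball x r).lipschitzOnWith_of_nnnorm_hasFDerivWithin_le
    (fun y hy => (h y (hrU hy)).hasFDerivWithinAt) fun y hy => ?_
  refine NNReal.le_toNNReal_of_coe_le ?_
  rw [coe_nnnorm, innerSL_apply_norm]
  exact hb y (hrU hy)

/-- The flux as a smooth function of the point and of the values of `ψ` and `∇ψ`. -/
noncomputable def fluxOf (γ τ : ℝ) (u : E d → ℝ) (z : E d × ℝ × E d) : E d :=
  flux τ (2 * γ ^ 2 * (Real.exp (γ * z.2.1) * ‖z.2.2‖ ^ 2))
    (Real.exp (τ * Real.exp (γ * z.2.1)) * u z.1)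
    (Real.exp (τ * Real.exp (γ * z.2.1)) •
      (gradient u z.1 + (τ * u z.1) • (γ * Real.exp (γ * z.2.1)) • z.2.2))
    ((γ * Real.exp (γ * z.2.1)) • z.2.2)

theorem carlemanFlux_eq_fluxOf (γ τ : ℝ) (ψ u : E d → ℝ) (Ψ : E d → E d) (x : E d) :
    carlemanFlux γ τ ψ Ψ u x = fluxOf γ τ u (x, ψ x, Ψ x) := rfl

theorem _root_.ContDiff.flux {X : Type*} [NormedAddCommGroup X] [NormedSpace ℝ X] {h v : X → ℝ}
    {p Φ : X → E d} (τ : ℝ) (hh : ContDiff ℝ 1 h) (hv : ContDiff ℝ 1 v) (hp : ContDiff ℝ 1 p)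
    (hΦ : ContDiff ℝ 1 Φ) : ContDiff ℝ 1 fun x => flux τ (h x) (v x) (p x) (Φ x) :=
  (((contDiff_const.mul (hΦ.inner ℝ hp)).add (hh.mul hv)).smul hp).add
    ((((contDiff_const.mul (hΦ.norm_sq ℝ)).mul (hv.pow 2)).sub (hp.norm_sq ℝ)).smul hΦ)

theorem contDiff_fluxOf {γ τ : ℝ} {u : E d → ℝ} (hu : ContDiff ℝ ∞ u) :
    ContDiff ℝ 1 (fluxOf γ τ u) := by
  have hg : ContDiff ℝ 1 (gradient u) := (contDiff_gradient hu).of_le (by simp)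
  have hu1 : ContDiff ℝ 1 u := hu.of_le (by simp)
  have hs : ContDiff ℝ 1 fun z : E d × ℝ × E d => z.2.1 := contDiff_snd.fst
  have hw : ContDiff ℝ 1 fun z : E d × ℝ × E d => z.2.2 := contDiff_snd.snd
  have he : ContDiff ℝ 1 fun z : E d × ℝ × E d => Real.exp (γ * z.2.1) :=
    (contDiff_const.mul hs).exp
  have he' : ContDiff ℝ 1 fun z : E d × ℝ × E d => Real.exp (τ * Real.exp (γ * z.2.1)) :=
    (contDiff_const.mul he).exp
  have hu2 : ContDiff ℝ 1 fun z : E d × ℝ × E d => u z.1 := hu1.comp contDiff_fst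
  have hg2 : ContDiff ℝ 1 fun z : E d × ℝ × E d => gradient u z.1 := hg.comp contDiff_fst
  have hΦ : ContDiff ℝ 1 fun z : E d × ℝ × E d => (γ * Real.exp (γ * z.2.1)) • z.2.2 :=
    (contDiff_const.mul he).smul hw
  exact ContDiff.flux τ (contDiff_const.mul (he.mul (hw.norm_sq ℝ))) (he'.mul hu2)
    (he'.smul (hg2.add ((contDiff_const.mul hu2).smul hΦ))) hΦ

/-- The flux is a `C¹` function of the point and of the values of `ψ` and `∇ψ`, all locally
Lipschitz on `U`. -/
theorem locallyLipschitzOn_carlemanFlux {U : Set (E d)} {γ τ : ℝ} {ψ u : E d → ℝ}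
    {Ψ : E d → E d} (hψ : LocallyLipschitzOn U ψ) (hΨ : LocallyLipschitz Ψ)
    (hu : ContDiff ℝ ∞ u) (i : Fin d) (r : ℝ) :
    LocallyLipschitzOn U fun x => r * carlemanFlux γ τ ψ Ψ u x i := by
  have hcomp : ContDiff ℝ 1 fun z => r * fluxOf γ τ u z i :=
    contDiff_const.mul ((contDiff_euclidean.1 (contDiff_fluxOf hu)) i)
  have hid : LocallyLipschitzOn U (fun x : E d => x) :=
    LipschitzWith.id.locallyLipschitz.locallyLipschitzOn
  simp_rw [carlemanFlux_eq_fluxOf]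
  exact hcomp.comp_locallyLipschitzOn (hid.prodMk (hψ.prodMk hΨ.locallyLipschitzOn))

theorem sq_mul_sq_le {a₀ a₁ a lap I g : ℝ} (ha₀ : 0 < a₀) (ha : a₀ ≤ a) (hI : |I| ≤ a₁ * g) :
    lap ^ 2 * a₀ ^ 2 ≤ 2 * (a * lap + I) ^ 2 + 2 * a₁ ^ 2 * g ^ 2 := by
  have h1 : I ^ 2 ≤ a₁ ^ 2 * g ^ 2 := by
    rw [← sq_abs, ← mul_pow]
    gcongr
  have h2 : lap ^ 2 * a₀ ^ 2 ≤ lap ^ 2 * a ^ 2 := by gcongr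
  nlinarith [sq_nonneg (a * lap + 2 * I)]

theorem norm_carlemanFlux_le {γ τ b : ℝ} {ψ u : E d → ℝ} {Ψ : E d → E d} {x : E d} (hb : 0 ≤ b)
    (hφ : 1 ≤ weight γ ψ x) (hγ : 1 ≤ γ) (hτ : 1 ≤ τ) (hΨb : ‖Ψ x‖ ≤ b) :
    τ * ‖carlemanFlux γ τ ψ Ψ u x‖ ≤ (2 * (3 * b + b ^ 2) * (1 + b ^ 2) + b ^ 3 + b ^ 2) *
      (τ ^ 3 * γ ^ 3 * weight γ ψ x ^ 3 * Real.exp (τ * weight γ ψ x) ^ 2 * u x ^ 2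
        + τ * γ * weight γ ψ x * Real.exp (τ * weight γ ψ x) ^ 2 * ‖gradient u x‖ ^ 2) := by
  have hw0 : 0 < weight γ ψ x := by linarith
  have hγ0 : 0 < γ := by linarith
  refine boundary_bound hb hφ hγ hτ (norm_sq_conjGrad_sub rfl hΨb).2
    (norm_flux_le hφ hγ hτ ?_ ?_ ?_)
  · rw [weightGrad, norm_smul, Real.norm_of_nonneg (by positivity)]
    gcongr
  · unfold multiplier; positivity
  · calc multiplier γ ψ Ψ x ≤ 2 * γ ^ 2 * (weight γ ψ x * b ^ 2) := by
          unfold multiplier; gcongr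
      _ = _ := by ring

-- The pointwise inequality is fed to the one-sided divergence theorem. The data `ψ, Ψ, α, 𝒜` are
-- assumed continuous on the whole space so that flux and integrands are globally continuous; `Ψ`
-- has to be the gradient of `ψ` only inside `U`.
set_option maxHeartbeats 800000 in
theorem exists_real_carleman {U : Set (E d)} (hU : IsLipschitzDomain U)
    (hUb : Bornology.IsBounded U) (hUc : Uᶜ.Nonempty) {ψ α : E d → ℝ} {Ψ 𝒜 : E d → E d}
    {K : ℝ≥0} {a₀ a₁ b c : ℝ} (hψc : Continuous ψ) (hΨ : LipschitzWith K Ψ)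
    (hψ : ∀ x ∈ U, HasFDerivAt ψ (innerSL ℝ (Ψ x)) x) (hαc : Continuous α)
    (h𝒜c : Continuous 𝒜) (ha₀ : 0 < a₀) (hα : ∀ x ∈ U, a₀ ≤ α x) (h𝒜 : ∀ x ∈ U, ‖𝒜 x‖ ≤ a₁)
    (hc : 0 < c) (hΨc : ∀ x ∈ U, c ≤ ‖Ψ x‖) (hb : 0 ≤ b) (hΨb : ∀ x ∈ closure U, ‖Ψ x‖ ≤ b)
    (hψ0 : ∀ x ∈ closure U, 0 ≤ ψ x) :
    ∃ γs : ℝ, 1 ≤ γs ∧ ∃ τs : ℝ, 1 ≤ τs ∧ ∃ C : ℝ, 0 < C ∧ ∀ τ : ℝ, τs ≤ τ → ∀ γ : ℝ, γs ≤ γ →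
      ∀ u : E d → ℝ, ContDiff ℝ ∞ u →
        (∫⁻ x in U, ENNReal.ofReal
            (τ ^ 3 * γ ^ 4 * weight γ ψ x ^ 3 * Real.exp (2 * τ * weight γ ψ x) * u x ^ 2
              + τ * γ ^ 2 * Real.exp (2 * τ * weight γ ψ x) * ‖gradient u x‖ ^ 2))
          ≤ ENNReal.ofReal C *
            ((∫⁻ x in U, ENNReal.ofReal (Real.exp (2 * τ * weight γ ψ x) *
                (α x * tr (fderiv ℝ (gradient u) x) + inner ℝ (𝒜 x) (gradient u x)) ^ 2))
              + (∫⁻ x, ENNReal.ofReal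
                (τ ^ 3 * γ ^ 3 * weight γ ψ x ^ 3 * Real.exp (2 * τ * weight γ ψ x) * u x ^ 2
                  + τ * γ * weight γ ψ x * Real.exp (2 * τ * weight γ ψ x) * ‖gradient u x‖ ^ 2)
                ∂(surfaceMeasure U))) := by
  obtain ⟨CD, hCD, hdiv⟩ := exists_lintegral_le_of_le_div hU hUb hUc
  set k₀ : ℝ := 2 * b ^ 3 + 4 * K * b with hk₀
  set C₁ : ℝ := 2 * (1 + 2 * b ^ 2) / c ^ 4 + 2 / c ^ 2 with hC₁
  have hC₁0 : 0 < C₁ := by positivity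
  set C₂ : ℝ := 2 * (3 * b + b ^ 2) * (1 + b ^ 2) + b ^ 3 + b ^ 2 with hC₂
  have hC₂0 : 0 ≤ C₂ := by positivity
  -- The first entry bounds the operator term. The second collects the divergence constant, the `d`
  -- flux components and the pointwise flux bound.
  set C : ℝ := max (8 * C₁ / a₀ ^ 2) (CD.toReal * (d * (8 * C₁ * C₂))) with hC
  have hγs0 : 0 ≤ 2 * ((d + 2) * K) / c ^ 2 := by positivity
  have hγs1 : 0 ≤ 8 * C₁ * a₁ ^ 2 / a₀ ^ 2 := by positivity
  have hτs0 : 0 ≤ 4 * k₀ ^ 2 / c ^ 6 := by positivity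
  have hτs1 : 0 ≤ 4 * (b ^ 2 + d * K) ^ 2 / c ^ 4 := by positivity
  -- The summands of the thresholds serve, in order, `hγ`, `hγK`, `hγa` and `hτ`, `hτk`, `hτb`; none
  -- depends on `u`.
  refine ⟨1 + 2 * ((d + 2) * K) / c ^ 2 + 8 * C₁ * a₁ ^ 2 / a₀ ^ 2, by linarith,
    1 + 4 * k₀ ^ 2 / c ^ 6 + 4 * (b ^ 2 + d * K) ^ 2 / c ^ 4, by linarith,
    C, lt_of_lt_of_le (by positivity) (le_max_left _ _), fun τ hτs γ hγs u hu => ?_⟩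
  have hγ : 1 ≤ γ := by linarith
  have hτ : 1 ≤ τ := by linarith
  have hγK : 2 * ((d + 2) * K) ≤ γ * c ^ 2 := by
    rw [← div_le_iff₀ (by positivity)]; linarith
  have hγa : 8 * C₁ * a₁ ^ 2 ≤ γ * a₀ ^ 2 := by
    rw [← div_le_iff₀ (by positivity)]; linarith
  have hττ : τ ≤ τ ^ 2 := le_self_pow₀ hτ (by norm_num)
  have hτk : 4 * k₀ ^ 2 ≤ τ ^ 2 * c ^ 6 := by
    rw [← div_le_iff₀ (by positivity)]; linarith
  have hτb : 4 * (b ^ 2 + d * K) ^ 2 ≤ τ * c ^ 4 := by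
    rw [← div_le_iff₀ (by positivity)]; linarith
  have hφ1 : ∀ x ∈ closure U, 1 ≤ weight γ ψ x := fun x hx =>
    Real.one_le_exp (mul_nonneg (by linarith) (hψ0 x hx))
  have hexp : ∀ x, Real.exp (2 * τ * weight γ ψ x) = Real.exp (τ * weight γ ψ x) ^ 2 := fun x => by
    rw [← Real.exp_nat_mul]; ring_nf
  simp_rw [hexp]
  have hwc := continuous_weight (γ := γ) hψc
  have hgc := (contDiff_gradient hu).continuous
  have hgc' : Continuous fun x => tr (fderiv ℝ (gradient u) x) := by
    have h1 := (contDiff_gradient hu).continuous_fderiv (by simp)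
    unfold tr
    fun_prop
  have huc := hu.continuous
  have hΨcont := hΨ.continuous
  set L : E d → ℝ := fun x => α x * tr (fderiv ℝ (gradient u) x) + inner ℝ (𝒜 x) (gradient u x)
    with hL
  have hLc : Continuous L := by fun_prop
  set f : E d → ℝ := fun x => 8 * C₁ / a₀ ^ 2 * (Real.exp (τ * weight γ ψ x) ^ 2 * L x ^ 2) with hf
  set T : E d → ℝ := fun x =>
    τ ^ 3 * γ ^ 3 * weight γ ψ x ^ 3 * Real.exp (τ * weight γ ψ x) ^ 2 * u x ^ 2
      + τ * γ * weight γ ψ x * Real.exp (τ * weight γ ψ x) ^ 2 * ‖gradient u x‖ ^ 2 with hT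
  have hTc : Continuous T := by fun_prop
  have hψlip : LocallyLipschitzOn U ψ :=
    locallyLipschitzOn_of_hasFDerivAt hU.1 hψ fun x hx => hΨb x (subset_closure hx)
  have hmain := hdiv (fun i x => 8 * C₁ * τ * carlemanFlux γ τ ψ Ψ u x i)
    (fun x => τ ^ 3 * γ ^ 4 * weight γ ψ x ^ 3 * Real.exp (τ * weight γ ψ x) ^ 2 * u x ^ 2
              + τ * γ ^ 2 * Real.exp (τ * weight γ ψ x) ^ 2 * ‖gradient u x‖ ^ 2) f
    (fun i => by
      have := continuous_carlemanFlux (γ := γ) (τ := τ) hψc hΨcont hu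
      fun_prop)
    (fun i => locallyLipschitzOn_carlemanFlux hψlip hΨ.locallyLipschitz hu i _)
    (by fun_prop) (by fun_prop)
    (fun x hx => by have := hφ1 x (subset_closure hx); positivity)
    (fun x hx => by positivity)
    (by
      filter_upwards [ae_restrict_of_ae hΨ.ae_differentiableAt,
        ae_restrict_mem hU.1.measurableSet] with x hxd hxU
      have hxc := subset_closure hxU
      obtain ⟨F', hF', hle⟩ := carlemanFlux_coercive (γ := γ) (τ := τ)
        (by filter_upwards [hU.1.mem_nhds hxU] with y hy using hψ y hy) hxd.hasFDerivAt hu hc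
        (hΨc x hxU) (hΨb x hxc) (hxd.hasFDerivAt.le_of_lipschitz hΨ) (hφ1 x hxc) hγ hγK hτ hk₀
        hτk hτb
      refine ⟨fun i => 8 * C₁ * τ * F' (unitVec i) i, fun i => ?_, ?_⟩
      · have h1 : HasFDerivAt (fun y => carlemanFlux γ τ ψ Ψ u y i)
            ((EuclideanSpace.proj i : E d →L[ℝ] ℝ).comp F') x :=
          ((EuclideanSpace.proj i : E d →L[ℝ] ℝ).hasFDerivAt).comp x hF'
        exact (h1.const_mul (8 * C₁ * τ)).hasLineDerivAt (unitVec i)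
      · rw [← Finset.mul_sum]
        have hlap : tr (fderiv ℝ (gradient u) x) ^ 2 * a₀ ^ 2
            ≤ 2 * L x ^ 2 + 2 * a₁ ^ 2 * ‖gradient u x‖ ^ 2 :=
          sq_mul_sq_le ha₀ (hα x hxU) ((abs_real_inner_le_norm _ _).trans
            (mul_le_mul_of_nonneg_right (h𝒜 x hxU) (norm_nonneg _)))
        exact interior_bound hc hC₁ ha₀ (hφ1 x hxc) hγ hτ hγa hlap
          (norm_sq_conjGrad_sub rfl (hΨb x hxc)).1 (by positivity) hle)
  refine hmain.trans ?_
  have hfm : ∫⁻ x in U, ENNReal.ofReal (f x) = ENNReal.ofReal (8 * C₁ / a₀ ^ 2) *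
      ∫⁻ x in U, ENNReal.ofReal (Real.exp (τ * weight γ ψ x) ^ 2 * L x ^ 2) := by
    rw [← lintegral_const_mul]
    · refine lintegral_congr fun x => ?_
      rw [hf, ENNReal.ofReal_mul (by positivity)]
    · have : Continuous fun x => Real.exp (τ * weight γ ψ x) ^ 2 * L x ^ 2 := by fun_prop
      exact this.measurable.ennreal_ofReal
  have hbd : ∀ i, ∫⁻ x, ‖8 * C₁ * τ * carlemanFlux γ τ ψ Ψ u x i‖ₑ ∂surfaceMeasure U ≤
      ENNReal.ofReal (8 * C₁ * C₂) * ∫⁻ x, ENNReal.ofReal (T x) ∂surfaceMeasure U := by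
    intro i
    rw [← lintegral_const_mul _ hTc.measurable.ennreal_ofReal]
    refine lintegral_mono_ae ?_
    filter_upwards [ae_restrict_mem isClosed_frontier.measurableSet] with x hx
    have hxc : x ∈ closure U := frontier_subset_closure hx
    have hw1 := hφ1 x hxc
    have hw0 : 0 < weight γ ψ x := by linarith
    have hγ0 : 0 < γ := by linarith
    rw [← ENNReal.ofReal_mul (by positivity), ← ofReal_norm]
    refine ENNReal.ofReal_le_ofReal ?_
    have h1 : τ * ‖carlemanFlux γ τ ψ Ψ u x‖ ≤ C₂ * T x :=
      norm_carlemanFlux_le hb hw1 hγ hτ (hΨb x hxc)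
    have h2 := PiLp.norm_apply_le (carlemanFlux γ τ ψ Ψ u x) i
    rw [norm_mul, Real.norm_of_nonneg (by positivity)]
    calc 8 * C₁ * τ * ‖carlemanFlux γ τ ψ Ψ u x i‖
        ≤ 8 * C₁ * τ * ‖carlemanFlux γ τ ψ Ψ u x‖ := by gcongr
      _ = 8 * C₁ * (τ * ‖carlemanFlux γ τ ψ Ψ u x‖) := by ring
      _ ≤ 8 * C₁ * (C₂ * T x) := by gcongr
      _ = _ := by ring
  rw [hfm, mul_add (ENNReal.ofReal C)]
  refine add_le_add ?_ ?_
  · exact mul_le_mul_left (ENNReal.ofReal_le_ofReal (le_max_left _ _)) _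
  · calc CD * ∑ i, ∫⁻ x, ‖8 * C₁ * τ * carlemanFlux γ τ ψ Ψ u x i‖ₑ ∂surfaceMeasure U
        ≤ CD * ∑ _i : Fin d, ENNReal.ofReal (8 * C₁ * C₂) *
            ∫⁻ x, ENNReal.ofReal (T x) ∂surfaceMeasure U := by
          gcongr with i
          exact hbd i
      _ = ENNReal.ofReal (CD.toReal * (d * (8 * C₁ * C₂))) *
            ∫⁻ x, ENNReal.ofReal (T x) ∂surfaceMeasure U := by
          rw [ENNReal.ofReal_mul ENNReal.toReal_nonneg, ENNReal.ofReal_toReal hCD,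
            ENNReal.ofReal_mul (Nat.cast_nonneg d), ENNReal.ofReal_natCast, Finset.sum_const,
            Finset.card_univ, Fintype.card_fin, nsmul_eq_mul]
          ring
      _ ≤ _ := by
          gcongr
          exact le_max_right _ _

end RealCarleman

end Carleman

namespace Carleman

/-! ### Approximation in `H²` by Schwartz functions -/

section SobolevApproximation

open FourierTransform LineDeriv TemperedDistribution

variable {d : ℕ}

/-- Plancherel turns the multiplier into pointwise multiplication by a bounded function. -/
theorem norm_toLp_fourierMultiplierCLM_le {m : E d → ℂ} (hm : m.HasTemperateGrowth) {C : ℝ}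
    (hC : ∀ x, ‖m x‖ ≤ C) (f : 𝓢(E d, ℂ)) :
    ‖(SchwartzMap.fourierMultiplierCLM ℂ m f).toLp 2‖ ≤ C * ‖f.toLp 2‖ := by
  have h1 : 𝓕 (SchwartzMap.fourierMultiplierCLM ℂ m f) = SchwartzMap.smulLeftCLM ℂ m (𝓕 f) := by
    rw [SchwartzMap.fourierMultiplierCLM_apply, FourierTransform.fourier_fourierInv_eq]
  rw [← SchwartzMap.norm_fourier_toL2_eq, ← SchwartzMap.norm_fourier_toL2_eq f, h1]
  refine Lp.norm_le_mul_norm_of_ae_le_mul ?_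
  filter_upwards [SchwartzMap.coeFn_toLp (SchwartzMap.smulLeftCLM ℂ m (𝓕 f)) 2,
    SchwartzMap.coeFn_toLp (𝓕 f) 2] with x hx1 hx2
  rw [hx1, hx2, SchwartzMap.smulLeftCLM_apply_apply hm, norm_smul]
  gcongr
  exact hC x

theorem toLp_sub (a b : 𝓢(E d, ℂ)) : (a - b).toLp 2 (volume : Measure (E d)) =
    a.toLp 2 volume - b.toLp 2 volume :=
  map_sub (SchwartzMap.toLpCLM ℂ ℂ 2 (volume : Measure (E d))) a b

theorem toLp_smul (k : ℂ) (a : 𝓢(E d, ℂ)) : (k • a).toLp 2 (volume : Measure (E d)) =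
    k • a.toLp 2 volume :=
  map_smul (SchwartzMap.toLpCLM ℂ ℂ 2 (volume : Measure (E d))) k a

theorem cauchySeq_toLp_of_norm_le {T : 𝓢(E d, ℂ) →L[ℂ] 𝓢(E d, ℂ)} {C : ℝ}
    (hT : ∀ f, ‖(T f).toLp 2‖ ≤ C * ‖f.toLp 2‖) {h : ℕ → 𝓢(E d, ℂ)}
    (hh : CauchySeq fun n => (h n).toLp 2) : CauchySeq fun n => (T (h n)).toLp 2 := by
  have hdist : ∀ a b : 𝓢(E d, ℂ), dist ((T a).toLp 2 (volume : Measure (E d)))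
      ((T b).toLp 2 volume) ≤
        max C 1 * dist (a.toLp 2 (volume : Measure (E d))) (b.toLp 2 volume) := by
    intro a b
    rw [dist_eq_norm, dist_eq_norm, ← toLp_sub, ← toLp_sub, ← map_sub]
    refine (hT _).trans ?_
    gcongr
    exact le_max_left _ _
  have hM : 0 < max C 1 := by positivity
  rw [Metric.cauchySeq_iff'] at hh ⊢
  intro ε hε
  obtain ⟨N, hN⟩ := hh (ε / max C 1) (by positivity)
  exact ⟨N, fun n hn => (hdist _ _).trans_lt ((lt_div_iff₀' hM).1 (hN n hn))⟩

/-- The symbol of the Bessel potential of order `-2`. -/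
noncomputable def besselSymbol (x : E d) : ℂ := (((1 + ‖x‖ ^ 2) ^ (-2 / 2 : ℝ) : ℝ) : ℂ)

theorem besselSymbol_hasTemperateGrowth : (besselSymbol (d := d)).HasTemperateGrowth := by
  unfold besselSymbol
  fun_prop

theorem norm_besselSymbol (x : E d) : ‖besselSymbol x‖ = (1 + ‖x‖ ^ 2)⁻¹ := by
  rw [besselSymbol, Complex.norm_real, Real.norm_of_nonneg (by positivity)]
  norm_num [Real.rpow_neg_one]

theorem innerSymbol_hasTemperateGrowth (m : E d) :
    (fun x : E d => ((inner ℝ x m : ℝ) : ℂ)).HasTemperateGrowth := by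
  fun_prop

theorem lineDeriv_eq_complex_multiplier (m : E d) (f : 𝓢(E d, ℂ)) :
    ∂_{m} f = (2 * Real.pi * Complex.I) • SchwartzMap.fourierMultiplierCLM ℂ
      (fun x : E d => ((inner ℝ x m : ℝ) : ℂ)) f := by
  rw [SchwartzMap.lineDeriv_eq_fourierMultiplierCLM]
  congr 1
  exact (SchwartzMap.fourierMultiplierCLM_ofReal ℂ (by fun_prop) f).symm

theorem norm_inner_mul_besselSymbol_le {m : E d} (hm : ‖m‖ = 1) (x : E d) :
    ‖((inner ℝ x m : ℝ) : ℂ) * besselSymbol x‖ ≤ 1 := by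
  rw [norm_mul, norm_besselSymbol, Complex.norm_real, ← div_eq_mul_inv, div_le_one (by positivity)]
  have := norm_inner_le_norm (𝕜 := ℝ) x m
  rw [hm, mul_one] at this
  nlinarith [sq_nonneg (‖x‖ - 1)]

theorem norm_inner_mul_inner_mul_besselSymbol_le {m l : E d} (hm : ‖m‖ = 1) (hl : ‖l‖ = 1)
    (x : E d) :
    ‖((inner ℝ x l : ℝ) : ℂ) * (((inner ℝ x m : ℝ) : ℂ) * besselSymbol x)‖ ≤ 1 := by
  rw [norm_mul, norm_mul, norm_besselSymbol, Complex.norm_real, Complex.norm_real, ← mul_assoc,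
    ← div_eq_mul_inv, div_le_one (by positivity)]
  have h1 := norm_inner_le_norm (𝕜 := ℝ) x m
  have h2 := norm_inner_le_norm (𝕜 := ℝ) x l
  rw [hm, mul_one] at h1
  rw [hl, mul_one] at h2
  calc ‖inner ℝ x l‖ * ‖inner ℝ x m‖ ≤ ‖x‖ * ‖x‖ := by gcongr
    _ ≤ 1 + ‖x‖ ^ 2 := by nlinarith

/-- An `L²` limit exists by completeness. It equals `V` as a tempered distribution, because Bessel
potentials are continuous there, and therefore in `L²`, which embeds injectively. -/
theorem tendsto_toLp_besselSymbol {V g : Lp ℂ 2 (volume : Measure (E d))} {h : ℕ → 𝓢(E d, ℂ)}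
    (hh : Tendsto (fun n => (h n).toLp 2) atTop (𝓝 g))
    (hc : CauchySeq fun n => (SchwartzMap.fourierMultiplierCLM ℂ besselSymbol (h n)).toLp 2)
    (hg : besselPotential (E d) ℂ 2 (V : 𝓢'(E d, ℂ)) = g) :
    Tendsto (fun n => (SchwartzMap.fourierMultiplierCLM ℂ besselSymbol (h n)).toLp 2) atTop
      (𝓝 V) := by
  obtain ⟨W, hW⟩ := cauchySeq_tendsto_of_complete hc
  have hcont := (Lp.toTemperedDistributionCLM ℂ (volume : Measure (E d)) 2).continuous
  have h1 := (hcont.tendsto W).comp hW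
  have h2 := (((besselPotential (E d) ℂ (-2)).continuous.comp hcont).tendsto g).comp hh
  have h3 : ∀ n, Lp.toTemperedDistributionCLM ℂ (volume : Measure (E d)) 2
      ((SchwartzMap.fourierMultiplierCLM ℂ besselSymbol (h n)).toLp 2) =
      besselPotential (E d) ℂ (-2)
        (Lp.toTemperedDistributionCLM ℂ (volume : Measure (E d)) 2 ((h n).toLp 2)) := by
    intro n
    rw [Lp.toTemperedDistributionCLM_apply, Lp.toTemperedDistributionCLM_apply,
      Lp.toTemperedDistribution_toLp_eq, Lp.toTemperedDistribution_toLp_eq]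
    exact (fourierMultiplierCLM_toTemperedDistributionCLM_eq besselSymbol_hasTemperateGrowth
      (h n)).symm
  have h4 := tendsto_nhds_unique (h1.congr h3) h2
  rw [Function.comp_apply, Lp.toTemperedDistributionCLM_apply g, ← hg,
    (besselPotential_neg_apply_eq_iff 2 _ _).2 rfl,
    ← Lp.toTemperedDistributionCLM_apply V] at h4
  have h5 : W = V := (LinearMap.ker_eq_bot.1
    (Lp.ker_toTemperedDistributionCLM_eq_bot (E := E d) (F := ℂ) (μ := volume) (p := 2))) h4
  rwa [h5] at hW

/-- Functions in `H²(ℝ^d)` are limits of Schwartz functions in the `H²` norm. -/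
theorem exists_schwartz_approx {V : Lp ℂ 2 (volume : Measure (E d))}
    (hV : MemSobolev 2 2 (V : 𝓢'(E d, ℂ))) :
    ∃ f : ℕ → 𝓢(E d, ℂ), Tendsto (fun n => (f n).toLp 2) atTop (𝓝 V) ∧
      (∀ i : Fin d, CauchySeq fun n => (∂_{unitVec i} (f n)).toLp 2) ∧
      ∀ i j : Fin d, CauchySeq fun n => (∂_{unitVec j} (∂_{unitVec i} (f n))).toLp 2 := by
  obtain ⟨g, hg⟩ := hV
  obtain ⟨s, hs, hlim⟩ := mem_closure_iff_seq_limit.1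
    (SchwartzMap.denseRange_toLpCLM (E := E d) (F := ℂ) (μ := volume) (p := 2) (by simp) g)
  choose h hh using hs
  have hh' : Tendsto (fun n => (h n).toLp 2) atTop (𝓝 g) := by
    refine hlim.congr fun n => ?_
    rw [← hh n, SchwartzMap.toLpCLM_apply]
  have hcau := hh'.cauchySeq
  have hσ := besselSymbol_hasTemperateGrowth (d := d)
  have hS1 : ∀ i : Fin d, ∀ f, ∂_{unitVec i} (SchwartzMap.fourierMultiplierCLM ℂ besselSymbol f) = (2 * Real.pi * Complex.I) •
      SchwartzMap.fourierMultiplierCLM ℂ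
        (fun x : E d => ((inner ℝ x (unitVec i) : ℝ) : ℂ) * besselSymbol x) f := by
    intro i f
    rw [lineDeriv_eq_complex_multiplier, SchwartzMap.fourierMultiplierCLM_fourierMultiplierCLM_apply
      (innerSymbol_hasTemperateGrowth _) hσ]
    rfl
  have hmul : ∀ (k : ℂ) (m : E d → ℂ), m.HasTemperateGrowth → (∀ x, ‖m x‖ ≤ 1) →
      CauchySeq fun n => (k • SchwartzMap.fourierMultiplierCLM ℂ m (h n)).toLp 2 := by
    intro k m hm hm1
    refine cauchySeq_toLp_of_norm_le (T := k • SchwartzMap.fourierMultiplierCLM ℂ m) (C := ‖k‖)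
      (fun f => ?_) hcau
    rw [_root_.smul_apply, toLp_smul, norm_smul]
    gcongr
    simpa using norm_toLp_fourierMultiplierCLM_le hm hm1 f
  -- `h n` approximates the Bessel potential of order `2` of `V` in `L²`, and the potential of order
  -- `-2` undoes it. The symbols `σ`, `ξᵢσ`, `ξᵢξⱼσ` with `σ = (1 + |ξ|²)⁻¹` are bounded by `1`, so
  -- derivatives up to order two are Cauchy.
  refine ⟨fun n => SchwartzMap.fourierMultiplierCLM ℂ besselSymbol (h n), ?_, fun i => ?_, fun i j => ?_⟩
  · refine tendsto_toLp_besselSymbol hh' ?_ hg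
    simpa using hmul 1 besselSymbol hσ fun x => by
      rw [norm_besselSymbol]
      exact inv_le_one_of_one_le₀ (by nlinarith [norm_nonneg x])
  · simp only [hS1]
    exact hmul _ _ ((innerSymbol_hasTemperateGrowth _).mul hσ)
      (norm_inner_mul_besselSymbol_le (norm_unitVec i))
  · have : ∀ n, ∂_{unitVec j} (∂_{unitVec i} (SchwartzMap.fourierMultiplierCLM ℂ besselSymbol (h n))) =
        ((2 * Real.pi * Complex.I) * (2 * Real.pi * Complex.I)) •
        SchwartzMap.fourierMultiplierCLM ℂ (fun x : E d => ((inner ℝ x (unitVec j) : ℝ) : ℂ) *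
          (((inner ℝ x (unitVec i) : ℝ) : ℂ) * besselSymbol x)) (h n) := by
      intro n
      have hi : (fun x : E d => ((inner ℝ x (unitVec i) : ℝ) : ℂ) *
          besselSymbol x).HasTemperateGrowth := (innerSymbol_hasTemperateGrowth _).mul hσ
      rw [hS1, lineDeriv_eq_complex_multiplier, map_smul,
        SchwartzMap.fourierMultiplierCLM_fourierMultiplierCLM_apply
        (innerSymbol_hasTemperateGrowth _) hi, smul_smul]
      rfl
    simp only [this]
    exact hmul _ _ ((innerSymbol_hasTemperateGrowth _).mul
      ((innerSymbol_hasTemperateGrowth _).mul hσ))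
      (norm_inner_mul_inner_mul_besselSymbol_le (norm_unitVec i) (norm_unitVec j))

theorem tendsto_eLpNorm_sub_of_tendsto_toLp {f : ℕ → 𝓢(E d, ℂ)}
    {V : Lp ℂ 2 (volume : Measure (E d))} (hf : Tendsto (fun n => (f n).toLp 2) atTop (𝓝 V))
    (U : Set (E d)) :
    Tendsto (fun n => eLpNorm (fun x => f n x - V x) 2 (volume.restrict U)) atTop (𝓝 0) := by
  refine tendsto_of_tendsto_of_tendsto_of_le_of_le tendsto_const_nhds
    ((Lp.tendsto_Lp_iff_tendsto_eLpNorm' _ _).1 hf) (fun _ => zero_le) fun n => ?_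
  refine (eLpNorm_mono_measure _ Measure.restrict_le_self).trans_eq (eLpNorm_congr_ae ?_)
  filter_upwards [(f n).coeFn_toLp 2] with x hx
  simp [hx]

/-- `G` and `H` are just `L²` limits at this stage; their identification with weak derivatives of
`u` comes in `MemH2.exists_approx`. -/
theorem MemH2.exists_smooth_approx {U : Set (E d)} {u : E d → ℂ} (hu : MemH2 U u) :
    ∃ (f : ℕ → E d → ℂ) (G : Fin d → E d → ℂ) (H : Fin d → Fin d → E d → ℂ),
      (∀ n, ContDiff ℝ ∞ (f n)) ∧
      MemLp u 2 (volume.restrict U) ∧ (∀ i, MemLp (G i) 2 (volume.restrict U)) ∧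
      (∀ i j, MemLp (H i j) 2 (volume.restrict U)) ∧
      Tendsto (fun n => eLpNorm (fun x => f n x - u x) 2 (volume.restrict U)) atTop (𝓝 0) ∧
      (∀ i, Tendsto (fun n => eLpNorm (fun x => fderiv ℝ (f n) x (unitVec i) - G i x) 2
        (volume.restrict U)) atTop (𝓝 0)) ∧
      ∀ i j, Tendsto (fun n => eLpNorm (fun x =>
        fderiv ℝ (fun y => fderiv ℝ (f n) y (unitVec i)) x (unitVec j) - H i j x) 2
        (volume.restrict U)) atTop (𝓝 0) := by
  obtain ⟨V, hV, hVu⟩ := hu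
  obtain ⟨f, hf, hf1, hf2⟩ := exists_schwartz_approx hV
  choose G hG using fun i => cauchySeq_tendsto_of_complete (hf1 i)
  choose H hH using fun i j => cauchySeq_tendsto_of_complete (hf2 i j)
  refine ⟨fun n => f n, fun i => G i, fun i j => H i j, fun n => (f n).smooth _,
    ((Lp.memLp V).restrict U).ae_eq hVu, fun i => (Lp.memLp _).restrict U,
    fun i j => (Lp.memLp _).restrict U, ?_, fun i => ?_, fun i j => ?_⟩
  · refine (tendsto_eLpNorm_sub_of_tendsto_toLp hf U).congr fun n => eLpNorm_congr_ae ?_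
    filter_upwards [hVu] with x hx
    rw [hx]
  · refine (tendsto_eLpNorm_sub_of_tendsto_toLp (hG i) U).congr fun n => ?_
    simp only [SchwartzMap.lineDerivOp_apply_eq_fderiv]
  · refine (tendsto_eLpNorm_sub_of_tendsto_toLp (hH i j) U).congr fun n => ?_
    have : (fun y => fderiv ℝ (f n) y (unitVec i)) = (∂_{unitVec i} (f n) : 𝓢(E d, ℂ)) := by
      funext y
      rw [SchwartzMap.lineDerivOp_apply_eq_fderiv]
    simp only [SchwartzMap.lineDerivOp_apply_eq_fderiv _ (∂_{unitVec i} (f n)), this]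

end SobolevApproximation

end Carleman

namespace Carleman

/-! ### Weak derivatives: closedness and uniqueness -/

section WeakDerivatives

variable {d : ℕ} {U : Set (E d)}

theorem integrable_smul_of_tsupport_subset {φ : E d → ℝ} {h : E d → ℂ}
    (hφ : Continuous φ) (hφc : HasCompactSupport φ) (hφU : tsupport φ ⊆ U)
    (hh : LocallyIntegrableOn h U) : Integrable fun x => φ x • h x := by
  have h1 : IntegrableOn (fun x => φ x • h x) (tsupport φ) :=
    (hh.integrableOn_compact_subset hφU hφc.isCompact).continuousOn_smul hφ.continuousOn
      hφc.isCompact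
  refine (integrableOn_iff_integrable_of_support_subset ?_).1 h1
  exact (Function.support_smul_subset_left φ h).trans (subset_tsupport φ)

theorem setIntegral_smul_eq_integral {φ : E d → ℝ} (hφU : tsupport φ ⊆ U) (h : E d → ℂ) :
    ∫ x in U, φ x • h x = ∫ x, φ x • h x := by
  refine setIntegral_eq_integral_of_forall_compl_eq_zero fun x hx => ?_
  rw [image_eq_zero_of_notMem_tsupport fun hx' => hx (hφU hx'), zero_smul]

theorem locallyIntegrableOn_of_memLp_two {v : E d → ℂ} (hv : MemLp v 2 (volume.restrict U)) :
    LocallyIntegrableOn v U :=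
  locallyIntegrableOn_of_locallyIntegrable_restrict (hv.locallyIntegrable (by norm_num))

theorem tsupport_fderiv_apply_subset_tsupport (η : E d → ℝ) (e : E d) :
    tsupport (fun x => fderiv ℝ η x e) ⊆ tsupport η := by
  refine closure_minimal (fun x hx => ?_) (isClosed_tsupport η)
  by_contra h
  refine hx ?_
  have : fderiv ℝ η x = 0 := by
    by_contra h'
    exact h (support_fderiv_subset ℝ h')
  simp [this]

/-- Classical derivatives are weak derivatives. -/
theorem setIntegral_fderiv_smul_eq {f : E d → ℂ} (hUo : IsOpen U) (hf : ContDiffOn ℝ 1 f U)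
    (e : E d) {η : E d → ℝ} (hη : ContDiff ℝ ∞ η) (hηc : HasCompactSupport η)
    (hηU : tsupport η ⊆ U) :
    ∫ x in U, (fderiv ℝ η x e) • f x = - ∫ x in U, η x • fderiv ℝ f x e := by
  have hs := tsupport_fderiv_apply_subset_tsupport η e
  have hη1 : Continuous fun x => fderiv ℝ η x e :=
    (hη.continuous_fderiv (by simp)).clm_apply continuous_const
  have hf0 := hf.continuousOn.locallyIntegrableOn hUo.measurableSet (μ := volume)
  have hf1 : LocallyIntegrableOn (fun x => fderiv ℝ f x e) U :=
    ((hf.continuousOn_fderiv_of_isOpen hUo le_rfl).clm_apply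
      continuousOn_const).locallyIntegrableOn hUo.measurableSet
  rw [setIntegral_smul_eq_integral hηU, setIntegral_smul_eq_integral (hs.trans hηU)]
  have := integral_bilinear_hasLineDerivAt_right_eq_neg_left_of_integrable
    (μ := (volume : Measure (E d))) (f := f) (f' := fun x => fderiv ℝ f x e) (g := η)
    (g' := fun x => fderiv ℝ η x e) (v := e) (B := (ContinuousLinearMap.lsmul ℝ ℝ (E := ℂ)).flip)
    ?_ ?_ ?_ ?_ ?_
  · simpa using this
  · simpa using integrable_smul_of_tsupport_subset hη.continuous hηc hηU hf1
  · simpa using integrable_smul_of_tsupport_subset hη1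
      (hηc.of_isClosed_subset (isClosed_tsupport _) hs) (hs.trans hηU) hf0
  · simpa using integrable_smul_of_tsupport_subset hη.continuous hηc hηU hf0
  · intro x hx
    exact ((hf.differentiableOn one_ne_zero).differentiableAt
      (hUo.mem_nhds (hηU hx))).hasFDerivAt.hasLineDerivAt e
  · intro x _
    exact (hη.differentiable (by simp) x).hasFDerivAt.hasLineDerivAt e

theorem tendsto_setIntegral_smul {φ : E d → ℝ} (hφ : Continuous φ) (hφc : HasCompactSupport φ)
    {f : ℕ → E d → ℂ} {v : E d → ℂ} {μ : Measure (E d)} [IsFiniteMeasureOnCompacts μ]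
    (hfm : ∀ n, AEStronglyMeasurable (f n) μ) (hv : MemLp v 2 μ)
    (h : Tendsto (fun n => eLpNorm (fun x => f n x - v x) 2 μ) atTop (𝓝 0)) :
    Tendsto (fun n => ∫ x, φ x • f n x ∂μ) atTop (𝓝 (∫ x, φ x • v x ∂μ)) := by
  have hφL : MemLp φ 2 μ := hφ.memLp_of_hasCompactSupport hφc
  have hsub : ∀ n, eLpNorm (fun x => φ x • (f n x - v x)) 1 μ ≤
      eLpNorm φ 2 μ * eLpNorm (fun x => f n x - v x) 2 μ := fun n =>
    eLpNorm_smul_le_mul_eLpNorm (p := 2) (q := 2) (r := 1) (𝕜 := ℝ) (φ := φ)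
      (f := fun x => f n x - v x) ((hfm n).sub hv.1) hφL.1
  have hvφ : Integrable (fun x => φ x • v x) μ :=
    memLp_one_iff_integrable.1 (MemLp.smul (p := 2) (q := 2) (r := 1) (𝕜 := ℝ) (φ := φ) hv hφL)
  have hlim : Tendsto (fun n => eLpNorm (fun x => φ x • (f n x - v x)) 1 μ) atTop (𝓝 0) := by
    refine tendsto_of_tendsto_of_tendsto_of_le_of_le tendsto_const_nhds ?_ (fun _ => zero_le) hsub
    simpa using ENNReal.Tendsto.const_mul h (Or.inr hφL.2.ne)
  refine tendsto_integral_of_L1' _ hvφ.1 ?_ ?_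
  · filter_upwards [hlim.eventually_lt_const zero_lt_one] with n hn
    have : Integrable (fun x => φ x • (f n x - v x)) μ :=
      memLp_one_iff_integrable.1 ⟨hφ.aestronglyMeasurable.smul ((hfm n).sub hv.1),
        hn.trans ENNReal.one_lt_top⟩
    refine (this.add hvφ).congr (ae_of_all _ fun x => ?_)
    simp [smul_sub]
  · refine hlim.congr fun n => eLpNorm_congr_ae (ae_of_all _ fun x => ?_)
    simp [smul_sub]

/-- Both sides of the integration by parts formula pass to the `L²` limit against a fixed test
function. Regularity of `f n` is asked only on `U`, so that products with the coefficient `α` are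
admissible. -/
theorem hasWeakPartial_of_tendsto (hUo : IsOpen U) {i : Fin d} {f : ℕ → E d → ℂ} {v g : E d → ℂ}
    (hf : ∀ n, ContDiffOn ℝ 1 (f n) U) (hv : MemLp v 2 (volume.restrict U))
    (hg : MemLp g 2 (volume.restrict U))
    (hfv : Tendsto (fun n => eLpNorm (fun x => f n x - v x) 2 (volume.restrict U)) atTop (𝓝 0))
    (hfg : Tendsto (fun n => eLpNorm (fun x => fderiv ℝ (f n) x (unitVec i) - g x) 2
      (volume.restrict U)) atTop (𝓝 0)) : HasWeakPartial U i v g := by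
  refine ⟨locallyIntegrableOn_of_memLp_two hv, locallyIntegrableOn_of_memLp_two hg,
    fun η hη hηc hηU => ?_⟩
  have hη1 : Continuous fun x => fderiv ℝ η x (unitVec i) :=
    (hη.continuous_fderiv (by simp)).clm_apply continuous_const
  have hη1c : HasCompactSupport fun x => fderiv ℝ η x (unitVec i) :=
    hηc.of_isClosed_subset (isClosed_tsupport _) (tsupport_fderiv_apply_subset_tsupport η _)
  have h1 := tendsto_setIntegral_smul hη1 hη1c
    (fun n => (hf n).continuousOn.aestronglyMeasurable hUo.measurableSet) hv hfv
  have h2 := tendsto_setIntegral_smul hη.continuous hηc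
    (fun n => (((hf n).continuousOn_fderiv_of_isOpen hUo le_rfl).clm_apply
      continuousOn_const).aestronglyMeasurable hUo.measurableSet) hg hfg
  refine tendsto_nhds_unique h1 (h2.neg.congr fun n => ?_)
  rw [setIntegral_fderiv_smul_eq hUo (hf n) _ hη hηc hηU]

/-- The fundamental lemma of the calculus of variations. It makes the arbitrary choice in
`weakPartial` harmless. -/
theorem HasWeakPartial.ae_eq (hUo : IsOpen U) {i : Fin d} {v g g' : E d → ℂ}
    (hg : HasWeakPartial U i v g) (hg' : HasWeakPartial U i v g') :
    g =ᵐ[volume.restrict U] g' := by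
  have h := hUo.ae_eq_zero_of_integral_contDiff_smul_eq_zero (μ := (volume : Measure (E d)))
    (f := g - g') (hg.2.1.sub hg'.2.1) fun η hη hηc hηU => ?_
  · filter_upwards [(ae_restrict_iff' hUo.measurableSet).2 h] with x hx
    exact sub_eq_zero.1 hx
  · have h1 := hg.2.2 η hη hηc hηU
    rw [hg'.2.2 η hη hηc hηU, neg_inj, setIntegral_smul_eq_integral hηU,
      setIntegral_smul_eq_integral hηU] at h1
    simp only [Pi.sub_apply, smul_sub]
    rw [integral_sub (integrable_smul_of_tsupport_subset hη.continuous hηc hηU hg.2.1)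
      (integrable_smul_of_tsupport_subset hη.continuous hηc hηU hg'.2.1), h1, sub_self]

theorem hasWeakPartial_weakPartial {i : Fin d} {v g : E d → ℂ} (hg : HasWeakPartial U i v g) :
    HasWeakPartial U i v (weakPartial U i v) := by
  have h : ∃ w, HasWeakPartial U i v w := ⟨g, hg⟩
  rw [weakPartial, dif_pos h]
  exact h.choose_spec

theorem HasWeakPartial.weakPartial_ae_eq (hUo : IsOpen U) {i : Fin d} {v g : E d → ℂ}
    (hg : HasWeakPartial U i v g) : weakPartial U i v =ᵐ[volume.restrict U] g :=
  (hasWeakPartial_weakPartial hg).ae_eq hUo hg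

end WeakDerivatives

/-! ### Boundary traces -/

section Traces

variable {d : ℕ} {U : Set (E d)}

theorem norm_le_sum_norm_unitVec (A : E d →L[ℝ] ℂ) : ‖A‖ ≤ ∑ i, ‖A (unitVec i)‖ := by
  refine A.opNorm_le_bound (Finset.sum_nonneg fun i _ => norm_nonneg _) fun x => ?_
  conv_lhs => rw [← (EuclideanSpace.basisFun (Fin d) ℝ).sum_repr x]
  rw [map_sum, Finset.sum_mul]
  refine (norm_sum_le _ _).trans (Finset.sum_le_sum fun i _ => ?_)
  rw [map_smul, norm_smul, mul_comm]
  simp only [EuclideanSpace.basisFun_apply]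
  exact mul_le_mul_of_nonneg_left (PiLp.norm_apply_le x i) (norm_nonneg _)

/-- The distance from `f` to `(v, G)` in `H¹(U)`. -/
noncomputable def sobolevDist (U : Set (E d)) (f v : E d → ℂ) (G : Fin d → E d → ℂ) : ℝ≥0∞ :=
  eLpNorm (fun x => f x - v x) 2 (volume.restrict U) +
    ∑ i, eLpNorm (fun x => fderiv ℝ f x (unitVec i) - G i x) 2 (volume.restrict U)

theorem eLpNorm_two_sq {α F : Type*} [MeasurableSpace α] [NormedAddCommGroup F] (f : α → F)
    (μ : Measure α) : eLpNorm f 2 μ ^ 2 = ∫⁻ x, ‖f x‖ₑ ^ 2 ∂μ := by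
  have := eLpNorm_nnreal_pow_eq_lintegral (f := f) (μ := μ) (p := 2) (by norm_num)
  simpa using this

theorem exists_eLpNorm_trace_le (hU : IsLipschitzDomain U) (hUb : Bornology.IsBounded U) :
    ∃ C : ℝ≥0∞, C ≠ ⊤ ∧ ∀ f : E d → ℂ, ContDiff ℝ 1 f →
      eLpNorm f 2 (surfaceMeasure U) ≤ C * (eLpNorm f 2 (volume.restrict U) +
        ∑ i, eLpNorm (fun x => fderiv ℝ f x (unitVec i)) 2 (volume.restrict U)) := by
  obtain ⟨C, hC, h⟩ := exists_trace_le (F := ℂ) hU hUb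
  -- `C ≤ (C + 1) ^ 2` lets the squared inequality be unsquared without taking a root of `C`.
  refine ⟨C + 1, by simp [hC], fun f hf => ?_⟩
  have hfd : Continuous (fderiv ℝ f) := hf.continuous_fderiv one_ne_zero
  have h1 : eLpNorm (fderiv ℝ f) 2 (volume.restrict U) ≤
      ∑ i, eLpNorm (fun x => fderiv ℝ f x (unitVec i)) 2 (volume.restrict U) := by
    calc eLpNorm (fderiv ℝ f) 2 (volume.restrict U)
        ≤ eLpNorm (∑ i, fun x => ‖fderiv ℝ f x (unitVec i)‖) 2 (volume.restrict U) := by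
          refine eLpNorm_mono_real fun x => ?_
          rw [Finset.sum_apply]
          exact norm_le_sum_norm_unitVec _
      _ ≤ ∑ i, eLpNorm (fun x => ‖fderiv ℝ f x (unitVec i)‖) 2 (volume.restrict U) :=
          eLpNorm_sum_le (fun i _ => ((hfd.clm_apply
            continuous_const).norm).aestronglyMeasurable) (by norm_num)
      _ = _ := by simp only [eLpNorm_norm]
  have h2 := h f hf
  rw [lintegral_add_left (by have := hf.continuous; fun_prop), ← eLpNorm_two_sq, ← eLpNorm_two_sq,
    ← eLpNorm_two_sq] at h2
  refine le_trans ?_ (mul_le_mul_right (add_le_add le_rfl h1) _)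
  refine (ENNReal.pow_le_pow_left_iff two_ne_zero).1 (h2.trans ?_)
  rw [mul_pow]
  refine mul_le_mul' ?_ ?_
  · calc C ≤ (C + 1) * 1 := by rw [mul_one]; exact le_self_add
      _ ≤ (C + 1) ^ 2 := by rw [sq]; gcongr; exact le_add_self
  · rw [add_sq]
    exact add_le_add le_self_add le_rfl

/-- The trace inequality for `f - g`, with the triangle inequality through the common target `(v,
G)`. It gives both existence of the trace and its independence of the approximating sequence. -/
theorem exists_eLpNorm_trace_sub_le (hU : IsLipschitzDomain U) (hUb : Bornology.IsBounded U) :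
    ∃ C : ℝ≥0∞, C ≠ ⊤ ∧ ∀ (f g v : E d → ℂ) (G : Fin d → E d → ℂ), ContDiff ℝ 1 f →
      ContDiff ℝ 1 g → AEStronglyMeasurable v (volume.restrict U) →
      (∀ i, AEStronglyMeasurable (G i) (volume.restrict U)) →
      eLpNorm (fun x => f x - g x) 2 (surfaceMeasure U) ≤
        C * (sobolevDist U f v G + sobolevDist U g v G) := by
  obtain ⟨C, hC, h⟩ := exists_eLpNorm_trace_le hU hUb
  refine ⟨C, hC, fun f g v G hf hg hv hG => (h _ (hf.sub hg)).trans ?_⟩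
  refine mul_le_mul_right ?_ _
  have key : ∀ a b w : E d → ℂ, AEStronglyMeasurable a (volume.restrict U) →
      AEStronglyMeasurable b (volume.restrict U) → AEStronglyMeasurable w (volume.restrict U) →
      eLpNorm (fun x => a x - b x) 2 (volume.restrict U) ≤
        eLpNorm (fun x => a x - w x) 2 (volume.restrict U) +
        eLpNorm (fun x => b x - w x) 2 (volume.restrict U) := by
    intro a b w ha hb hw
    refine le_of_eq_of_le ?_ (eLpNorm_sub_le (p := 2) (ha.sub hw) (hb.sub hw) (by norm_num))
    congr 1
    funext x
    simp
  have hd : ∀ {f : E d → ℂ}, ContDiff ℝ 1 f → ∀ i : Fin d,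
      AEStronglyMeasurable (fun x => fderiv ℝ f x (unitVec i)) (volume.restrict U) := fun hf i =>
    ((hf.continuous_fderiv one_ne_zero).clm_apply continuous_const).aestronglyMeasurable
  unfold sobolevDist
  rw [add_add_add_comm, ← Finset.sum_add_distrib]
  refine add_le_add (key _ _ _ hf.continuous.aestronglyMeasurable
    hg.continuous.aestronglyMeasurable hv) (Finset.sum_le_sum fun i _ => ?_)
  refine le_of_eq_of_le ?_ (key _ _ _ (hd hf i) (hd hg i) (hG i))
  congr 1
  funext x
  rw [fderiv_fun_sub (hf.differentiable one_ne_zero x) (hg.differentiable one_ne_zero x)]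
  rfl

theorem memLp_surfaceMeasure (hU : IsLipschitzDomain U) (hUb : Bornology.IsBounded U)
    {f : E d → ℂ} (hf : Continuous f) : MemLp f 2 (surfaceMeasure U) := by
  have := isFiniteMeasure_surfaceMeasure hU hUb
  have hK : IsCompact (frontier U) := hUb.isCompact_closure.of_isClosed_subset isClosed_frontier
    frontier_subset_closure
  obtain ⟨C, hC⟩ := hK.exists_bound_of_continuousOn hf.continuousOn
  refine MemLp.of_bound hf.aestronglyMeasurable C ?_
  filter_upwards [ae_restrict_mem isClosed_frontier.measurableSet] with x hx using hC x hx

/-- Any `H¹(U)`-approximating sequence of smooth functions converges to the trace on `∂U`. -/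
theorem trace_spec (hU : IsLipschitzDomain U) (hUb : Bornology.IsBounded U) {v : E d → ℂ}
    {f : ℕ → E d → ℂ} (hf : ∀ n, ContDiff ℝ ∞ (f n)) (hv : MemLp v 2 (volume.restrict U))
    (hG : ∀ i, ∃ g, HasWeakPartial U i v g ∧ MemLp g 2 (volume.restrict U))
    (hfv : Tendsto (fun n => sobolevDist U (f n) v fun i => weakPartial U i v) atTop (𝓝 0)) :
    MemLp (trace U v) 2 (surfaceMeasure U) ∧
    Tendsto (fun n => eLpNorm (fun x => f n x - trace U v x) 2 (surfaceMeasure U)) atTop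
      (𝓝 0) := by
  obtain ⟨C, hC, hle⟩ := exists_eLpNorm_trace_sub_le hU hUb
  have hGm : ∀ i, AEStronglyMeasurable (weakPartial U i v) (volume.restrict U) := by
    intro i
    obtain ⟨g, hg, hg2⟩ := hG i
    exact hg2.1.congr (hg.weakPartial_ae_eq hU.1).symm
  have hf1 : ∀ n, ContDiff ℝ 1 (f n) := fun n => (hf n).of_le (by simp)
  have hmem : ∀ n, MemLp (f n) 2 (surfaceMeasure U) := fun n =>
    memLp_surfaceMeasure hU hUb (hf n).continuous
  have htr : ∃ w, IsTrace U v w := by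
    have hc : CauchySeq fun n => (hmem n).toLp := by
      rw [Lp.cauchySeq_Lp_iff_cauchySeq_eLpNorm]
      have hlim : Tendsto (fun n : ℕ × ℕ => C *
          (sobolevDist U (f n.1) v (fun i => weakPartial U i v) +
            sobolevDist U (f n.2) v fun i => weakPartial U i v)) atTop (𝓝 0) := by
        rw [← prod_atTop_atTop_eq]
        simpa using ENNReal.Tendsto.const_mul
          ((hfv.comp tendsto_fst).add (hfv.comp tendsto_snd)) (Or.inr hC)
      refine tendsto_of_tendsto_of_tendsto_of_le_of_le tendsto_const_nhds hlim
        (fun _ => zero_le) fun n => ?_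
      refine le_of_eq_of_le (eLpNorm_congr_ae ?_) (hle _ _ v _ (hf1 n.1) (hf1 n.2) hv.1 hGm)
      exact (hmem n.1).coeFn_toLp.sub (hmem n.2).coeFn_toLp
    obtain ⟨w, hw⟩ := cauchySeq_tendsto_of_complete hc
    refine ⟨w, hv, hG, Lp.memLp w, f, hf, ?_, fun i => ?_, ?_⟩
    · exact tendsto_of_tendsto_of_tendsto_of_le_of_le tendsto_const_nhds hfv
        (fun _ => zero_le) fun n => le_self_add
    · refine tendsto_of_tendsto_of_tendsto_of_le_of_le tendsto_const_nhds hfv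
        (fun _ => zero_le) fun n => le_add_of_nonneg_of_le zero_le ?_
      exact Finset.single_le_sum (f := fun i => eLpNorm (fun x => fderiv ℝ (f n) x (unitVec i) -
        weakPartial U i v x) 2 (volume.restrict U)) (fun _ _ => zero_le) (Finset.mem_univ i)
    · refine ((Lp.tendsto_Lp_iff_tendsto_eLpNorm' _ _).1 hw).congr fun n => ?_
      exact eLpNorm_congr_ae ((hmem n).coeFn_toLp.sub (ae_eq_refl _))
  have hspec : IsTrace U v (trace U v) := by
    rw [trace, dif_pos htr]
    exact htr.choose_spec
  -- The trace is a chosen function and comes with its own approximating sequence `g`. Comparing `f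
  -- n` with `g n` on the boundary transfers the convergence to `f`.
  obtain ⟨-, -, hw, g, hg, hg0, hg1, hgw⟩ := hspec
  refine ⟨hw, ?_⟩
  have hg1' : ∀ n, ContDiff ℝ 1 (g n) := fun n => (hg n).of_le (by simp)
  have hgv : Tendsto (fun n => sobolevDist U (g n) v fun i => weakPartial U i v) atTop
      (𝓝 0) := by
    simpa [sobolevDist] using hg0.add (tendsto_finsetSum Finset.univ fun i _ => hg1 i)
  have hlim : Tendsto (fun n => C * (sobolevDist U (f n) v (fun i => weakPartial U i v) +
      sobolevDist U (g n) v fun i => weakPartial U i v) +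
      eLpNorm (fun x => g n x - trace U v x) 2 (surfaceMeasure U)) atTop (𝓝 0) := by
    simpa using (ENNReal.Tendsto.const_mul (hfv.add hgv) (Or.inr hC)).add hgw
  refine tendsto_of_tendsto_of_tendsto_of_le_of_le tendsto_const_nhds hlim
    (fun _ => zero_le) fun n => ?_
  have h1 := eLpNorm_add_le (p := 2) (μ := surfaceMeasure U)
    ((hmem n).1.sub (memLp_surfaceMeasure hU hUb (hg n).continuous).1)
    ((memLp_surfaceMeasure hU hUb (hg n).continuous).1.sub hw.1) (by norm_num)
  refine le_trans (le_of_eq ?_) (h1.trans (add_le_add (hle _ _ v _ (hf1 n) (hg1' n) hv.1 hGm)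
    le_rfl))
  congr 1
  funext x
  simp

end Traces

end Carleman

namespace Carleman

/-! ### Complex-valued functions and `C^{1,1}` data -/

section ComplexCarleman

variable {d : ℕ}

theorem gradient_apply {f : E d → ℝ} {x : E d} (h : DifferentiableAt ℝ f x) (i : Fin d) :
    gradient f x i = fderiv ℝ f x (unitVec i) := by
  rw [h.hasFDerivAt_innerSL_gradient.fderiv, innerSL_apply_apply, unitVec,
    EuclideanSpace.inner_single_right]
  simp only [conj_trivial, one_mul]

/-- Stated for a general real functional `π` so that real and imaginary parts are handled at once.
-/
theorem gradient_comp_apply (π : ℂ →L[ℝ] ℝ) {w : E d → ℂ} (hw : ContDiff ℝ ∞ w) (x : E d)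
    (i : Fin d) : gradient (fun y => π (w y)) x i = π (fderiv ℝ w x (unitVec i)) := by
  have hwx := hw.differentiable (by simp) x
  have h : HasFDerivAt (fun y => π (w y)) _ x := π.hasFDerivAt.comp x hwx.hasFDerivAt
  rw [gradient_apply h.differentiableAt, h.fderiv]
  rfl

theorem norm_sq_gradient_comp (π : ℂ →L[ℝ] ℝ) {w : E d → ℂ} (hw : ContDiff ℝ ∞ w) (x : E d) :
    ‖gradient (fun y => π (w y)) x‖ ^ 2 = ∑ i, π (fderiv ℝ w x (unitVec i)) ^ 2 := by
  rw [EuclideanSpace.real_norm_sq_eq]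
  simp only [gradient_comp_apply π hw]

theorem tr_fderiv_gradient_comp (π : ℂ →L[ℝ] ℝ) {w : E d → ℂ} (hw : ContDiff ℝ ∞ w) (x : E d) :
    tr (fderiv ℝ (gradient fun y => π (w y)) x) =
      ∑ i, π (fderiv ℝ (fun y => fderiv ℝ w y (unitVec i)) x (unitVec i)) := by
  refine Finset.sum_congr rfl fun i _ => ?_
  have hu : ContDiff ℝ ∞ fun y => π (w y) := π.contDiff.comp hw
  have h1 := ((contDiff_gradient hu).differentiable (by simp) x).hasFDerivAt
  have h2 := (EuclideanSpace.proj (𝕜 := ℝ) i).hasFDerivAt.comp x h1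
  have hd : DifferentiableAt ℝ (fun y => fderiv ℝ w y (unitVec i)) x :=
    ((hw.fderiv_right (m := ∞) le_rfl).clm_apply contDiff_const).differentiable (by simp) x
  have h3 := π.hasFDerivAt.comp x hd.hasFDerivAt
  have h4 : (fun y => gradient (fun y => π (w y)) y i) =
      fun y => π (fderiv ℝ w y (unitVec i)) := funext fun y => gradient_comp_apply π hw y i
  have h5 : HasFDerivAt (fun y => gradient (fun y => π (w y)) y i) _ x := h2
  rw [h4] at h5
  exact DFunLike.congr_fun (h5.unique h3) (unitVec i)

/-- The operator `∇·(α∇w)` in expanded form, `𝒜` being the gradient of `α`. -/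
noncomputable def expandedOp (α : E d → ℝ) (𝒜 : E d → E d) (w : E d → ℂ) (x : E d) : ℂ :=
  ∑ i, (𝒜 x i • fderiv ℝ w x (unitVec i) +
    α x • fderiv ℝ (fun y => fderiv ℝ w y (unitVec i)) x (unitVec i))

theorem map_expandedOp (π : ℂ →L[ℝ] ℝ) {w : E d → ℂ} (hw : ContDiff ℝ ∞ w) (α : E d → ℝ)
    (𝒜 : E d → E d) (x : E d) : π (expandedOp α 𝒜 w x) =
      α x * tr (fderiv ℝ (gradient fun y => π (w y)) x) +
        inner ℝ (𝒜 x) (gradient (fun y => π (w y)) x) := by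
  rw [tr_fderiv_gradient_comp π hw, expandedOp, map_sum, PiLp.inner_apply, Finset.mul_sum,
    ← Finset.sum_add_distrib]
  refine Finset.sum_congr rfl fun i _ => ?_
  rw [gradient_comp_apply π hw]
  simp only [map_add, map_smul, smul_eq_mul, RCLike.inner_apply, conj_trivial]
  ring

theorem continuous_expandedOp {α : E d → ℝ} {𝒜 : E d → E d} (hα : Continuous α)
    (h𝒜 : Continuous 𝒜) {w : E d → ℂ} (hw : ContDiff ℝ ∞ w) :
    Continuous (expandedOp α 𝒜 w) := by
  have h1 : ∀ i : Fin d, ContDiff ℝ ∞ fun y => fderiv ℝ w y (unitVec i) := fun i =>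
    (hw.fderiv_right le_rfl).clm_apply contDiff_const
  have h2 : ∀ i : Fin d, Continuous fun x =>
      fderiv ℝ (fun y => fderiv ℝ w y (unitVec i)) x (unitVec i) := fun i =>
    ((h1 i).continuous_fderiv (by simp)).clm_apply continuous_const
  have h3 := fun i => (h1 i).continuous
  refine continuous_finsetSum _ fun i _ => ?_
  exact (((EuclideanSpace.proj (𝕜 := ℝ) i).continuous.comp h𝒜).smul (h3 i)).add (hα.smul (h2 i))

theorem norm_sq_eq_reCLM_sq_add_imCLM_sq (z : ℂ) : ‖z‖ ^ 2 = Complex.reCLM z ^ 2 + Complex.imCLM z ^ 2 := by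
  rw [← Complex.normSq_eq_norm_sq, Complex.normSq_apply, Complex.reCLM_apply, Complex.imCLM_apply]
  ring

theorem lintegral_energy_eq_add {μ : Measure (E d)} {p q : E d → ℝ} (hp : Continuous p)
    (hq : Continuous q) (hp0 : ∀ x, 0 ≤ p x) (hq0 : ∀ x, 0 ≤ q x) {w : E d → ℂ}
    (hw : ContDiff ℝ ∞ w) :
    ∫⁻ x, ENNReal.ofReal (p x * ‖w x‖ ^ 2 + q x * ∑ i, ‖fderiv ℝ w x (unitVec i)‖ ^ 2) ∂μ =
      (∫⁻ x, ENNReal.ofReal (p x * Complex.reCLM (w x) ^ 2 +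
        q x * ‖gradient (fun y => Complex.reCLM (w y)) x‖ ^ 2) ∂μ) +
      (∫⁻ x, ENNReal.ofReal (p x * Complex.imCLM (w x) ^ 2 +
        q x * ‖gradient (fun y => Complex.imCLM (w y)) x‖ ^ 2) ∂μ) := by
  have hwc := hw.continuous
  have hg := (contDiff_gradient (Complex.reCLM.contDiff.comp hw)).continuous
  have hm : Continuous fun x => p x * Complex.reCLM (w x) ^ 2 +
      q x * ‖gradient (fun y => Complex.reCLM (w y)) x‖ ^ 2 := by
    have : Continuous (gradient fun y => Complex.reCLM (w y)) := hg
    fun_prop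
  rw [← lintegral_add_left hm.measurable.ennreal_ofReal]
  refine lintegral_congr fun x => ?_
  have := hp0 x
  have := hq0 x
  rw [← ENNReal.ofReal_add (by positivity) (by positivity), norm_sq_gradient_comp _ hw,
    norm_sq_gradient_comp _ hw, norm_sq_eq_reCLM_sq_add_imCLM_sq]
  simp only [norm_sq_eq_reCLM_sq_add_imCLM_sq, Finset.sum_add_distrib]
  ring_nf

theorem lintegral_op_eq_add {μ : Measure (E d)} {p : E d → ℝ} (hp : Continuous p)
    (hp0 : ∀ x, 0 ≤ p x) {α : E d → ℝ} {𝒜 : E d → E d} (hα : Continuous α)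
    (h𝒜 : Continuous 𝒜) {w : E d → ℂ} (hw : ContDiff ℝ ∞ w) :
    ∫⁻ x, ENNReal.ofReal (p x * ‖expandedOp α 𝒜 w x‖ ^ 2) ∂μ =
      (∫⁻ x, ENNReal.ofReal (p x *
        (α x * tr (fderiv ℝ (gradient fun y => Complex.reCLM (w y)) x) +
          inner ℝ (𝒜 x) (gradient (fun y => Complex.reCLM (w y)) x)) ^ 2) ∂μ) +
      (∫⁻ x, ENNReal.ofReal (p x *
        (α x * tr (fderiv ℝ (gradient fun y => Complex.imCLM (w y)) x) +
          inner ℝ (𝒜 x) (gradient (fun y => Complex.imCLM (w y)) x)) ^ 2) ∂μ) := by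
  simp only [← map_expandedOp _ hw]
  have hc := continuous_expandedOp hα h𝒜 hw
  have hm : Continuous fun x => p x * Complex.reCLM (expandedOp α 𝒜 w x) ^ 2 := by fun_prop
  rw [← lintegral_add_left hm.measurable.ennreal_ofReal]
  refine lintegral_congr fun x => ?_
  have := hp0 x
  rw [← ENNReal.ofReal_add (by positivity) (by positivity), norm_sq_eq_reCLM_sq_add_imCLM_sq]
  ring_nf

/-- The coefficients being real, the operator commutes with real and imaginary parts, and each of
the three integrals is the sum of its two parts. -/
theorem exists_complex_carleman {U : Set (E d)} (hU : IsLipschitzDomain U)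
    (hUb : Bornology.IsBounded U) (hUc : Uᶜ.Nonempty) {ψ α : E d → ℝ} {Ψ 𝒜 : E d → E d}
    {K : ℝ≥0} {a₀ a₁ b c : ℝ} (hψc : Continuous ψ) (hΨ : LipschitzWith K Ψ)
    (hψ : ∀ x ∈ U, HasFDerivAt ψ (innerSL ℝ (Ψ x)) x) (hαc : Continuous α)
    (h𝒜c : Continuous 𝒜) (ha₀ : 0 < a₀) (hα : ∀ x ∈ U, a₀ ≤ α x) (h𝒜 : ∀ x ∈ U, ‖𝒜 x‖ ≤ a₁)
    (hc : 0 < c) (hΨc : ∀ x ∈ U, c ≤ ‖Ψ x‖) (hb : 0 ≤ b) (hΨb : ∀ x ∈ closure U, ‖Ψ x‖ ≤ b)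
    (hψ0 : ∀ x ∈ closure U, 0 ≤ ψ x) :
    ∃ γs : ℝ, 1 ≤ γs ∧ ∃ τs : ℝ, 1 ≤ τs ∧ ∃ C : ℝ, 0 < C ∧ ∀ τ : ℝ, τs ≤ τ → ∀ γ : ℝ, γs ≤ γ →
      ∀ w : E d → ℂ, ContDiff ℝ ∞ w →
        (∫⁻ x in U, ENNReal.ofReal
            (τ ^ 3 * γ ^ 4 * weight γ ψ x ^ 3 * Real.exp (2 * τ * weight γ ψ x) * ‖w x‖ ^ 2
              + τ * γ ^ 2 * Real.exp (2 * τ * weight γ ψ x) *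
                ∑ i, ‖fderiv ℝ w x (unitVec i)‖ ^ 2))
          ≤ ENNReal.ofReal C *
            ((∫⁻ x in U, ENNReal.ofReal (Real.exp (2 * τ * weight γ ψ x) *
                ‖expandedOp α 𝒜 w x‖ ^ 2))
              + (∫⁻ x, ENNReal.ofReal
                (τ ^ 3 * γ ^ 3 * weight γ ψ x ^ 3 * Real.exp (2 * τ * weight γ ψ x) * ‖w x‖ ^ 2
                  + τ * γ * weight γ ψ x * Real.exp (2 * τ * weight γ ψ x) *
                    ∑ i, ‖fderiv ℝ w x (unitVec i)‖ ^ 2)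
                ∂(surfaceMeasure U))) := by
  obtain ⟨γs, hγs, τs, hτs, C, hC, h⟩ := exists_real_carleman hU hUb hUc hψc hΨ hψ hαc h𝒜c ha₀ hα
    h𝒜 hc hΨc hb hΨb hψ0
  refine ⟨γs, hγs, τs, hτs, C, hC, fun τ hτ γ hγ w hw => ?_⟩
  have hτ0 : 0 ≤ τ := by linarith
  have hγ0 : 0 ≤ γ := by linarith
  have hφ : Continuous fun x => weight γ ψ x := by unfold weight; fun_prop
  have hφ0 : ∀ x, 0 < weight γ ψ x := fun x => Real.exp_pos _
  have hφ0' : ∀ x, 0 ≤ weight γ ψ x := fun x => (hφ0 x).le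
  rw [lintegral_energy_eq_add (by fun_prop) (by fun_prop)
      (fun x => by have := hφ0' x; positivity) (fun x => by have := hφ0' x; positivity) hw,
    lintegral_energy_eq_add (by fun_prop) (by fun_prop)
      (fun x => by have := hφ0' x; positivity) (fun x => by have := hφ0' x; positivity) hw,
    lintegral_op_eq_add (by fun_prop) (fun x => by positivity) hαc h𝒜c hw, add_add_add_comm,
    mul_add]
  exact add_le_add (h τ hτ γ hγ _ (Complex.reCLM.contDiff.comp hw))
    (h τ hτ γ hγ _ (Complex.imCLM.contDiff.comp hw))

/-- The function is extended by Tietze's theorem and its gradient, independently, as a Lipschitz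
map. Outside `U` the two extensions need not be related. -/
theorem IsC11.exists_extension {U : Set (E d)} (hUo : IsOpen U) {f : E d → ℝ} (hf : IsC11 U f) :
    ∃ (g : E d → ℝ) (G : E d → E d) (K : ℝ≥0), Continuous g ∧ LipschitzWith K G ∧
      (∀ x ∈ closure U, g x = f x) ∧ (∀ x ∈ U, G x = gradient f x) ∧
      ∀ x ∈ U, HasFDerivAt g (innerSL ℝ (G x)) x := by
  obtain ⟨hfc, hfd, K, hK⟩ := hf
  obtain ⟨G, hG, hGU⟩ := hK.extend_finite_dimension
  obtain ⟨g, hg⟩ := ContinuousMap.exists_restrict_eq (Y := ℝ) isClosed_closure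
    ⟨(closure U).domRestrict f, hfc.domRestrict⟩
  have hgf : ∀ x ∈ closure U, g x = f x := fun x hx => DFunLike.congr_fun hg ⟨x, hx⟩
  refine ⟨g, G, _, g.continuous, hG, hgf, fun x hx => (hGU hx).symm, fun x hx => ?_⟩
  have h1 := (hfd.differentiableAt (hUo.mem_nhds hx)).hasFDerivAt_innerSL_gradient
  rw [hGU hx] at h1
  refine h1.congr_of_eventuallyEq ?_
  filter_upwards [hUo.mem_nhds hx] with y hy using hgf y (subset_closure hy)

theorem weight_congr {γ : ℝ} {ψ ψ' : E d → ℝ} {x : E d} (h : ψ x = ψ' x) :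
    weight γ ψ x = weight γ ψ' x := by
  rw [weight, weight, h]

theorem exists_smooth_carleman (hd : d ≠ 0) {U : Set (E d)} (hU : IsLipschitzDomain U)
    (hUb : Bornology.IsBounded U) {α ψ : E d → ℝ} (hα : IsC11 U α)
    (hαpos : ∀ x ∈ closure U, 0 < α x) (hψ : IsC11 U ψ) {c : ℝ} (hc : 0 < c)
    (hgrad : ∀ x ∈ U, c ≤ ‖gradient ψ x‖) (hψ0 : ∀ x ∈ frontier U, 0 ≤ ψ x) :
    ∃ γs : ℝ, 1 ≤ γs ∧ ∃ τs : ℝ, 1 ≤ τs ∧ ∃ C : ℝ, 0 < C ∧ ∀ τ : ℝ, τs ≤ τ → ∀ γ : ℝ, γs ≤ γ →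
      ∀ w : E d → ℂ, ContDiff ℝ ∞ w →
        (∫⁻ x in U, ENNReal.ofReal
            (τ ^ 3 * γ ^ 4 * weight γ ψ x ^ 3 * Real.exp (2 * τ * weight γ ψ x) * ‖w x‖ ^ 2
              + τ * γ ^ 2 * Real.exp (2 * τ * weight γ ψ x) *
                ∑ i, ‖fderiv ℝ w x (unitVec i)‖ ^ 2))
          ≤ ENNReal.ofReal C *
            ((∫⁻ x in U, ENNReal.ofReal (Real.exp (2 * τ * weight γ ψ x) *
                ‖expandedOp α (gradient α) w x‖ ^ 2))
              + (∫⁻ x, ENNReal.ofReal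
                (τ ^ 3 * γ ^ 3 * weight γ ψ x ^ 3 * Real.exp (2 * τ * weight γ ψ x) * ‖w x‖ ^ 2
                  + τ * γ * weight γ ψ x * Real.exp (2 * τ * weight γ ψ x) *
                    ∑ i, ‖fderiv ℝ w x (unitVec i)‖ ^ 2)
                ∂(surfaceMeasure U))) := by
  have : NeZero d := ⟨hd⟩
  -- A bounded set cannot be the whole space when `d ≠ 0`; distances to `Uᶜ` are then meaningful.
  have hUc : Uᶜ.Nonempty := by
    rw [Set.nonempty_compl]
    rintro rfl
    exact NormedSpace.unbounded_univ ℝ (E d) hUb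
  have hcpt : IsCompact (closure U) := hUb.isCompact_closure
  obtain ⟨α', 𝒜, Kα, hα'c, h𝒜l, hα', h𝒜, hα'd⟩ := hα.exists_extension hU.1
  obtain ⟨ψ', Ψ, K, hψ'c, hΨl, hψ', hΨ, hψ'd⟩ := hψ.exists_extension hU.1
  obtain ⟨a₀, ha₀, hα₀⟩ : ∃ a₀ : ℝ, 0 < a₀ ∧ ∀ x ∈ U, a₀ ≤ α' x := by
    obtain ⟨a, ha, h⟩ := hcpt.exists_forall_le' hα'c.continuousOn
      (a := 0) fun x hx => by rw [hα' x hx]; exact hαpos x hx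
    exact ⟨a, ha, fun x hx => h x (subset_closure hx)⟩
  obtain ⟨a₁, ha₁⟩ := hcpt.exists_bound_of_continuousOn h𝒜l.continuous.continuousOn
  obtain ⟨b, hb⟩ := hcpt.exists_bound_of_continuousOn hΨl.continuous.continuousOn
  -- A minimum over the closure attained inside `U` would be a critical point, contradicting the
  -- lower bound on the gradient. It is therefore attained on the boundary, where the sign is given.
  have hψ'0 : ∀ x ∈ closure U, 0 ≤ ψ' x := by
    rcases (closure U).eq_empty_or_nonempty with he | hne
    · simp [he]
    obtain ⟨z, hz, hmin⟩ := hcpt.exists_isMinOn hne hψ'c.continuousOn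
    intro x hx
    refine le_trans ?_ (hmin hx)
    by_cases hzU : z ∈ U
    · exfalso
      have hloc : IsLocalMin ψ' z := by
        filter_upwards [hU.1.mem_nhds hzU] with y hy using hmin (subset_closure hy)
      have h0 := hloc.hasFDerivAt_eq_zero (hψ'd z hzU)
      have h1 : Ψ z = 0 := by
        have := DFunLike.congr_fun h0 (Ψ z)
        simpa using this
      have h2 := hgrad z hzU
      rw [← hΨ z hzU, h1, norm_zero] at h2
      linarith
    · rw [hψ' z hz]
      exact hψ0 z ⟨hz, by rwa [hU.1.interior_eq]⟩
  obtain ⟨γs, hγs, τs, hτs, C, hC, h⟩ := exists_complex_carleman hU hUb hUc hψ'c hΨl hψ'd hα'c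
    h𝒜l.continuous ha₀ hα₀ (fun x hx => ha₁ x (subset_closure hx)) hc
    (fun x hx => by rw [hΨ x hx]; exact hgrad x hx) (b := max b 0) (le_max_right _ _)
    (fun x hx => (hb x hx).trans (le_max_left _ _)) hψ'0
  refine ⟨γs, hγs, τs, hτs, C, hC, fun τ hτ γ hγ w hw => ?_⟩
  convert h τ hτ γ hγ w hw using 1
  · refine setLIntegral_congr_fun hU.1.measurableSet fun x hx => ?_
    simp only [weight_congr (γ := γ) (hψ' x (subset_closure hx))]
  · congr 2
    · refine setLIntegral_congr_fun hU.1.measurableSet fun x hx => ?_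
      simp only [weight_congr (γ := γ) (hψ' x (subset_closure hx)), expandedOp,
        hα' x (subset_closure hx), h𝒜 x hx]
    · refine setLIntegral_congr_fun isClosed_frontier.measurableSet fun x hx => ?_
      simp only [weight_congr (γ := γ) (hψ' x (frontier_subset_closure hx))]

end ComplexCarleman

end Carleman

namespace Carleman

/-! ### Weighted integrals under `L²` convergence -/

section LTwoLimits

variable {d : ℕ} {μ : Measure (E d)}

/-- Convergence in `L²(μ)`. -/
abbrev ConvergesL2 (μ : Measure (E d)) (f : ℕ → E d → ℂ) (g : E d → ℂ) : Prop :=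
  Tendsto (fun n => eLpNorm (fun x => f n x - g x) 2 μ) atTop (𝓝 0)

theorem ConvergesL2.congr {f f' : ℕ → E d → ℂ} {g g' : E d → ℂ} (h : ConvergesL2 μ f g)
    (hf : ∀ n, f n =ᵐ[μ] f' n) (hg : g =ᵐ[μ] g') : ConvergesL2 μ f' g' :=
  Tendsto.congr (fun n => eLpNorm_congr_ae ((hf n).sub hg)) h

theorem ConvergesL2.smul {f : ℕ → E d → ℂ} {g : E d → ℂ} (h : ConvergesL2 μ f g) {m : E d → ℝ}
    {M : ℝ} (hm : ∀ᵐ x ∂μ, ‖m x‖ ≤ M) :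
    ConvergesL2 μ (fun n x => m x • f n x) fun x => m x • g x := by
  have hlim : Tendsto (fun n => ENNReal.ofReal M * eLpNorm (fun x => f n x - g x) 2 μ) atTop
      (𝓝 0) := by
    simpa using ENNReal.Tendsto.const_mul h (Or.inr ENNReal.ofReal_ne_top)
  refine tendsto_of_tendsto_of_tendsto_of_le_of_le tendsto_const_nhds hlim (fun _ => zero_le)
    fun n => eLpNorm_le_mul_eLpNorm_of_ae_le_mul ?_ 2
  filter_upwards [hm] with x hx
  rw [← smul_sub, norm_smul]
  gcongr

theorem ConvergesL2.add {f f' : ℕ → E d → ℂ} {g g' : E d → ℂ} (h : ConvergesL2 μ f g)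
    (h' : ConvergesL2 μ f' g') (hf : ∀ n, AEStronglyMeasurable (f n) μ)
    (hf' : ∀ n, AEStronglyMeasurable (f' n) μ) (hg : AEStronglyMeasurable g μ)
    (hg' : AEStronglyMeasurable g' μ) :
    ConvergesL2 μ (fun n x => f n x + f' n x) fun x => g x + g' x := by
  have hlim := Tendsto.add h h'
  rw [add_zero] at hlim
  refine tendsto_of_tendsto_of_tendsto_of_le_of_le tendsto_const_nhds hlim (fun _ => zero_le)
    fun n => ?_
  refine le_of_eq_of_le ?_ (eLpNorm_add_le ((hf n).sub hg) ((hf' n).sub hg') (by norm_num))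
  congr 1
  funext x
  simp only [Pi.add_apply]
  ring

theorem ConvergesL2.sum {ι : Type*} {s : Finset ι} {f : ι → ℕ → E d → ℂ} {g : ι → E d → ℂ}
    (h : ∀ i, ConvergesL2 μ (f i) (g i)) (hf : ∀ i n, AEStronglyMeasurable (f i n) μ)
    (hg : ∀ i, AEStronglyMeasurable (g i) μ) :
    ConvergesL2 μ (fun n x => ∑ i ∈ s, f i n x) fun x => ∑ i ∈ s, g i x := by
  have hlim := tendsto_finsetSum s fun i _ => h i
  rw [Finset.sum_const_zero] at hlim
  refine tendsto_of_tendsto_of_tendsto_of_le_of_le tendsto_const_nhds hlim (fun _ => zero_le)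
    fun n => ?_
  refine le_of_eq_of_le ?_ (eLpNorm_sum_le (fun i _ => (hf i n).sub (hg i)) (by norm_num))
  congr 1
  funext x
  simp [Finset.sum_sub_distrib]

theorem ConvergesL2.tendsto_eLpNorm {f : ℕ → E d → ℂ} {g : E d → ℂ} (h : ConvergesL2 μ f g)
    (hf : ∀ n, AEStronglyMeasurable (f n) μ) (hg : AEStronglyMeasurable g μ) :
    Tendsto (fun n => eLpNorm (f n) 2 μ) atTop (𝓝 (eLpNorm g 2 μ)) := by
  have hup : Tendsto (fun n => eLpNorm g 2 μ + eLpNorm (fun x => f n x - g x) 2 μ) atTop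
      (𝓝 (eLpNorm g 2 μ)) := by
    simpa using tendsto_const_nhds.add h
  have hlo : Tendsto (fun n => eLpNorm g 2 μ - eLpNorm (fun x => f n x - g x) 2 μ) atTop
      (𝓝 (eLpNorm g 2 μ)) := by
    simpa using ENNReal.Tendsto.sub (tendsto_const_nhds (x := eLpNorm g 2 μ)) h
      (Or.inr ENNReal.zero_ne_top)
  refine tendsto_of_tendsto_of_tendsto_of_le_of_le hlo hup (fun n => ?_) fun n => ?_
  · rw [tsub_le_iff_right]
    refine le_of_eq_of_le ?_ ((eLpNorm_sub_le (hf n) ((hf n).sub hg) (by norm_num)))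
    congr 1
    funext x
    simp
  · refine le_of_eq_of_le ?_ (eLpNorm_add_le hg ((hf n).sub hg) (by norm_num))
    congr 1
    funext x
    simp

theorem lintegral_ofReal_mul_norm_sq {p : E d → ℝ} (hp : ∀ x, 0 ≤ p x) (g : E d → ℂ) :
    ∫⁻ x, ENNReal.ofReal (p x * ‖g x‖ ^ 2) ∂μ = eLpNorm (fun x => √(p x) • g x) 2 μ ^ 2 := by
  rw [eLpNorm_two_sq]
  refine lintegral_congr fun x => ?_
  rw [← ofReal_norm, ← ENNReal.ofReal_pow (norm_nonneg _), norm_smul,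
    Real.norm_of_nonneg (Real.sqrt_nonneg _), mul_pow, Real.sq_sqrt (hp x)]

variable {K s : Set (E d)} {ν : Measure (E d)}

/-- The integral is the squared `L²` norm of `√p • f`, and `√p` is bounded on the compact set, so
multiplication by it preserves `L²` convergence. -/
theorem ConvergesL2.tendsto_lintegral (hK : IsCompact K) (hs : MeasurableSet s) (hsK : s ⊆ K)
    {p : E d → ℝ} (hpc : ContinuousOn p K) (hp : ∀ x, 0 ≤ p x) {f : ℕ → E d → ℂ} {g : E d → ℂ}
    (h : ConvergesL2 (ν.restrict s) f g) (hf : ∀ n, AEStronglyMeasurable (f n) (ν.restrict s))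
    (hg : AEStronglyMeasurable g (ν.restrict s)) :
    Tendsto (fun n => ∫⁻ x in s, ENNReal.ofReal (p x * ‖f n x‖ ^ 2) ∂ν) atTop
      (𝓝 (∫⁻ x in s, ENNReal.ofReal (p x * ‖g x‖ ^ 2) ∂ν)) := by
  simp only [lintegral_ofReal_mul_norm_sq hp]
  have hc : ContinuousOn (fun x => √(p x)) K := hpc.sqrt
  obtain ⟨M, hM⟩ := hK.exists_bound_of_continuousOn hc
  have hm : AEStronglyMeasurable (fun x => √(p x)) (ν.restrict s) :=
    (hc.mono hsK).aestronglyMeasurable hs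
  refine ENNReal.Tendsto.pow (ConvergesL2.tendsto_eLpNorm (h.smul (M := M) ?_)
    (fun n => hm.smul (hf n)) (hm.smul hg))
  filter_upwards [ae_restrict_mem hs] with x hx using hM x (hsK hx)

theorem lintegral_energy_eq_sum (hs : MeasurableSet s) (hsK : s ⊆ K)
    {p q : E d → ℝ} (hpc : ContinuousOn p K) (hp : ∀ x, 0 ≤ p x) (hqc : ContinuousOn q K)
    (hq : ∀ x, 0 ≤ q x) {a : E d → ℂ} {b : Fin d → E d → ℂ}
    (ha : AEStronglyMeasurable a (ν.restrict s))
    (hb : ∀ i, AEStronglyMeasurable (b i) (ν.restrict s)) :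
    ∫⁻ x in s, ENNReal.ofReal (p x * ‖a x‖ ^ 2 + q x * ∑ i, ‖b i x‖ ^ 2) ∂ν =
      (∫⁻ x in s, ENNReal.ofReal (p x * ‖a x‖ ^ 2) ∂ν) +
        ∑ i, ∫⁻ x in s, ENNReal.ofReal (q x * ‖b i x‖ ^ 2) ∂ν := by
  have hpm := ((hpc.mono hsK).aestronglyMeasurable hs (μ := ν)).aemeasurable
  have hqm := ((hqc.mono hsK).aestronglyMeasurable hs (μ := ν)).aemeasurable
  have h1 : AEMeasurable (fun x => ENNReal.ofReal (p x * ‖a x‖ ^ 2)) (ν.restrict s) :=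
    (hpm.mul (ha.norm.aemeasurable.pow_const 2)).ennreal_ofReal
  have h2 : ∀ i, AEMeasurable (fun x => ENNReal.ofReal (q x * ‖b i x‖ ^ 2)) (ν.restrict s) :=
    fun i => (hqm.mul ((hb i).norm.aemeasurable.pow_const 2)).ennreal_ofReal
  rw [← lintegral_finsetSum' _ fun i _ => h2 i, ← lintegral_add_left' h1]
  refine lintegral_congr fun x => ?_
  have hp' := hp x
  have hq' := hq x
  rw [ENNReal.ofReal_add (by positivity) (by positivity), Finset.mul_sum,
    ENNReal.ofReal_sum_of_nonneg fun i _ => by positivity]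

theorem tendsto_lintegral_energy (hK : IsCompact K) (hs : MeasurableSet s) (hsK : s ⊆ K)
    {p q : E d → ℝ} (hpc : ContinuousOn p K) (hp : ∀ x, 0 ≤ p x) (hqc : ContinuousOn q K)
    (hq : ∀ x, 0 ≤ q x) {f : ℕ → E d → ℂ} (hf : ∀ n, ContDiff ℝ ∞ (f n)) {a : E d → ℂ}
    {b : Fin d → E d → ℂ} (ha : AEStronglyMeasurable a (ν.restrict s))
    (hb : ∀ i, AEStronglyMeasurable (b i) (ν.restrict s)) (hfa : ConvergesL2 (ν.restrict s) f a)
    (hfb : ∀ i, ConvergesL2 (ν.restrict s) (fun n x => fderiv ℝ (f n) x (unitVec i)) (b i)) :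
    Tendsto (fun n => ∫⁻ x in s, ENNReal.ofReal (p x * ‖f n x‖ ^ 2 +
        q x * ∑ i, ‖fderiv ℝ (f n) x (unitVec i)‖ ^ 2) ∂ν) atTop
      (𝓝 (∫⁻ x in s, ENNReal.ofReal (p x * ‖a x‖ ^ 2 + q x * ∑ i, ‖b i x‖ ^ 2) ∂ν)) := by
  have h0 : ∀ n, AEStronglyMeasurable (f n) (ν.restrict s) := fun n =>
    (hf n).continuous.aestronglyMeasurable
  have h1 : ∀ i n, AEStronglyMeasurable (fun x => fderiv ℝ (f n) x (unitVec i))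
      (ν.restrict s) := fun i n =>
    (((hf n).continuous_fderiv (by simp)).clm_apply continuous_const).aestronglyMeasurable
  rw [lintegral_energy_eq_sum hs hsK hpc hp hqc hq ha hb]
  simp only [fun n => lintegral_energy_eq_sum hs hsK hpc hp hqc hq (h0 n) fun i => h1 i n]
  exact (hfa.tendsto_lintegral hK hs hsK hpc hp h0 ha).add (tendsto_finsetSum _ fun i _ =>
    (hfb i).tendsto_lintegral hK hs hsK hqc hq (h1 i) (hb i))

end LTwoLimits

/-! ### Density of smooth functions, with operator and traces -/

section Density

variable {d : ℕ} {U : Set (E d)}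

theorem IsC11.contDiffOn (hUo : IsOpen U) {α : E d → ℝ} (hα : IsC11 U α) :
    ContDiffOn ℝ 1 α U := by
  obtain ⟨-, hd, K, hK⟩ := hα
  have h := (contDiffOn_succ_iff_fderiv_of_isOpen (𝕜 := ℝ) (n := 0) (f := α) hUo).2
    ⟨hd, by simp, ?_⟩
  · simpa using h
  · rw [contDiffOn_zero]
    refine ((innerSL ℝ).continuous.comp_continuousOn hK.continuousOn).congr fun x hx => ?_
    exact (hd.differentiableAt (hUo.mem_nhds hx)).hasFDerivAt_innerSL_gradient.fderiv

theorem IsC11.exists_bound (hUo : IsOpen U) (hUb : Bornology.IsBounded U) {α : E d → ℝ}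
    (hα : IsC11 U α) : ∃ M : ℝ, ∀ x ∈ U, ‖α x‖ ≤ M ∧ ∀ i, ‖gradient α x i‖ ≤ M := by
  obtain ⟨g, G, K, hg, hG, hgα, hGα, -⟩ := hα.exists_extension hUo
  obtain ⟨M₁, hM₁⟩ := hUb.isCompact_closure.exists_bound_of_continuousOn hg.continuousOn
  obtain ⟨M₂, hM₂⟩ :=
    hUb.isCompact_closure.exists_bound_of_continuousOn hG.continuous.continuousOn
  refine ⟨max M₁ M₂, fun x hx => ⟨?_, fun i => ?_⟩⟩
  · rw [← hgα x (subset_closure hx)]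
    exact (hM₁ x (subset_closure hx)).trans (le_max_left _ _)
  · rw [← hGα x hx]
    exact (PiLp.norm_apply_le _ i).trans ((hM₂ x (subset_closure hx)).trans (le_max_right _ _))

/-- The product rule for the weak derivatives of `α ∂ᵢu`, and the convergence of the corresponding
expressions along an approximating sequence. -/
theorem weakPartial_coeff_mul (hUo : IsOpen U) (hUb : Bornology.IsBounded U) {α : E d → ℝ}
    (hα : IsC11 U α) {i : Fin d} {f : ℕ → E d → ℂ} (hf : ∀ n, ContDiff ℝ ∞ (f n)) {v h : E d → ℂ}
    (hv : MemLp v 2 (volume.restrict U)) (hh : MemLp h 2 (volume.restrict U))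
    (hfv : ConvergesL2 (volume.restrict U) f v)
    (hfh : ConvergesL2 (volume.restrict U) (fun n x => fderiv ℝ (f n) x (unitVec i)) h) :
    AEStronglyMeasurable (weakPartial U i fun y => (α y : ℂ) * v y) (volume.restrict U) ∧
    ConvergesL2 (volume.restrict U) (fun n x => gradient α x i • f n x +
      α x • fderiv ℝ (f n) x (unitVec i)) (weakPartial U i fun y => (α y : ℂ) * v y) := by
  obtain ⟨M, hM⟩ := hα.exists_bound hUo hUb
  have hα1 := hα.contDiffOn hUo
  have hαm : AEStronglyMeasurable α (volume.restrict U) :=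
    hα1.continuousOn.aestronglyMeasurable hUo.measurableSet
  have hgm : AEStronglyMeasurable (fun x => gradient α x i) (volume.restrict U) := by
    obtain ⟨-, -, K, hK⟩ := hα
    exact ((EuclideanSpace.proj (𝕜 := ℝ) i).continuous.comp_continuousOn
      hK.continuousOn).aestronglyMeasurable hUo.measurableSet
  have hαb : ∀ᵐ x ∂(volume.restrict U), ‖α x‖ ≤ M := by
    filter_upwards [ae_restrict_mem hUo.measurableSet] with x hx using (hM x hx).1
  have hgb : ∀ᵐ x ∂(volume.restrict U), ‖gradient α x i‖ ≤ M := by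
    filter_upwards [ae_restrict_mem hUo.measurableSet] with x hx using (hM x hx).2 i
  have hfm : ∀ n, AEStronglyMeasurable (f n) (volume.restrict U) := fun n =>
    (hf n).continuous.aestronglyMeasurable
  have hdm : ∀ n, AEStronglyMeasurable (fun x => fderiv ℝ (f n) x (unitVec i))
      (volume.restrict U) := fun n =>
    (((hf n).continuous_fderiv (by simp)).clm_apply continuous_const).aestronglyMeasurable
  have hconv : ConvergesL2 (volume.restrict U) (fun n x => gradient α x i • f n x +
      α x • fderiv ℝ (f n) x (unitVec i)) fun x => gradient α x i • v x + α x • h x :=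
    (hfv.smul hgb).add (hfh.smul hαb) (fun n => hgm.smul (hfm n)) (fun n => hαm.smul (hdm n))
      (hgm.smul hv.1) (hαm.smul hh.1)
  have hmem : ∀ {m : E d → ℝ} {w : E d → ℂ}, AEStronglyMeasurable m (volume.restrict U) →
      (∀ᵐ x ∂(volume.restrict U), ‖m x‖ ≤ M) → MemLp w 2 (volume.restrict U) →
      MemLp (fun x => m x • w x) 2 (volume.restrict U) := by
    intro m w hm hmb hw
    refine MemLp.of_le_mul (c := M) hw (hm.smul hw.1) ?_
    filter_upwards [hmb] with x hx
    rw [norm_smul]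
    gcongr
  have hwp : HasWeakPartial U i (fun y => (α y : ℂ) * v y)
      fun x => gradient α x i • v x + α x • h x := by
    -- Approximating by `α • f n` reduces the weak product rule to the classical one, as `α` is `C¹`
    -- on `U` with bounded values and gradient.
    refine hasWeakPartial_of_tendsto hUo (f := fun n x => α x • f n x)
      (fun n => hα1.smul ((hf n).of_le (by simp)).contDiffOn) ?_ ?_ ?_ ?_
    · simpa only [Complex.real_smul] using hmem hαm hαb hv
    · exact (hmem hgm hgb hv).add (hmem hαm hαb hh)
    · simpa only [Complex.real_smul] using hfv.smul hαb
    · refine hconv.congr (fun n => ?_) (ae_eq_refl _)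
      filter_upwards [ae_restrict_mem hUo.measurableSet] with x hx
      have hαx := hα.2.1.differentiableAt (hUo.mem_nhds hx)
      have hd : HasFDerivAt (fun y => α y • f n y) _ x :=
        hαx.hasFDerivAt.smul ((hf n).differentiable (by simp) x).hasFDerivAt
      rw [hd.fderiv, gradient_apply hαx]
      simp [add_comm]
  have hae := hwp.weakPartial_ae_eq hUo
  exact ⟨((hgm.smul hv.1).add (hαm.smul hh.1)).congr hae.symm,
    hconv.congr (fun _ => ae_eq_refl _) hae.symm⟩

theorem continuousOn_expandedOp_term (hUo : IsOpen U) {α : E d → ℝ} (hα : IsC11 U α) {w : E d → ℂ}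
    (hw : ContDiff ℝ ∞ w) (i : Fin d) :
    ContinuousOn (fun x => gradient α x i • fderiv ℝ w x (unitVec i) +
      α x • fderiv ℝ (fun y => fderiv ℝ w y (unitVec i)) x (unitVec i)) U := by
  obtain ⟨-, -, K, hK⟩ := id hα
  have h0 : ContDiff ℝ ∞ fun x => fderiv ℝ w x (unitVec i) :=
    (hw.fderiv_right le_rfl).clm_apply contDiff_const
  have h1 := (h0.continuous_fderiv (by simp)).clm_apply (continuous_const (y := unitVec i))
  refine ContinuousOn.add ?_ ?_
  · exact ((EuclideanSpace.proj (𝕜 := ℝ) i).continuous.comp_continuousOn hK.continuousOn).smul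
      h0.continuous.continuousOn
  · exact (hα.contDiffOn hUo).continuousOn.smul h1.continuousOn

/-- Functions in `H²(U)` are approximated by smooth functions together with their derivatives, the
elliptic operator and the traces. -/
theorem MemH2.exists_approx (hU : IsLipschitzDomain U) (hUb : Bornology.IsBounded U) {α : E d → ℝ}
    (hα : IsC11 U α) {u : E d → ℂ} (hu : MemH2 U u) :
    ∃ f : ℕ → E d → ℂ, (∀ n, ContDiff ℝ ∞ (f n)) ∧
      (AEStronglyMeasurable u (volume.restrict U) ∧ ConvergesL2 (volume.restrict U) f u) ∧
      (∀ i, AEStronglyMeasurable (weakPartial U i u) (volume.restrict U) ∧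
        ConvergesL2 (volume.restrict U) (fun n x => fderiv ℝ (f n) x (unitVec i))
          (weakPartial U i u)) ∧
      (AEStronglyMeasurable (fun x => -ellipticOp U α u x) (volume.restrict U) ∧
        ConvergesL2 (volume.restrict U) (fun n => expandedOp α (gradient α) (f n))
          fun x => -ellipticOp U α u x) ∧
      (AEStronglyMeasurable (trace U u) (surfaceMeasure U) ∧
        ConvergesL2 (surfaceMeasure U) f (trace U u)) ∧
      ∀ i, AEStronglyMeasurable (trace U (weakPartial U i u)) (surfaceMeasure U) ∧
        ConvergesL2 (surfaceMeasure U) (fun n x => fderiv ℝ (f n) x (unitVec i))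
          (trace U (weakPartial U i u)) := by
  obtain ⟨f, G, H, hf, hum, hGm, hHm, hfu, hfG, hfH⟩ := hu.exists_smooth_approx
  have hUo := hU.1
  have hf1 : ∀ i n, ContDiff ℝ ∞ fun x => fderiv ℝ (f n) x (unitVec i) := fun i n =>
    ((hf n).fderiv_right le_rfl).clm_apply contDiff_const
  have hG : ∀ i, HasWeakPartial U i u (G i) := fun i =>
    hasWeakPartial_of_tendsto hUo (fun n => ((hf n).of_le (by simp)).contDiffOn) hum (hGm i) hfu (hfG i)
  have hGae : ∀ i, weakPartial U i u =ᵐ[volume.restrict U] G i := fun i =>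
    (hG i).weakPartial_ae_eq hUo
  have hwm : ∀ i, MemLp (weakPartial U i u) 2 (volume.restrict U) := fun i =>
    (hGm i).ae_eq (hGae i).symm
  have hfw : ∀ i, ConvergesL2 (volume.restrict U) (fun n x => fderiv ℝ (f n) x (unitVec i))
      (weakPartial U i u) := fun i =>
    ConvergesL2.congr (hfG i) (fun _ => ae_eq_refl _) (hGae i).symm
  have hH : ∀ i j, HasWeakPartial U j (weakPartial U i u) (H i j) := fun i j =>
    hasWeakPartial_of_tendsto hUo (fun n => ((hf1 i n).of_le (by simp)).contDiffOn) (hwm i) (hHm i j)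
      (hfw i) (hfH i j)
  have htr := trace_spec hU hUb hf hum (fun i => ⟨G i, hG i, hGm i⟩) (by
    simpa [sobolevDist] using Tendsto.add hfu (tendsto_finsetSum Finset.univ fun i _ => hfw i))
  have htr1 := fun i => trace_spec hU hUb (hf1 i) (hwm i) (fun j => ⟨H i j, hH i j, hHm i j⟩) (by
    simpa [sobolevDist] using Tendsto.add (hfw i) (tendsto_finsetSum Finset.univ fun j _ =>
      ConvergesL2.congr (hfH i j) (fun _ => ae_eq_refl _) ((hH i j).weakPartial_ae_eq hUo).symm))
  have hop := fun i => weakPartial_coeff_mul hUo hUb hα (hf1 i) (hwm i) (hHm i i) (hfw i) (hfH i i)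
  -- `expandedOp` represents `∇·(α∇u)`, so the limit is the negative of `ellipticOp`; the sign
  -- disappears in the norm.
  have hneg : (fun x => -ellipticOp U α u x) = fun x =>
      ∑ i, weakPartial U i (fun y => (α y : ℂ) * weakPartial U i u y) x := by
    funext x
    rw [ellipticOp, neg_neg]
  refine ⟨f, hf, ⟨hum.1, hfu⟩, fun i => ⟨(hwm i).1, hfw i⟩, ?_, ⟨htr.1.1, htr.2⟩,
    fun i => ⟨(htr1 i).1.1, (htr1 i).2⟩⟩
  rw [hneg]
  refine ⟨Finset.aestronglyMeasurable_fun_sum _ fun i _ => (hop i).1,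
    ConvergesL2.sum (fun i => (hop i).2) (fun i n => ?_) fun i => (hop i).1⟩
  exact (continuousOn_expandedOp_term hUo hα (hf n) i).aestronglyMeasurable hUo.measurableSet

end Density

end Carleman

/-! ### Passage to the limit in the estimate -/

theorem lemma4p1 (d : ℕ) (hd : 2 ≤ d)
    (U : Set (Carleman.E d)) (hU : Carleman.IsLipschitzDomain U) (hUb : Bornology.IsBounded U)
    (α : Carleman.E d → ℝ) (hα : Carleman.IsC11 U α) (hαpos : ∀ x ∈ closure U, 0 < α x)
    (ψ : Carleman.E d → ℝ) (hψ : Carleman.IsC11 U ψ)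
    (c : ℝ) (hc : 0 < c) (hgrad : ∀ x ∈ U, c ≤ ‖gradient ψ x‖)
    (hψ0 : ∀ x ∈ frontier U, 0 ≤ ψ x) :
    ∃ γs : ℝ, 1 ≤ γs ∧ ∃ τs : ℝ, 1 ≤ τs ∧ ∃ C : ℝ, 0 < C ∧
      ∀ τ : ℝ, τs ≤ τ → ∀ γ : ℝ, γs ≤ γ → ∀ u : Carleman.E d → ℂ, Carleman.MemH2 U u →
        (∫⁻ x in U, ENNReal.ofReal
            (τ ^ 3 * γ ^ 4 * Carleman.weight γ ψ x ^ 3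
                * Real.exp (2 * τ * Carleman.weight γ ψ x) * ‖u x‖ ^ 2
              + τ * γ ^ 2 * Real.exp (2 * τ * Carleman.weight γ ψ x)
                * Carleman.gradNormSq U u x))
          ≤ ENNReal.ofReal C *
            ((∫⁻ x in U, ENNReal.ofReal
                (Real.exp (2 * τ * Carleman.weight γ ψ x) * ‖Carleman.ellipticOp U α u x‖ ^ 2))
              + (∫⁻ x, ENNReal.ofReal
                (τ ^ 3 * γ ^ 3 * Carleman.weight γ ψ x ^ 3
                    * Real.exp (2 * τ * Carleman.weight γ ψ x) * ‖Carleman.trace U u x‖ ^ 2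
                  + τ * γ * Carleman.weight γ ψ x
                    * Real.exp (2 * τ * Carleman.weight γ ψ x)
                    * Carleman.traceGradNormSq U u x)
                ∂(Carleman.surfaceMeasure U))) := by
  obtain ⟨γs, hγs, τs, hτs, C, hC, h⟩ := Carleman.exists_smooth_carleman (by omega) hU hUb hα
    hαpos hψ hc hgrad hψ0
  refine ⟨γs, hγs, τs, hτs, C, hC, fun τ hτ γ hγ u hu => ?_⟩
  obtain ⟨f, hf, hfu, hfw, hfL, hft, hftw⟩ := hu.exists_approx hU hUb hα
  have hτ0 : 0 ≤ τ := by linarith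
  have hγ0 : 0 ≤ γ := by linarith
  have hK : IsCompact (closure U) := hUb.isCompact_closure
  have hφ : ContinuousOn (fun x => Carleman.weight γ ψ x) (closure U) :=
    Real.continuous_exp.comp_continuousOn (continuousOn_const.mul hψ.1)
  have hφ0 : ∀ x, 0 ≤ Carleman.weight γ ψ x := fun x => (Real.exp_pos _).le
  have hexp : ContinuousOn (fun x => Real.exp (2 * τ * Carleman.weight γ ψ x)) (closure U) :=
    Real.continuous_exp.comp_continuousOn (continuousOn_const.mul hφ)
  have hUm := hU.1.measurableSet
  have hFm : MeasurableSet (frontier U) := isClosed_frontier.measurableSet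
  have h1 := Carleman.tendsto_lintegral_energy (ν := volume) hK hUm subset_closure
    (p := fun x => τ ^ 3 * γ ^ 4 * Carleman.weight γ ψ x ^ 3 *
      Real.exp (2 * τ * Carleman.weight γ ψ x))
    (q := fun x => τ * γ ^ 2 * Real.exp (2 * τ * Carleman.weight γ ψ x))
    ((continuousOn_const.mul (hφ.pow 3)).mul hexp)
    (fun x => by have := hφ0 x; positivity) (continuousOn_const.mul hexp)
    (fun x => by positivity) hf hfu.1 (fun i => (hfw i).1) hfu.2 fun i => (hfw i).2
  have h2 := Carleman.ConvergesL2.tendsto_lintegral hK hUm subset_closure hexp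
    (fun x => by positivity) hfL.2 (fun n => ?_) hfL.1
  · have h3 := Carleman.tendsto_lintegral_energy hK hFm frontier_subset_closure
      (p := fun x => τ ^ 3 * γ ^ 3 * Carleman.weight γ ψ x ^ 3 *
        Real.exp (2 * τ * Carleman.weight γ ψ x))
      (q := fun x => τ * γ * Carleman.weight γ ψ x * Real.exp (2 * τ * Carleman.weight γ ψ x))
      ((continuousOn_const.mul (hφ.pow 3)).mul hexp)
      (fun x => by have := hφ0 x; positivity) ((continuousOn_const.mul hφ).mul hexp)
      (fun x => by have := hφ0 x; positivity) hf hft.1 (fun i => (hftw i).1) hft.2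
      fun i => (hftw i).2
    simp only [norm_neg] at h2
    -- For fixed `τ` and `γ` the weights are bounded on the closure, so all three integrals converge
    -- along the approximating sequence. The constants do not depend on `n`.
    exact le_of_tendsto_of_tendsto' h1
      (ENNReal.Tendsto.const_mul (h2.add h3) (Or.inr ENNReal.ofReal_ne_top))
      fun n => h τ hτ γ hγ (f n) (hf n)
  · exact (continuousOn_finsetSum _ fun i _ =>
      Carleman.continuousOn_expandedOp_term hU.1 hα (hf n) i).aestronglyMeasurable hUm
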